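/- For a finite simple graph $G$ and a vertex $v$ let $\mathrm{cl}_G(v)=\max_{v'\in V(G)\setminus N[v]}|N(v)\cap N(v')|$ (with maximum $0$ over the empty set). The graph $G$ is called $c$-closed if $\mathrm{cl}_G(v)<c$ for all $v\in V(G)$. The problem Induced $(k_1,k_2)$-Biclique asks, given a graph $G$ and $k_1,k_2\in\mathbb N$ with $k_1\le k_2$, whether there are disjoint vertex sets $S,T\subseteq V(G)$ with $|S|=k_1$ and $|T|=k_2$ such that no two vertices of $S$ are adjacent, no two vertices of $T$ are adjacent, and every vertex of $S$ is adjacent to every vertex of $T$. Theorem. On instances with $k_1\ge 2$, Induced $(k_1,k_2)$-Biclique can be solved in $O^*(1.6107^c)$ time on $c$-closed graphs, where $O^*$ hides factors polynomial in the input size. That is, there are a single (deterministic) random access machine program and a polynomial $p$ such that for every $c$, every $c$-closed graph $G$ on $n$ vertices (given by its adjacency matrix) and all integers $2\le k_1\le k_2$ (given in binary), the program run on $(G,k_1,k_2)$ halts with the correct yes/no answer, with running time at most $1.6107^c\cdot p(n^2+\ell(k_1)+\ell(k_2))$, where $\ell$ denotes bit length. Running time is measured by the logarithmic cost criterion (each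 elementary operation costs one plus the bit length of the number it produces). -/

import Mathlib

/-! ### Random access machines with logarithmic cost

A program manipulates natural-number registers and zero-initialised arrays (indirect addressing).
A fixed program mentions only finitely many registers and arrays. Running time is measured by the
logarithmic cost criterion: each elementary operation costs one unit plus the bit length of the
number that it produces. -/

namespace RAM

/-- A memory state: the contents of the registers, and the cells of the arrays. -/
@[ext]
structure State where
  reg : ℕ → ℕ
  arr : ℕ → ℕ → ℕ

/-- Arithmetic expressions. `read a e` is the cell of array `a` whose index is the value of `e`. -/
inductive Term where
  | const (k : ℕ)
  | reg (x : ℕ)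
  | read (a : ℕ) (e : Term)
  | add (e f : Term)
  | sub (e f : Term)
  | mul (e f : Term)

/-- The value of an expression; `sub` is truncated subtraction. -/
def Term.val (s : State) : Term → ℕ
  | .const k => k
  | .reg x => s.reg x
  | .read a e => s.arr a (e.val s)
  | .add e f => e.val s + f.val s
  | .sub e f => e.val s - f.val s
  | .mul e f => e.val s * f.val s

/-- The logarithmic cost of evaluating an expression: every subexpression costs one plus the bit
length of its value. -/
def Term.cost (s : State) : Term → ℕ
  | .const k => 1 + Nat.size k
  | .reg x => 1 + Nat.size (s.reg x)
  | .read a e => 1 + Nat.size (s.arr a (e.val s)) + e.cost s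
  | .add e f => 1 + Nat.size (e.val s + f.val s) + (e.cost s + f.cost s)
  | .sub e f => 1 + Nat.size (e.val s - f.val s) + (e.cost s + f.cost s)
  | .mul e f => 1 + Nat.size (e.val s * f.val s) + (e.cost s + f.cost s)

/-- Programs. -/
inductive Program where
  | skip
  /-- register `x` := value of `e` -/
  | assign (x : ℕ) (e : Term)
  /-- array `a`, at index given by `i`, := value of `e` -/
  | write (a : ℕ) (i e : Term)
  | seq (p q : Program)
  /-- run `p` if `e` is nonzero, and `q` otherwise -/
  | ite (e : Term) (p q : Program)
  /-- repeat `p` as long as `e` is nonzero -/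
  | loop (e : Term) (p : Program)

def State.setReg (s : State) (x v : ℕ) : State :=
  { s with reg := Function.update s.reg x v }

def State.setArr (s : State) (a i v : ℕ) : State :=
  { s with arr := Function.update s.arr a (Function.update (s.arr a) i v) }

/-- `Runs p s t s'`: started in state `s`, the program `p` terminates in state `s'`, at total
cost exactly `t`. -/
inductive Runs : Program → State → ℕ → State → Prop
  | skip (s : State) : Runs .skip s 1 s
  | assign (s : State) (x : ℕ) (e : Term) :
      Runs (.assign x e) s (1 + e.cost s) (s.setReg x (e.val s))
  | write (s : State) (a : ℕ) (i e : Term) :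
      Runs (.write a i e) s (1 + i.cost s + e.cost s) (s.setArr a (i.val s) (e.val s))
  | seq {p q : Program} {s s' s'' : State} {t t' : ℕ} :
      Runs p s t s' → Runs q s' t' s'' → Runs (.seq p q) s (t + t') s''
  | ite_true {e : Term} {p q : Program} {s s' : State} {t : ℕ} :
      e.val s ≠ 0 → Runs p s t s' → Runs (.ite e p q) s (1 + e.cost s + t) s'
  | ite_false {e : Term} {p q : Program} {s s' : State} {t : ℕ} :
      e.val s = 0 → Runs q s t s' → Runs (.ite e p q) s (1 + e.cost s + t) s'
  | loop_done {e : Term} {p : Program} {s : State} :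
      e.val s = 0 → Runs (.loop e p) s (1 + e.cost s) s
  | loop_step {e : Term} {p : Program} {s s' s'' : State} {t t' : ℕ} :
      e.val s ≠ 0 → Runs p s t s' → Runs (.loop e p) s' t' s'' →
        Runs (.loop e p) s (1 + e.cost s + t + t') s''

/-- The machine is deterministic: final state and cost are determined by the initial state. -/
theorem Runs.deterministic {p : Program} {s s₁ s₂ : State} {t₁ t₂ : ℕ}
    (h₁ : Runs p s t₁ s₁) (h₂ : Runs p s t₂ s₂) : t₁ = t₂ ∧ s₁ = s₂ := by
  induction h₁ generalizing t₂ s₂ with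
  | skip => cases h₂; exact ⟨rfl, rfl⟩
  | assign => cases h₂; exact ⟨rfl, rfl⟩
  | write => cases h₂; exact ⟨rfl, rfl⟩
  | seq _ _ ih ih' =>
    cases h₂ with
    | seq a b =>
      obtain ⟨rfl, rfl⟩ := ih a
      obtain ⟨rfl, rfl⟩ := ih' b
      exact ⟨rfl, rfl⟩
  | ite_true h _ ih =>
    cases h₂ with
    | ite_true _ a => obtain ⟨rfl, rfl⟩ := ih a; exact ⟨rfl, rfl⟩
    | ite_false h' _ => exact absurd h' h
  | ite_false h _ ih =>
    cases h₂ with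
    | ite_true h' _ => exact absurd h h'
    | ite_false _ a => obtain ⟨rfl, rfl⟩ := ih a; exact ⟨rfl, rfl⟩
  | loop_done h =>
    cases h₂ with
    | loop_done _ => exact ⟨rfl, rfl⟩
    | loop_step h' _ _ => exact absurd h h'
  | loop_step h _ _ ih ih' =>
    cases h₂ with
    | loop_done h' => exact absurd h' h
    | loop_step _ a b =>
      obtain ⟨rfl, rfl⟩ := ih a
      obtain ⟨rfl, rfl⟩ := ih' b
      exact ⟨rfl, rfl⟩

end RAM

/-! ### Closure of graphs and induced bicliques -/

open Classical in
/-- The closure number of a vertex `v`: the largest number of common neighbours of `v` with a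
vertex outside the closed neighbourhood of `v` (zero if there is no such vertex). -/
noncomputable def SimpleGraph.closureNumber {V : Type*} [Fintype V] (G : SimpleGraph V) (v : V) :
    ℕ :=
  (Finset.univ.filter (fun u : V => u ≠ v ∧ ¬ G.Adj v u)).sup
    (fun u => (G.neighborSet v ∩ G.neighborSet u).ncard)

/-- A graph is `c`-closed if every vertex has closure number less than `c`. -/
def SimpleGraph.IsCClosed {V : Type*} [Fintype V] (G : SimpleGraph V) (c : ℕ) : Prop :=
  ∀ v : V, G.closureNumber v < c

/-- `G` has an induced biclique with sides of sizes exactly `k₁` and `k₂`. -/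
def SimpleGraph.HasInducedBiclique {V : Type*} (G : SimpleGraph V) (k₁ k₂ : ℕ) : Prop :=
  ∃ S T : Finset V, Disjoint S T ∧ S.card = k₁ ∧ T.card = k₂ ∧
    (∀ s ∈ S, ∀ s' ∈ S, ¬ G.Adj s s') ∧
    (∀ t ∈ T, ∀ t' ∈ T, ¬ G.Adj t t') ∧
    (∀ s ∈ S, ∀ t ∈ T, G.Adj s t)

open Classical in
/-- The initial memory on input `(G, k₁, k₂)`: registers 0, 1, 2 hold `n`, `k₁`, `k₂`, array 0
holds the adjacency matrix of `G` row by row, and everything else is zero. -/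
noncomputable def bicliqueInput {n : ℕ} (G : SimpleGraph (Fin n)) (k₁ k₂ : ℕ) : RAM.State where
  reg x := if x = 0 then n else if x = 1 then k₁ else if x = 2 then k₂ else 0
  arr a i := if a = 0 ∧ ∃ u v : Fin n, i = u.val * n + v.val ∧ G.Adj u v then 1 else 0

/-- The size of the input `(G, k₁, k₂)`: the bits of the adjacency matrix of an `n`-vertex graph
and of the binary representations of `k₁` and `k₂`. -/
def bicliqueInputSize (n k₁ k₂ : ℕ) : ℕ :=
  n ^ 2 + Nat.size k₁ + Nat.size k₂

namespace RAM

/-! ### Symbolic execution of programs -/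

/-! As 2 ≤ k₁ ≤ k₂, an induced biclique (S, T) contains two distinct nonadjacent vertices a, a' of S
and two distinct nonadjacent vertices d, d' of T. Guess this quadruple. Then S lies in N(d) ∩ N(d')
outside N(a) ∪ N(a'), and T lies in N(a) ∩ N(a') outside N(d) ∪ N(d'). Closedness bounds each of
these two sets by c - 1, so at most 2c - 2 candidates remain (`card_root_act`). Let two candidates
conflict if they are adjacent in G and on the same side, or nonadjacent and on different sides. The
independent sets of this conflict graph are exactly the induced bicliques among the candidates.

These independent sets are counted by their numbers of vertices on the two sides, through a
partition function. A vertex of the S-side has weight 2^w and one of the T-side weight 2^(w(n+1)),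
so a set with i and j vertices contributes 2^(w(i+(n+1)j)). For w = 5n + 1 there are fewer than 2^w
pairs of a quadruple and a set. Hence the sum over all quadruples has no carries in base 2^w, and
its digit at k₁ + (n+1)k₂ is nonzero exactly if the biclique exists (`exists_monomial_iff`,
`le_mod_iff`, `grand_iff`).

The partition function is evaluated in the larger class of two-spin systems, because that class is
closed under summing out a variable with at most two neighbours; a case distinction is needed only
for three or more (`Z_next`). The branching tree on m variables has at most 1.269^m leaves
(`leaves_le`). As long as some degree is at least 4, the value 1 forces all neighbours to 0, and a
measure that weights variables by degree gives the bound (`leaves_branch`). After that, variables of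
degree 2 are eliminated first, so branching happens only if all degrees are 3. Either branch then
turns three variables into degree-2 ones, which is enough because 2 ≤ 1.2⁴ (`leaves_cubic`). Finally
1.269² ≤ 1.6107.

The machine has no recursion. It enumerates the leaves with a binary counter of decisions and walks
down from the root for every leaf (`chain_leaves`, `okT_chain`). One step down at most doubles a
potential that bounds all relevant weights (`pot_next_le`), so all numbers have polynomially many
bits and a leaf costs polynomial time. -/

@[simp] theorem State.setReg_reg (s : State) (x v y : ℕ) :
    (s.setReg x v).reg y = if y = x then v else s.reg y := by
  simp [State.setReg, Function.update_apply]

@[simp] theorem State.setReg_arr (s : State) (x v : ℕ) : (s.setReg x v).arr = s.arr := rfl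

@[simp] theorem State.setArr_reg (s : State) (a i v : ℕ) : (s.setArr a i v).reg = s.reg := rfl

@[simp] theorem State.setArr_arr (s : State) (a i v b j : ℕ) :
    (s.setArr a i v).arr b j = if b = a ∧ j = i then v else s.arr b j := by
  simp only [State.setArr, Function.update_apply]
  by_cases h : b = a
  · subst h; simp [Function.update_apply]
  · simp [h]

/-! ### What a program leaves untouched. -/

/-- The registers assigned by a program. -/
def Program.wr : Program → ℕ → Bool
  | .skip, _ => false
  | .assign x _, y => x == y
  | .write _ _ _, _ => false
  | .seq p q, y => p.wr y || q.wr y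
  | .ite _ p q, y => p.wr y || q.wr y
  | .loop _ p, y => p.wr y

/-- The arrays written by a program. -/
def Program.wa : Program → ℕ → Bool
  | .skip, _ => false
  | .assign _ _, _ => false
  | .write a _ _, y => a == y
  | .seq p q, y => p.wa y || q.wa y
  | .ite _ p q, y => p.wa y || q.wa y
  | .loop _ p, y => p.wa y

/-- The states `s` and `s'` agree on everything that `p` does not write. -/
structure Frame (p : Program) (s s' : State) : Prop where
  reg : ∀ x, p.wr x = false → s'.reg x = s.reg x
  arr : ∀ a, p.wa a = false → s'.arr a = s.arr a

theorem Frame.refl (p : Program) (s : State) : Frame p s s := ⟨fun _ _ => rfl, fun _ _ => rfl⟩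

theorem Frame.trans {p : Program} {s s' s'' : State} (h : Frame p s s') (h' : Frame p s' s'') :
    Frame p s s'' :=
  ⟨fun x hx => (h'.reg x hx).trans (h.reg x hx), fun a ha => (h'.arr a ha).trans (h.arr a ha)⟩

/-- The write sets are computed from the syntax, so for concrete programs the claim that a register
or array survives is closed by `rfl`. -/
theorem Runs.frame {p : Program} {s s' : State} {t : ℕ} (h : Runs p s t s') : Frame p s s' := by
  induction h with
  | skip s => exact Frame.refl _ s
  | assign s x e =>
    refine ⟨fun y hy => ?_, fun _ _ => rfl⟩
    have : x ≠ y := by simpa [Program.wr] using hy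
    simp [Ne.symm this]
  | write s a i e =>
    refine ⟨fun _ _ => rfl, fun b hb => ?_⟩
    have : a ≠ b := by simpa [Program.wa] using hb
    funext j
    simp [Ne.symm this]
  | seq _ _ ih ih' =>
    refine ⟨fun y hy => ?_, fun y hy => ?_⟩
    · simp only [Program.wr, Bool.or_eq_false_iff] at hy
      rw [ih'.reg y hy.2, ih.reg y hy.1]
    · simp only [Program.wa, Bool.or_eq_false_iff] at hy
      rw [ih'.arr y hy.2, ih.arr y hy.1]
  | ite_true _ _ ih =>
    refine ⟨fun y hy => ?_, fun y hy => ?_⟩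
    · simp only [Program.wr, Bool.or_eq_false_iff] at hy
      exact ih.reg y hy.1
    · simp only [Program.wa, Bool.or_eq_false_iff] at hy
      exact ih.arr y hy.1
  | ite_false _ _ ih =>
    refine ⟨fun y hy => ?_, fun y hy => ?_⟩
    · simp only [Program.wr, Bool.or_eq_false_iff] at hy
      exact ih.reg y hy.2
    · simp only [Program.wa, Bool.or_eq_false_iff] at hy
      exact ih.arr y hy.2
  | loop_done _ => exact Frame.refl _ _
  | loop_step _ _ _ ih ih' => exact Frame.trans ⟨ih.reg, ih.arr⟩ ih'

/-! ### Word length and the cost of expressions. -/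

/-- All numbers in memory have at most `b` bits. -/
structure Bdd (b : ℕ) (s : State) : Prop where
  reg : ∀ x, s.reg x < 2 ^ b
  arr : ∀ a i, s.arr a i < 2 ^ b

theorem Bdd.setReg {b : ℕ} {s : State} (h : Bdd b s) {x v : ℕ} (hv : v < 2 ^ b) :
    Bdd b (s.setReg x v) :=
  ⟨fun y => by rw [State.setReg_reg]; split_ifs <;> [exact hv; exact h.reg y], h.arr⟩

theorem Bdd.setArr {b : ℕ} {s : State} (h : Bdd b s) {a i v : ℕ} (hv : v < 2 ^ b) :
    Bdd b (s.setArr a i v) :=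
  ⟨h.reg, fun c j => by rw [State.setArr_arr]; split_ifs <;> [exact hv; exact h.arr c j]⟩

/-- The length of an expression. -/
def Term.len : Term → ℕ
  | .const k => 1 + Nat.size k
  | .reg _ => 1
  | .read _ e => 1 + e.len
  | .add e f => 1 + (e.len + f.len)
  | .sub e f => 1 + (e.len + f.len)
  | .mul e f => 1 + (e.len + f.len)

/-- Products add bit lengths, and sums need at most one further bit. The factor b + 1 instead of b
pays for these carries and for constants, also when b = 0. -/
theorem Term.size_val_le {b : ℕ} {s : State} (h : Bdd b s) (e : Term) :
    Nat.size (e.val s) ≤ e.len * (b + 1) := by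
  induction e with
  | const k => simp only [Term.val, Term.len]; nlinarith [Nat.zero_le (Nat.size k * b)]
  | reg x =>
    have := Nat.size_le.2 (h.reg x)
    simp only [Term.val, Term.len]; omega
  | read a e ih =>
    have := Nat.size_le.2 (h.arr a (e.val s))
    simp only [Term.val, Term.len]; nlinarith [Nat.zero_le (e.len * (b + 1))]
  | add e f ihe ihf =>
    have he := Nat.size_le.1 ihe
    have hf := Nat.size_le.1 ihf
    simp only [Term.val, Term.len]
    refine Nat.size_le.2 ?_
    have h1 : (2:ℕ) ^ (e.len * (b + 1)) ≤ 2 ^ ((e.len + f.len) * (b + 1)) :=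
      Nat.pow_le_pow_right (by norm_num) (by nlinarith)
    have h2 : (2:ℕ) ^ (f.len * (b + 1)) ≤ 2 ^ ((e.len + f.len) * (b + 1)) :=
      Nat.pow_le_pow_right (by norm_num) (by nlinarith)
    have h3 : (2:ℕ) ^ ((e.len + f.len) * (b + 1) + 1) ≤ 2 ^ ((1 + (e.len + f.len)) * (b + 1)) :=
      Nat.pow_le_pow_right (by norm_num) (by nlinarith)
    rw [pow_succ] at h3
    omega
  | sub e f ihe ihf =>
    simp only [Term.val, Term.len]
    have := Nat.size_le_size (Nat.sub_le (e.val s) (f.val s))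
    nlinarith [Nat.zero_le (f.len * (b + 1))]
  | mul e f ihe ihf =>
    have he := Nat.size_le.1 ihe
    have hf := Nat.size_le.1 ihf
    simp only [Term.val, Term.len]
    refine Nat.size_le.2 ?_
    calc e.val s * f.val s < 2 ^ (e.len * (b + 1)) * 2 ^ (f.len * (b + 1)) :=
          Nat.mul_lt_mul'' he hf
      _ = 2 ^ ((e.len + f.len) * (b + 1)) := by rw [← pow_add]; ring_nf
      _ ≤ _ := Nat.pow_le_pow_right (by norm_num) (by nlinarith)

/-- A bound for the cost of evaluating an expression in a memory with `b`-bit numbers. -/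
def Term.bound (b : ℕ) (e : Term) : ℕ := e.len * (1 + e.len * (b + 1))

/-- There are at most `len` subexpressions, and each has a value of at most `len * (b + 1)` bits. -/
theorem Term.cost_le {b : ℕ} {s : State} (h : Bdd b s) (e : Term) : e.cost s ≤ e.bound b := by
  have key : ∀ e : Term, 1 + Nat.size (e.val s) ≤ 1 + e.len * (b + 1) := fun e => by
    have := e.size_val_le h; omega
  have mono : ∀ k l : ℕ, k ≤ l → 1 + k * (b + 1) ≤ 1 + l * (b + 1) := fun k l hkl => by
    have := Nat.mul_le_mul_right (b + 1) hkl; omega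
  have two : ∀ (e f g : Term), g.len = 1 + (e.len + f.len) → e.cost s ≤ e.bound b →
      f.cost s ≤ f.bound b →
      1 + Nat.size (g.val s) + (e.cost s + f.cost s) ≤ g.bound b := by
    intro e f g hg he hf
    have h1 := key g
    have h2 := Nat.mul_le_mul_left e.len (mono e.len g.len (by omega))
    have h3 := Nat.mul_le_mul_left f.len (mono f.len g.len (by omega))
    unfold Term.bound at *
    calc _ ≤ (1 + g.len * (b + 1)) + (e.len * (1 + g.len * (b + 1)) +
            f.len * (1 + g.len * (b + 1))) := by omega
      _ = (1 + (e.len + f.len)) * (1 + g.len * (b + 1)) := by ring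
      _ = _ := by rw [← hg]
  induction e with
  | const k =>
    have := key (.const k)
    simp only [Term.cost, Term.bound, Term.val] at *
    have h1 : 1 ≤ (Term.const k).len := by simp [Term.len]
    nlinarith
  | reg x =>
    have := key (.reg x)
    simp only [Term.cost, Term.bound, Term.val] at *
    have h1 : 1 ≤ (Term.reg x).len := by simp [Term.len]
    nlinarith
  | read a e ih =>
    have h1 := key (.read a e)
    have h2 := Nat.mul_le_mul_left e.len (mono e.len (1 + e.len) (by omega))
    unfold Term.bound at *
    simp only [Term.cost, Term.val, Term.len] at *
    calc _ ≤ (1 + (1 + e.len) * (b + 1)) + e.len * (1 + (1 + e.len) * (b + 1)) := by omega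
      _ = _ := by ring
  | add e f ihe ihf => exact two e f (.add e f) rfl ihe ihf
  | sub e f ihe ihf => exact two e f (.sub e f) rfl ihe ihf
  | mul e f ihe ihf => exact two e f (.mul e f) rfl ihe ihf

/-! ### Total correctness with time bounds. -/

/-- A bound for the running time of a program in which every loop is executed at most `M` times
and no number has more than `b` bits. -/
def Program.time (M b : ℕ) : Program → ℕ
  | .skip => 1
  | .assign _ e => 1 + e.bound b
  | .write _ i e => 1 + i.bound b + e.bound b
  | .seq p q => p.time M b + q.time M b
  | .ite e p q => 1 + e.bound b + (p.time M b + q.time M b)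
  | .loop e p => (M + 1) * (1 + e.bound b + p.time M b)

/-- Started in a memory `s` of `b`-bit numbers, the program `p` terminates within time `T` in a
memory of `b`-bit numbers that satisfies `Q`. -/
def OkT (b : ℕ) (p : Program) (s : State) (T : ℕ) (Q : State → Prop) : Prop :=
  Bdd b s → ∃ t s', Runs p s t s' ∧ t ≤ T ∧ Bdd b s' ∧ Q s'

/-- `OkT` for the static time bound of the program. -/
def Ok (M b : ℕ) (p : Program) (s : State) (Q : State → Prop) : Prop :=
  OkT b p s (p.time M b) Q

section rules

variable {M b : ℕ} {p q : Program} {s : State} {Q R : State → Prop}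

theorem OkT.mono {T T' : ℕ} (h : OkT b p s T Q) (hT : T ≤ T')
    (hQ : ∀ s', Frame p s s' → Bdd b s' → Q s' → R s') : OkT b p s T' R := fun hb => by
  obtain ⟨t, s', h1, h2, h3, h4⟩ := h hb
  exact ⟨t, s', h1, h2.trans hT, h3, hQ s' h1.frame h3 h4⟩

theorem Ok.mono (h : Ok M b p s Q) (hQ : ∀ s', Frame p s s' → Bdd b s' → Q s' → R s') :
    Ok M b p s R := OkT.mono h le_rfl hQ

theorem Ok.of_bdd (h : Bdd b s → Ok M b p s Q) : Ok M b p s Q := fun hb => h hb hb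

theorem ok_skip (h : Q s) : Ok M b .skip s Q := fun hb => ⟨1, s, .skip s, le_rfl, hb, h⟩

theorem ok_assign {x : ℕ} {e : Term} (hv : e.val s < 2 ^ b) (h : Q (s.setReg x (e.val s))) :
    Ok M b (.assign x e) s Q := fun hb =>
  ⟨_, _, .assign s x e, by simpa [Program.time] using e.cost_le hb, hb.setReg hv, h⟩

theorem ok_write {a : ℕ} {i e : Term} (hv : e.val s < 2 ^ b)
    (h : Q (s.setArr a (i.val s) (e.val s))) : Ok M b (.write a i e) s Q := fun hb =>
  ⟨_, _, .write s a i e, by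
    have := e.cost_le hb
    have := i.cost_le hb
    simp only [Program.time]; omega, hb.setArr hv, h⟩

theorem okT_seq {T T' : ℕ} (h : OkT b p s T (fun s' => OkT b q s' T' Q)) :
    OkT b (.seq p q) s (T + T') Q := fun hb => by
  obtain ⟨t, s', h1, h2, h3, h4⟩ := h hb
  obtain ⟨t', s'', h1', h2', h3', h4'⟩ := h4 h3
  exact ⟨_, _, .seq h1 h1', by omega, h3', h4'⟩

theorem ok_seq (h : Ok M b p s (fun s' => Ok M b q s' Q)) : Ok M b (.seq p q) s Q := okT_seq h

theorem okT_ite {T : ℕ} {e : Term} (hp : e.val s ≠ 0 → OkT b p s T Q)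
    (hq : e.val s = 0 → OkT b q s T Q) : OkT b (.ite e p q) s (1 + e.bound b + T) Q := fun hb => by
  have hc := e.cost_le hb
  by_cases h0 : e.val s = 0
  · obtain ⟨t, s', h1, h2, h3, h4⟩ := hq h0 hb
    exact ⟨_, _, .ite_false h0 h1, by omega, h3, h4⟩
  · obtain ⟨t, s', h1, h2, h3, h4⟩ := hp h0 hb
    exact ⟨_, _, .ite_true h0 h1, by omega, h3, h4⟩

theorem ok_ite {e : Term} (hp : e.val s ≠ 0 → Ok M b p s Q) (hq : e.val s = 0 → Ok M b q s Q) :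
    Ok M b (.ite e p q) s Q :=
  okT_ite (fun h => OkT.mono (hp h) (Nat.le_add_right _ _) fun _ _ _ h => h)
    (fun h => OkT.mono (hq h) (Nat.le_add_left _ _) fun _ _ _ h => h)

/-- The index of the invariant is a variant: it decreases strictly, hence bounds the number of
rounds. The time of a round is a free parameter, so the rule also covers bodies whose time is not
the static bound. -/
theorem okT_loop {e : Term} {T : ℕ} (I : ℕ → State → Prop)
    (step : ∀ k s', Frame p s s' → I k s' → e.val s' ≠ 0 →
      OkT b p s' T (fun s'' => ∃ k' < k, I k' s''))
    (done : ∀ k s', Frame p s s' → I k s' → e.val s' = 0 → Q s') (K : ℕ) (h : I K s) :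
    OkT b (.loop e p) s ((K + 1) * (1 + e.bound b + T)) Q := by
  suffices H : ∀ k s', Frame p s s' → I k s' →
      OkT b (.loop e p) s' ((k + 1) * (1 + e.bound b + T)) Q from H K s (Frame.refl _ _) h
  intro k
  induction k using Nat.strong_induction_on with
  | _ k ih =>
    intro s' hf hI hb
    have hc := e.cost_le hb
    by_cases h0 : e.val s' = 0
    · exact ⟨_, _, .loop_done h0, by nlinarith [Nat.zero_le (k * (1 + e.bound b + T))], hb,
        done k s' hf hI h0⟩
    · obtain ⟨t, s'', h1, h2, h3, k', hk', h4⟩ := step k s' hf hI h0 hb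
      obtain ⟨t', s₃, h1', h2', h3', h4'⟩ := ih k' hk' s'' (hf.trans h1.frame) h4 h3
      refine ⟨_, _, .loop_step h0 h1 h1', ?_, h3', h4'⟩
      have := Nat.mul_le_mul_right (1 + e.bound b + T) (Nat.succ_le_succ hk')
      nlinarith

theorem ok_loop {e : Term} (I : ℕ → State → Prop) (K : ℕ) (hK : K ≤ M) (h : I K s)
    (step : ∀ k s', Frame p s s' → I k s' → e.val s' ≠ 0 →
      Ok M b p s' (fun s'' => ∃ k' < k, I k' s''))
    (done : ∀ k s', Frame p s s' → I k s' → e.val s' = 0 → Q s') :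
    Ok M b (.loop e p) s Q :=
  (okT_loop I step done K h).mono
    (Nat.mul_le_mul_right _ (Nat.succ_le_succ hK)) fun _ _ _ h => h

end rules

/-! ### Counting loops. -/

/-- Run `p` with register `x` ranging over the numbers below the value of `e`. -/
def forP (x : ℕ) (e : Term) (p : Program) : Program :=
  .seq (.assign x (.const 0))
    (.loop (.sub e (.reg x)) (.seq p (.assign x (.add (.reg x) (.const 1)))))

section rules

variable {M b : ℕ} {p : Program} {s : State} {Q : State → Prop}

/-- The bound `e` is evaluated again before every round, so it must have the value N in every state
that differs from `s` only in what the loop writes. The invariant for i + 1 refers to the state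
after the counter has been incremented. -/
theorem okT_for {x : ℕ} {e : Term} {T : ℕ} (N : ℕ) (I : ℕ → State → Prop) (hNb : N < 2 ^ b)
    (hx : p.wr x = false) (he : ∀ s', Frame (forP x e p) s s' → e.val s' = N)
    (h0 : I 0 (s.setReg x 0))
    (step : ∀ i < N, ∀ s', Frame (forP x e p) s s' → Bdd b s' → s'.reg x = i → I i s' →
      OkT b p s' T (fun s'' => I (i + 1) (s''.setReg x (i + 1))))
    (done : ∀ s', Frame (forP x e p) s s' → Bdd b s' → s'.reg x = N → I N s' → Q s') :
    OkT b (forP x e p) s (1 + (Term.const 0).bound b + (N + 1) * (1 + (Term.sub e (.reg x)).bound b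
      + (T + (1 + (Term.add (.reg x) (.const 1)).bound b)))) Q := by
  set body : Program := .seq p (.assign x (.add (.reg x) (.const 1))) with hbody
  have hfr : ∀ s' s'', Frame (forP x e p) s s' → Frame body s' s'' → Frame (forP x e p) s s'' := by
    intro s' s'' h h'
    refine h.trans ⟨fun y hy => h'.reg y ?_, fun y hy => h'.arr y ?_⟩
    · simp only [forP, Program.wr, Bool.or_eq_false_iff] at hy
      simp only [hbody, Program.wr, Bool.or_eq_false_iff]; exact hy.2
    · simp only [forP, Program.wa, Bool.or_eq_false_iff] at hy
      simp only [hbody, Program.wa, Bool.or_eq_false_iff]; exact hy.2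
  have hfr0 : Frame (forP x e p) s (s.setReg x 0) := by
    refine ⟨fun y hy => ?_, fun y _ => rfl⟩
    simp only [forP, Program.wr, Bool.or_eq_false_iff, beq_eq_false_iff_ne] at hy
    simp [Ne.symm hy.1]
  refine okT_seq ?_
  intro hb
  refine ⟨_, _, .assign s x (.const 0), by simpa using (Term.const 0).cost_le hb,
    hb.setReg (v := 0) (by positivity), ?_⟩
  change OkT b _ (s.setReg x 0) _ _
  intro hb1
  refine okT_loop (fun k s' => Bdd b s' ∧ s'.reg x + k = N ∧ I (s'.reg x) s') ?_ ?_ N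
    ⟨hb1, by simp, by simpa using h0⟩ hb1
  · rintro k s' hf ⟨hb', hk, hI⟩ hne
    have hf' := hfr _ _ hfr0 hf
    have hev := he s' hf'
    simp only [Term.val, hev] at hne
    refine okT_seq ?_
    refine (step (s'.reg x) (by omega) s' hf' hb' rfl hI).mono le_rfl ?_
    intro s'' hf'' hb'' hI'' _
    have hreg : s''.reg x = s'.reg x := hf''.reg x hx
    have hval : (Term.add (.reg x) (.const 1)).val s'' = s'.reg x + 1 := by simp [Term.val, hreg]
    have hbd := hb''.setReg (x := x) (v := s'.reg x + 1) (by omega)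
    refine ⟨_, _, .assign s'' x _, by
      simpa using (Term.add (.reg x) (.const 1)).cost_le hb'', ?_, k - 1, by omega, ?_⟩
    · rw [hval]; exact hbd
    · rw [hval]
      exact ⟨hbd, by simp; omega, by simpa using hI''⟩
  · rintro k s' hf ⟨hb', hk, hI⟩ h0
    have hf' := hfr _ _ hfr0 hf
    simp only [Term.val, he s' hf'] at h0
    have : s'.reg x = N := by omega
    exact done s' hf' hb' this (this ▸ hI)

theorem ok_for {x : ℕ} {e : Term} (N : ℕ) (I : ℕ → State → Prop) (hNM : N ≤ M) (hNb : N < 2 ^ b)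
    (hx : p.wr x = false) (he : ∀ s', Frame (forP x e p) s s' → e.val s' = N)
    (h0 : I 0 (s.setReg x 0))
    (step : ∀ i < N, ∀ s', Frame (forP x e p) s s' → Bdd b s' → s'.reg x = i → I i s' →
      Ok M b p s' (fun s'' => I (i + 1) (s''.setReg x (i + 1))))
    (done : ∀ s', Frame (forP x e p) s s' → Bdd b s' → s'.reg x = N → I N s' → Q s') :
    Ok M b (forP x e p) s Q := by
  refine (okT_for N I hNb hx he h0 step done).mono ?_ fun _ _ _ h => h
  simp only [forP, Program.time]
  gcongr

end rules

/-! ### Polynomial bounds -/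

/-- A function bounded by a polynomial. -/
def PolyBdd (g : ℕ → ℕ) : Prop := ∃ p : Polynomial ℕ, ∀ m, g m ≤ p.eval m

theorem PolyBdd.const (k : ℕ) : PolyBdd fun _ => k := ⟨Polynomial.C k, fun m => by simp⟩

theorem PolyBdd.id : PolyBdd fun m => m := ⟨Polynomial.X, fun m => by simp⟩

theorem PolyBdd.add {g h : ℕ → ℕ} (hg : PolyBdd g) (hh : PolyBdd h) :
    PolyBdd fun m => g m + h m := by
  obtain ⟨p, hp⟩ := hg
  obtain ⟨q, hq⟩ := hh
  exact ⟨p + q, fun m => by simpa using add_le_add (hp m) (hq m)⟩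

theorem PolyBdd.mul {g h : ℕ → ℕ} (hg : PolyBdd g) (hh : PolyBdd h) :
    PolyBdd fun m => g m * h m := by
  obtain ⟨p, hp⟩ := hg
  obtain ⟨q, hq⟩ := hh
  exact ⟨p * q, fun m => by simpa using Nat.mul_le_mul (hp m) (hq m)⟩

theorem PolyBdd.bound {b : ℕ → ℕ} (hb : PolyBdd b) (e : Term) : PolyBdd fun m => e.bound (b m) :=
  (PolyBdd.const _).mul ((PolyBdd.const _).add ((PolyBdd.const _).mul (hb.add (PolyBdd.const 1))))

/-- The program is fixed, so the nesting depth of its loops, and with it the degree of the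
polynomial, is a constant. -/
theorem PolyBdd.time {M b : ℕ → ℕ} (hM : PolyBdd M) (hb : PolyBdd b) (p : Program) :
    PolyBdd fun m => p.time (M m) (b m) := by
  induction p with
  | skip => exact PolyBdd.const 1
  | assign x e => exact (PolyBdd.const 1).add (hb.bound e)
  | write a i e => exact ((PolyBdd.const 1).add (hb.bound i)).add (hb.bound e)
  | seq p q ihp ihq => exact ihp.add ihq
  | ite e p q ihp ihq => exact ((PolyBdd.const 1).add (hb.bound e)).add (ihp.add ihq)
  | loop e p ih =>
    exact (hM.add (PolyBdd.const 1)).mul (((PolyBdd.const 1).add (hb.bound e)).add ih)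

end RAM

/-! ### Two-spin systems -/

section PairProducts

open Finset

/-- The product of `g` over all pairs of distinct elements of `A`. -/
def pairProd {n : ℕ} (A : Finset (Fin n)) (g : Fin n → Fin n → ℕ) : ℕ :=
  ∏ x ∈ A, ∏ y ∈ A, if x < y then g x y else 1

theorem pairProd_insert {n : ℕ} {A : Finset (Fin n)} {v : Fin n} (hv : v ∉ A)
    {g : Fin n → Fin n → ℕ} (hg : ∀ x y, g x y = g y x) :
    pairProd (insert v A) g = (∏ x ∈ A, g v x) * pairProd A g := by
  simp only [pairProd, prod_insert hv, lt_irrefl, if_false, one_mul, prod_mul_distrib]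
  rw [← mul_assoc, ← prod_mul_distrib]
  congr 1
  refine prod_congr rfl fun x hx => ?_
  have hne : v ≠ x := fun h => hv (h ▸ hx)
  rcases lt_or_gt_of_ne hne with h | h
  · simp [h, h.not_gt]
  · simp [h, h.not_gt, hg x v]

theorem pairProd_congr {n : ℕ} {A : Finset (Fin n)} {g h : Fin n → Fin n → ℕ}
    (H : ∀ x ∈ A, ∀ y ∈ A, x ≠ y → g x y = h x y) : pairProd A g = pairProd A h := by
  refine prod_congr rfl fun x hx => prod_congr rfl fun y hy => ?_
  split_ifs with hlt
  · exact H x hx y hy hlt.ne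
  · rfl

theorem pairProd_mul {n : ℕ} (A : Finset (Fin n)) (g h : Fin n → Fin n → ℕ) :
    pairProd A (fun x y => g x y * h x y) = pairProd A g * pairProd A h := by
  simp only [pairProd, ← prod_mul_distrib]
  refine prod_congr rfl fun x _ => prod_congr rfl fun y _ => ?_
  split_ifs <;> simp

theorem pairProd_le {n : ℕ} {A : Finset (Fin n)} {g h : Fin n → Fin n → ℕ}
    (H : ∀ x ∈ A, ∀ y ∈ A, x ≠ y → g x y ≤ h x y) : pairProd A g ≤ pairProd A h := by
  refine prod_le_prod' fun x hx => prod_le_prod' fun y hy => ?_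
  split_ifs with hlt
  · exact H x hx y hy hlt.ne
  · rfl

theorem pairProd_eq_one {n : ℕ} {A : Finset (Fin n)} {g : Fin n → Fin n → ℕ}
    (H : ∀ x ∈ A, ∀ y ∈ A, x ≠ y → g x y = 1) : pairProd A g = 1 := by
  rw [pairProd_congr (h := fun _ _ => 1) H]
  simp [pairProd]

/-- A pair product with a single nontrivial factor. -/
theorem pairProd_single {n : ℕ} {A : Finset (Fin n)} {a b : Fin n} (ha : a ∈ A) (hb : b ∈ A)
    (hab : a ≠ b) {g : Fin n → Fin n → ℕ} (hg : ∀ x y, g x y = g y x)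
    (H : ∀ x ∈ A, ∀ y ∈ A, x ≠ y → ¬ (x = a ∧ y = b) → ¬ (x = b ∧ y = a) → g x y = 1) :
    pairProd A g = g a b := by
  rw [← insert_erase ha, pairProd_insert (notMem_erase a A) hg, pairProd_eq_one, mul_one,
    prod_eq_single b]
  · intro x hx hxb
    rw [mem_erase] at hx
    exact H a ha x hx.2 (Ne.symm hx.1) (fun h => hxb h.2) (fun h => hx.1 h.2)
  · intro h
    exact absurd (mem_erase.2 ⟨hab.symm, hb⟩) h
  · intro x hx y hy hxy
    rw [mem_erase] at hx hy
    exact H x hx.2 y hy.2 hxy (fun h => hx.1 h.1) (fun h => hy.1 h.2)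

end PairProducts

/-- A system of 0/1-valued variables with weights on variables and on pairs of variables. The
variable `v` is active if `U v ≠ 0`. -/
structure TwoSpin (n : ℕ) where
  U : Fin n → ℕ
  adj : Fin n → Fin n → ℕ
  f : Fin 2 → Fin n → ℕ
  W : Fin 2 → Fin 2 → Fin n → Fin n → ℕ
  val : ℕ

namespace TwoSpin

open Finset

variable {n : ℕ}

/-- The active variables. -/
def act (S : TwoSpin n) : Finset (Fin n) := univ.filter fun v => S.U v ≠ 0

/-- The active neighbours of a variable. -/
def nb (S : TwoSpin n) (v : Fin n) : Finset (Fin n) := S.act.filter fun x => S.adj v x ≠ 0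

/-- The weight of an assignment, restricted to the variables in `A`. -/
def wt (S : TwoSpin n) (A : Finset (Fin n)) (σ : Fin n → Fin 2) : ℕ :=
  (∏ x ∈ A, S.f (σ x) x) * pairProd A fun x y => S.W (σ x) (σ y) x y

/-- The assignment that is 1 exactly on `I`. -/
def ind (I : Finset (Fin n)) (x : Fin n) : Fin 2 := if x ∈ I then 1 else 0

/-- The partition function. -/
def Z (S : TwoSpin n) : ℕ := S.val * ∑ I ∈ S.act.powerset, S.wt S.act (ind I)

/-- Weights are symmetric, and trivial on nonadjacent pairs. -/
structure Good (S : TwoSpin n) : Prop where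
  symW : ∀ s t x y, S.W s t x y = S.W t s y x
  symAdj : ∀ x y, S.adj x y = S.adj y x
  irrefl : ∀ x, S.adj x x = 0
  triv : ∀ x y, x ≠ y → S.adj x y = 0 → ∀ s t, S.W s t x y = 1

/-- Deactivate `v`. -/
def rm (S : TwoSpin n) (v : Fin n) (x : Fin n) : ℕ := if x = v then 0 else S.U x

/-- Fix the value of `v` to `s`. -/
def cond (S : TwoSpin n) (v : Fin n) (s : Fin 2) : TwoSpin n where
  U := S.rm v
  adj := S.adj
  f a x := if S.rm v x ≠ 0 then S.f a x * S.W s a v x else S.f a x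
  W := S.W
  val := S.val * S.f s v

/-- Sum over the values of a variable without neighbours. -/
def elim₀ (S : TwoSpin n) (v : Fin n) : TwoSpin n :=
  { S with U := S.rm v, val := S.val * (S.f 0 v + S.f 1 v) }

/-- Sum over the values of a variable with one neighbour. -/
def elim₁ (S : TwoSpin n) (v : Fin n) : TwoSpin n :=
  { S with
    U := S.rm v
    f := fun a x => if x ∈ S.nb v then
      S.f a x * (S.f 0 v * S.W 0 a v x + S.f 1 v * S.W 1 a v x) else S.f a x }

/-- Sum over the values of a variable with two neighbours. -/
def elim₂ (S : TwoSpin n) (v : Fin n) : TwoSpin n :=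
  { S with
    U := S.rm v
    adj := fun x y => if x ∈ S.nb v ∧ y ∈ S.nb v ∧ x ≠ y then 1 else S.adj x y
    W := fun s t x y => if x ∈ S.nb v ∧ y ∈ S.nb v ∧ x ≠ y then
      S.W s t x y * (S.f 0 v * S.W 0 s v x * S.W 0 t v y + S.f 1 v * S.W 1 s v x * S.W 1 t v y)
      else S.W s t x y }

/-- Whether treating `v` needs a case distinction on its value. -/
def Branching (S : TwoSpin n) (v : Fin n) : Prop := S.f 1 v ≠ 0 ∧ 3 ≤ (S.nb v).card

instance (S : TwoSpin n) (v : Fin n) : Decidable (S.Branching v) := instDecidableAnd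

/-- Treat the variable `v`; if a case distinction is needed, take the case `v = s`. -/
def next (S : TwoSpin n) (v : Fin n) (s : Fin 2) : TwoSpin n :=
  if S.f 1 v = 0 then S.cond v 0
  else if 3 ≤ (S.nb v).card then S.cond v s
  else if (S.nb v).card = 2 then S.elim₂ v
  else if (S.nb v).card = 1 then S.elim₁ v
  else S.elim₀ v

theorem mem_act {S : TwoSpin n} {v : Fin n} : v ∈ S.act ↔ S.U v ≠ 0 := by simp [act]

theorem mem_nb {S : TwoSpin n} {v x : Fin n} : x ∈ S.nb v ↔ S.U x ≠ 0 ∧ S.adj v x ≠ 0 := by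
  simp [nb, act]

theorem Good.notMem_nb {S : TwoSpin n} (h : S.Good) (v : Fin n) : v ∉ S.nb v := fun hv =>
  (mem_nb.1 hv).2 (h.irrefl v)

theorem act_of_U {S S' : TwoSpin n} {v : Fin n} (h : S'.U = S.rm v) : S'.act = S.act.erase v := by
  ext x
  rw [mem_act, mem_erase, mem_act, h]
  simp [rm]

theorem next_U (S : TwoSpin n) (v : Fin n) (s : Fin 2) : (S.next v s).U = S.rm v := by
  unfold next
  split_ifs <;> rfl

theorem act_next (S : TwoSpin n) (v : Fin n) (s : Fin 2) :
    (S.next v s).act = S.act.erase v := act_of_U (S.next_U v s)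

theorem Good.of_elim₂ {S : TwoSpin n} (h : S.Good) (v : Fin n) : (S.elim₂ v).Good where
  symW s t x y := by
    simp only [elim₂]
    by_cases hc : x ∈ S.nb v ∧ y ∈ S.nb v ∧ x ≠ y
    · rw [if_pos hc, if_pos ⟨hc.2.1, hc.1, hc.2.2.symm⟩, h.symW s t x y]; ring
    · rw [if_neg hc, if_neg (fun h' => hc ⟨h'.2.1, h'.1, h'.2.2.symm⟩), h.symW s t x y]
  symAdj x y := by
    simp only [elim₂]
    by_cases hc : x ∈ S.nb v ∧ y ∈ S.nb v ∧ x ≠ y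
    · rw [if_pos hc, if_pos ⟨hc.2.1, hc.1, hc.2.2.symm⟩]
    · rw [if_neg hc, if_neg (fun h' => hc ⟨h'.2.1, h'.1, h'.2.2.symm⟩), h.symAdj x y]
  irrefl x := by simp [elim₂, h.irrefl]
  triv x y hxy h0 s t := by
    simp only [elim₂] at h0 ⊢
    by_cases hc : x ∈ S.nb v ∧ y ∈ S.nb v ∧ x ≠ y
    · rw [if_pos hc] at h0; exact absurd h0 one_ne_zero
    · rw [if_neg hc] at h0 ⊢; exact h.triv x y hxy h0 s t

theorem Good.next {S : TwoSpin n} (h : S.Good) (v : Fin n) (s : Fin 2) : (S.next v s).Good := by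
  unfold TwoSpin.next
  split_ifs
  · exact ⟨h.symW, h.symAdj, h.irrefl, h.triv⟩
  · exact ⟨h.symW, h.symAdj, h.irrefl, h.triv⟩
  · exact h.of_elim₂ v
  · exact ⟨h.symW, h.symAdj, h.irrefl, h.triv⟩
  · exact ⟨h.symW, h.symAdj, h.irrefl, h.triv⟩

/-! ### How treating a variable changes the partition function. -/

theorem wt_insert {S : TwoSpin n} (h : S.Good) {A : Finset (Fin n)} {v : Fin n} (hv : v ∉ A)
    (σ : Fin n → Fin 2) :
    S.wt (insert v A) σ = S.wt A σ * (S.f (σ v) v * ∏ x ∈ A, S.W (σ v) (σ x) v x) := by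
  unfold wt
  rw [prod_insert hv, pairProd_insert hv fun x y => h.symW _ _ x y]
  ring

theorem wt_congr (S : TwoSpin n) {A : Finset (Fin n)} {σ τ : Fin n → Fin 2}
    (h : ∀ x ∈ A, σ x = τ x) : S.wt A σ = S.wt A τ := by
  unfold wt
  congr 1
  · exact prod_congr rfl fun x hx => by rw [h x hx]
  · exact pairProd_congr fun x hx y hy _ => by rw [h x hx, h y hy]

/-- The contribution of the variable `v` to the weight of an assignment of `A`. -/
def local_ (S : TwoSpin n) (A : Finset (Fin n)) (v : Fin n) (σ : Fin n → Fin 2) (s : Fin 2) : ℕ :=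
  S.f s v * ∏ x ∈ A, S.W s (σ x) v x

/-- Each set I avoiding v is paired with its extension by v. The two weights agree except for the
factor that involves v. -/
theorem Z_split {S : TwoSpin n} (h : S.Good) {v : Fin n} (hv : v ∈ S.act) :
    S.Z = S.val * ∑ I ∈ (S.act.erase v).powerset, S.wt (S.act.erase v) (ind I) *
      (S.local_ (S.act.erase v) v (ind I) 0 + S.local_ (S.act.erase v) v (ind I) 1) := by
  have hv' := notMem_erase v S.act
  unfold Z
  rw [← insert_erase hv, sum_powerset_insert hv', ← sum_add_distrib, erase_insert hv']
  congr 1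
  refine sum_congr rfl fun I hI => ?_
  have hvI : v ∉ I := fun hvI => hv' (mem_powerset.1 hI hvI)
  have h0 : ind I v = 0 := by simp [ind, hvI]
  have h1 : ind (insert v I) v = 1 := by simp [ind]
  have hc : ∀ x ∈ S.act.erase v, ind (insert v I) x = ind I x := fun x hx => by
    simp [ind, (mem_erase.1 hx).1]
  rw [wt_insert h hv', wt_insert h hv', h0, h1, S.wt_congr hc, mul_add, local_, local_]
  congr 3
  exact prod_congr rfl fun x hx => by rw [hc x hx]

theorem wt_cond {S : TwoSpin n} {v : Fin n} (s : Fin 2) (σ : Fin n → Fin 2) :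
    (S.cond v s).wt (S.act.erase v) σ * S.f s v =
      S.wt (S.act.erase v) σ * S.local_ (S.act.erase v) v σ s := by
  unfold wt local_
  have : ∏ x ∈ S.act.erase v, (S.cond v s).f (σ x) x =
      (∏ x ∈ S.act.erase v, S.f (σ x) x) * ∏ x ∈ S.act.erase v, S.W s (σ x) v x := by
    rw [← prod_mul_distrib]
    refine prod_congr rfl fun x hx => ?_
    rw [mem_erase, mem_act] at hx
    simp [cond, rm, hx.1, hx.2]
  rw [this]
  simp only [cond]
  ring

theorem Z_cond {S : TwoSpin n} {v : Fin n} (s : Fin 2) :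
    (S.cond v s).Z = S.val * ∑ I ∈ (S.act.erase v).powerset,
      S.wt (S.act.erase v) (ind I) * S.local_ (S.act.erase v) v (ind I) s := by
  have h2 : (S.cond v s).act = S.act.erase v := act_of_U rfl
  unfold Z
  rw [h2]
  simp only [← wt_cond, ← sum_mul]
  simp only [cond]
  ring

theorem Z_eq_cond_add {S : TwoSpin n} (h : S.Good) {v : Fin n} (hv : v ∈ S.act) :
    S.Z = (S.cond v 0).Z + (S.cond v 1).Z := by
  simp only [Z_split h hv, Z_cond, mul_add, sum_add_distrib]

theorem Z_forced {S : TwoSpin n} (h : S.Good) {v : Fin n} (hv : v ∈ S.act) (h0 : S.f 1 v = 0) :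
    S.Z = (S.cond v 0).Z := by
  rw [Z_eq_cond_add h hv]
  simp [Z, cond, h0]

theorem prod_W_of_nb {S : TwoSpin n} (h : S.Good) {v : Fin n} (s : Fin 2) (σ : Fin n → Fin 2) :
    ∏ x ∈ S.act.erase v, S.W s (σ x) v x = ∏ x ∈ S.nb v, S.W s (σ x) v x := by
  symm
  refine prod_subset (fun x hx => ?_) fun x hx hx' => ?_
  · rw [mem_erase, mem_act]
    exact ⟨fun hxv => h.notMem_nb v (hxv ▸ hx), (mem_nb.1 hx).1⟩
  · rw [mem_erase, mem_act] at hx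
    rw [mem_nb, not_and, not_not] at hx'
    exact h.triv v x hx.1.symm (hx' hx.2) _ _

theorem Z_elim₀ {S : TwoSpin n} (h : S.Good) {v : Fin n} (hv : v ∈ S.act) (h0 : S.nb v = ∅) :
    S.Z = (S.elim₀ v).Z := by
  have h2 : (S.elim₀ v).act = S.act.erase v := act_of_U rfl
  rw [Z_split h hv, Z, h2]
  simp only [local_, prod_W_of_nb h, h0, prod_empty, mul_one, ← sum_mul]
  simp only [elim₀, wt]
  ring

/-- Summing over v leaves a function of the value of its only neighbour, which is absorbed into the
weight of that neighbour. -/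
theorem Z_elim₁ {S : TwoSpin n} (h : S.Good) {v x : Fin n} (hv : v ∈ S.act)
    (h1 : S.nb v = {x}) : S.Z = (S.elim₁ v).Z := by
  have h2 : (S.elim₁ v).act = S.act.erase v := act_of_U rfl
  have hx : x ∈ S.nb v := by simp [h1]
  have hx' : x ∈ S.act.erase v := by
    rw [mem_erase, mem_act]
    exact ⟨fun hxv => h.notMem_nb v (hxv ▸ hx), (mem_nb.1 hx).1⟩
  rw [Z_split h hv, Z, h2]
  simp only [local_, prod_W_of_nb h, h1, prod_singleton]
  congr 1
  refine sum_congr rfl fun I _ => ?_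
  unfold wt
  have : ∏ y ∈ S.act.erase v, (S.elim₁ v).f (ind I y) y = (∏ y ∈ S.act.erase v, S.f (ind I y) y) *
      (S.f 0 v * S.W 0 (ind I x) v x + S.f 1 v * S.W 1 (ind I x) v x) := by
    rw [← mul_prod_erase _ _ hx', ← mul_prod_erase (a := x) _ _ hx']
    have hr : ∏ y ∈ (S.act.erase v).erase x, (S.elim₁ v).f (ind I y) y =
        ∏ y ∈ (S.act.erase v).erase x, S.f (ind I y) y := by
      refine prod_congr rfl fun y hy => ?_
      simp [elim₁, h1, (mem_erase.1 hy).1]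
    rw [hr]
    simp only [elim₁, h1, mem_singleton, if_true]
    ring
  rw [this]
  simp only [elim₁]
  ring

/-- Summing over v leaves a function of the values of its two neighbours, which is absorbed into
their pair weight. This is why general pair weights are allowed, and why three neighbours cannot be
treated in this way. -/
theorem Z_elim₂ {S : TwoSpin n} (h : S.Good) {v a b : Fin n} (hv : v ∈ S.act) (hab : a ≠ b)
    (h1 : S.nb v = {a, b}) : S.Z = (S.elim₂ v).Z := by
  have h2 : (S.elim₂ v).act = S.act.erase v := act_of_U rfl
  have hmem : ∀ x ∈ S.nb v, x ∈ S.act.erase v := fun x hx => by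
    rw [mem_erase, mem_act]
    exact ⟨fun hxv => h.notMem_nb v (hxv ▸ hx), (mem_nb.1 hx).1⟩
  have ha := hmem a (by simp [h1])
  have hb := hmem b (by simp [h1])
  rw [Z_split h hv, Z, h2]
  simp only [local_, prod_W_of_nb h, h1, prod_pair hab]
  congr 1
  refine sum_congr rfl fun I _ => ?_
  unfold wt
  have : pairProd (S.act.erase v) (fun x y => (S.elim₂ v).W (ind I x) (ind I y) x y) =
      pairProd (S.act.erase v) (fun x y => S.W (ind I x) (ind I y) x y) *
      (S.f 0 v * S.W 0 (ind I a) v a * S.W 0 (ind I b) v b +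
        S.f 1 v * S.W 1 (ind I a) v a * S.W 1 (ind I b) v b) := by
    have hp := pairProd_single ha hb hab (g := fun x y => if x ∈ S.nb v ∧ y ∈ S.nb v ∧ x ≠ y then
      (S.f 0 v * S.W 0 (ind I x) v x * S.W 0 (ind I y) v y +
        S.f 1 v * S.W 1 (ind I x) v x * S.W 1 (ind I y) v y) else 1) ?_ ?_
    · rw [if_pos (by simp [h1, hab])] at hp
      rw [← hp, ← pairProd_mul]
      refine pairProd_congr fun x _ y _ _ => ?_
      simp only [elim₂]
      split_ifs <;> simp
    · intro x y
      by_cases hc : x ∈ S.nb v ∧ y ∈ S.nb v ∧ x ≠ y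
      · rw [if_pos hc, if_pos ⟨hc.2.1, hc.1, hc.2.2.symm⟩]; ring
      · rw [if_neg hc, if_neg fun h' => hc ⟨h'.2.1, h'.1, h'.2.2.symm⟩]
    · intro x _ y _ hxy h3 h4
      refine if_neg ?_
      rintro ⟨hx, hy, -⟩
      simp only [h1, mem_insert, mem_singleton] at hx hy
      rcases hx with rfl | rfl <;> rcases hy with rfl | rfl <;> simp_all
  rw [this]
  simp only [elim₂]
  ring

theorem Z_next {S : TwoSpin n} (h : S.Good) {v : Fin n} (hv : v ∈ S.act) :
    S.Z = if S.Branching v then (S.next v 0).Z + (S.next v 1).Z else (S.next v 0).Z := by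
  unfold Branching next
  by_cases h0 : S.f 1 v = 0
  · simp [h0, Z_forced h hv h0]
  by_cases h3 : 3 ≤ (S.nb v).card
  · simp [h0, h3, Z_eq_cond_add h hv]
  simp only [h0, h3, if_false, and_false]
  by_cases h2 : (S.nb v).card = 2
  · obtain ⟨a, b, hab, h2'⟩ := card_eq_two.1 h2
    simpa [h2] using Z_elim₂ h hv hab h2'
  by_cases h1 : (S.nb v).card = 1
  · obtain ⟨a, h1'⟩ := card_eq_one.1 h1
    simpa [h1] using Z_elim₁ h hv h1'
  · simpa [h1, h2] using Z_elim₀ h hv (card_eq_zero.1 (by omega))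

end TwoSpin

namespace TwoSpin

open Finset

variable {n : ℕ}

/-! ### The branching tree -/

/-- The priority of a variable. -/
def key (S : TwoSpin n) (v : Fin n) : ℕ :=
  if S.f 1 v = 0 then n + 3
  else if (S.nb v).card ≤ 1 then n + 2
  else if 4 ≤ (S.nb v).card then (S.nb v).card
  -- Degree 2 comes after all degrees at least 4, because its elimination creates pair weights that
  -- are not exclusions. It comes before degree 3, so that branching on degree 3 happens only when
  -- all degrees are 3.
  else if (S.nb v).card = 2 then 2 else 1

theorem card_nb_le (S : TwoSpin n) (v : Fin n) : (S.nb v).card ≤ n := by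
  simpa using card_le_univ (S.nb v)

theorem key_pos (S : TwoSpin n) (v : Fin n) : 0 < S.key v := by
  unfold key; split_ifs <;> omega

theorem key_le (S : TwoSpin n) (v : Fin n) : S.key v ≤ n + 3 := by
  have := S.card_nb_le v
  unfold key; split_ifs <;> omega

/-- `v` is the first active variable of highest priority. -/
def IsSel (S : TwoSpin n) (v : Fin n) : Prop :=
  v ∈ S.act ∧ ∀ x ∈ S.act, S.key x ≤ S.key v ∧ (x < v → S.key x < S.key v)

theorem IsSel.unique {S : TwoSpin n} {v w : Fin n} (hv : S.IsSel v) (hw : S.IsSel w) : v = w := by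
  have h1 := hv.2 w hw.1
  have h2 := hw.2 v hv.1
  rcases lt_trichotomy v w with h | h | h
  · have := h2.2 h; omega
  · exact h
  · have := h1.2 h; omega

theorem exists_isSel {S : TwoSpin n} (h : S.act.Nonempty) : ∃ v, S.IsSel v := by
  obtain ⟨m, hm, hmax⟩ := exists_max_image S.act S.key h
  have hne : (S.act.filter fun v => S.key v = S.key m).Nonempty := ⟨m, by simp [hm]⟩
  have hmin := min'_mem _ hne
  rw [mem_filter] at hmin
  refine ⟨_, hmin.1, fun x hx => ⟨by rw [hmin.2]; exact hmax x hx, fun hlt => ?_⟩⟩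
  refine lt_of_le_of_ne (by rw [hmin.2]; exact hmax x hx) fun heq => ?_
  have := min'_le (S.act.filter fun v => S.key v = S.key m) x
    (mem_filter.2 ⟨hx, heq.trans hmin.2⟩)
  exact absurd hlt this.not_gt

open Classical in
/-- The selected variable, if there are active variables. -/
noncomputable def sel (S : TwoSpin n) : Option (Fin n) :=
  if h : ∃ v, S.IsSel v then some h.choose else none

theorem sel_eq_some {S : TwoSpin n} {v : Fin n} : S.sel = some v ↔ S.IsSel v := by
  unfold sel
  constructor
  · intro h
    split_ifs at h with h'
    cases h
    exact h'.choose_spec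
  · intro h
    have h' : ∃ v, S.IsSel v := ⟨v, h⟩
    rw [dif_pos h', h'.choose_spec.unique h]

theorem sel_eq_none {S : TwoSpin n} : S.sel = none ↔ S.act = ∅ := by
  constructor
  · intro h
    by_contra hne
    obtain ⟨v, hv⟩ := exists_isSel (nonempty_iff_ne_empty.2 hne)
    rw [sel_eq_some.2 hv] at h
    cases h
  · intro h
    cases hs : S.sel with
    | none => rfl
    | some v =>
      have := (sel_eq_some.1 hs).1
      simp [h] at this

/-- The number of leaves of the branching tree of height `k`. -/
noncomputable def leaves : ℕ → TwoSpin n → ℕ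
  | 0, _ => 1
  | k + 1, S =>
    match S.sel with
    -- With no active variable left the tree idles, so that all its paths have the same length.
    | none => leaves k S
    | some v => if S.Branching v then leaves k (S.next v 0) + leaves k (S.next v 1)
        else leaves k (S.next v 0)

/-- The sum of the values of the leaves of the branching tree of height `k`. -/
noncomputable def total : ℕ → TwoSpin n → ℕ
  | 0, S => S.val
  | k + 1, S =>
    match S.sel with
    | none => total k S
    | some v => if S.Branching v then total k (S.next v 0) + total k (S.next v 1)
        else total k (S.next v 0)

theorem Z_of_act_empty {S : TwoSpin n} (h : S.act = ∅) : S.Z = S.val := by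
  simp [Z, h, wt, pairProd]

/-- Each level deactivates one variable, so after as many levels as there are active variables only
the scalar `val` remains. -/
theorem total_eq_Z {k : ℕ} {S : TwoSpin n} (h : S.Good) (hk : S.act.card ≤ k) :
    S.total k = S.Z := by
  induction k generalizing S with
  | zero => rw [Z_of_act_empty (card_eq_zero.1 (by omega)), total]
  | succ k ih =>
    rw [total]
    cases hs : S.sel with
    | none =>
      have h0 := sel_eq_none.1 hs
      exact ih h (by simp [h0])
    | some v =>
      have hv := (sel_eq_some.1 hs).1
      have hc : ∀ s, (S.next v s).act.card ≤ k := fun s => by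
        rw [act_next, card_erase_of_mem hv]; omega
      simp only [Z_next h hv, ih (h.next v _) (hc _)]

theorem next_of_not_branching {S : TwoSpin n} {v : Fin n} (h : ¬ S.Branching v) (s : Fin 2) :
    S.next v s = S.next v 0 := by
  unfold Branching at h
  unfold next
  split_ifs with h1 h2
  · rfl
  · exact absurd ⟨h1, h2⟩ h
  · rfl
  · rfl
  · rfl

/-! ### Enumerating the leaves -/

/-- The decision with index `L`. -/
def bit (β : ℕ → ℕ) (L : ℕ) : Fin 2 := if β L = 0 then 0 else 1

/-- One step down the branching tree, taking decisions from `β`. -/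
noncomputable def step (β : ℕ → ℕ) (x : TwoSpin n × ℕ) : TwoSpin n × ℕ :=
  match x.1.sel with
  | none => x
  | some v => (x.1.next v (bit β x.2), if x.1.Branching v then x.2 + 1 else x.2)

/-- The next sequence of decisions after one that uses the first `k` entries of `β`, and whether
there is one. -/
def adv (β : ℕ → ℕ) : ℕ → (ℕ → ℕ) × ℕ
  | 0 => (β, 0)
  | k + 1 => if β k = 0 then (Function.update β k 1, 1) else adv (Function.update β k 0) k

/-- Run down the branching tree of `R` once. -/
noncomputable def round (R : TwoSpin n) (x : ℕ × (ℕ → ℕ)) : ℕ × (ℕ → ℕ) × ℕ :=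
  let y := (step x.2)^[n] (R, 0)
  (x.1 + y.1.val, adv x.2 y.2)

/-- `Chain R x m y`: `m` rounds lead from `x` to `y`, and only the last one may be final. -/
inductive Chain (R : TwoSpin n) : ℕ × (ℕ → ℕ) → ℕ → ℕ × (ℕ → ℕ) × ℕ → Prop
  | one (x) : Chain R x 1 (R.round x)
  | more {x m y} : (R.round x).2.2 ≠ 0 → Chain R ((R.round x).1, (R.round x).2.1) m y →
      Chain R x (m + 1) y

theorem Chain.append {R : TwoSpin n} {x m y m' z} (h : Chain R x m y) (hy : y.2.2 ≠ 0)
    (h' : Chain R (y.1, y.2.1) m' z) : Chain R x (m + m') z := by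
  induction h with
  | one x => rw [add_comm]; exact .more hy h'
  | more h1 _ ih => rw [add_right_comm]; exact .more h1 (ih hy h')

/-- A node at depth n - k is reached by every decision sequence with the right first L entries. If
the later entries are 0, the counter starts at the leftmost leaf below the node. After one round per
leaf below it, the carry leaves the node, and the counter advances on the first L entries only. -/
theorem chain_leaves {R : TwoSpin n} {k : ℕ} (hk : k ≤ n) {S : TwoSpin n} {L : ℕ} {β : ℕ → ℕ}
    (hreach : ∀ β' : ℕ → ℕ, (∀ i < L, β' i = β i) → (step β')^[n - k] (R, 0) = (S, L))
    (hβ : ∀ i ≥ L, β i = 0) (acc : ℕ) :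
    Chain R (acc, β) (S.leaves k) (acc + S.total k, adv β L) := by
  induction k generalizing S L β acc with
  | zero =>
    have := hreach β fun _ _ => rfl
    rw [Nat.sub_zero] at this
    have h1 := Chain.one (R := R) (acc, β)
    simp only [round, this] at h1
    exact h1
  | succ k ih =>
    have hstep : ∀ β' : ℕ → ℕ, (∀ i < L, β' i = β i) →
        (step β')^[n - k] (R, 0) = step β' (S, L) := fun β' h => by
      rw [show n - k = (n - (k + 1)) + 1 by omega, Function.iterate_succ_apply', hreach β' h]
    rw [leaves, total]
    cases hs : S.sel with
    | none =>
      refine ih (by omega) (fun β' h => ?_) hβ acc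
      rw [hstep β' h, step, hs]
    | some v =>
      by_cases hb : S.Branching v
      · simp only [if_pos hb]
        have hu : ∀ s : Fin 2, ∀ β' : ℕ → ℕ, bit β' L = s → (∀ i < L, β' i = β i) →
            (step β')^[n - k] (R, 0) = (S.next v s, L + 1) := fun s β' hs' h => by
          rw [hstep β' h, step]
          simp only [hs, if_pos hb, hs']
        have h0 := ih (by omega) (S := S.next v 0) (L := L + 1) (β := β)
          (fun β' h => hu 0 β' (by simp [bit, h L (by omega), hβ L le_rfl])
            fun i hi => h i (by omega)) (fun i hi => hβ i (by omega)) acc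
        -- Entry L was 0, so leaving the first subtree sets it to 1, which is where the second
        -- subtree starts.
        rw [adv, if_pos (hβ L le_rfl)] at h0
        have h1 := ih (by omega) (S := S.next v 1) (L := L + 1) (β := Function.update β L 1)
          (fun β' h => hu 1 β' (by simp [bit, h L (by omega)])
            fun i hi => by rw [h i (by omega), Function.update_of_ne (by omega)])
          (fun i hi => by rw [Function.update_of_ne (by omega)]; exact hβ i (by omega))
          (acc + (S.next v 0).total k)
        rw [adv] at h1
        simp only [Function.update_self, one_ne_zero, if_false, Function.update_idem] at h1
        -- Leaving the second subtree clears entry L again, and the carry moves to the first L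
        -- entries.
        have hβL : Function.update β L 0 = β := by
          rw [← hβ L le_rfl, Function.update_eq_self]
        rw [hβL] at h1
        have := h0.append (by simp) h1
        rwa [add_assoc] at this
      · simp only [if_neg hb]
        refine ih (by omega) (fun β' h => ?_) hβ acc
        rw [hstep β' h, step]
        simp only [hs, if_neg hb, next_of_not_branching hb]

/-- The final decision sequence is zero again, so the next quadruple can start without any cleaning.
-/
theorem chain_root (R : TwoSpin n) (acc : ℕ) :
    Chain R (acc, fun _ => 0) (R.leaves n) (acc + R.total n, fun _ => 0, 0) :=
  chain_leaves le_rfl (L := 0) (fun β' _ => by simp) (fun _ _ => rfl) acc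

/-- A bound for the final sum therefore keeps all intermediate sums within the word length. -/
theorem Chain.le {R : TwoSpin n} {x m y} (h : Chain R x m y) : x.1 ≤ y.1 := by
  induction h with
  | one x => simp [round]
  | more _ _ ih => refine le_trans ?_ ih; simp [round]

/-! ### Sizes of the weights -/

/-- The largest weight of a variable, and at least 1. -/
def mf (S : TwoSpin n) (x : Fin n) : ℕ := max 1 (univ.sup fun s => S.f s x)

/-- The largest weight of a pair, and at least 1. -/
def mW (S : TwoSpin n) (x y : Fin n) : ℕ :=
  max 1 (univ.sup fun p : Fin 2 × Fin 2 => S.W p.1 p.2 x y)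

/-- A bound for all weights of a system. -/
def pot (S : TwoSpin n) : ℕ := max 1 S.val * (∏ x ∈ S.act, S.mf x) * pairProd S.act S.mW

theorem one_le_mf (S : TwoSpin n) (x : Fin n) : 1 ≤ S.mf x := le_max_left _ _

theorem one_le_mW (S : TwoSpin n) (x y : Fin n) : 1 ≤ S.mW x y := le_max_left _ _

theorem le_mf (S : TwoSpin n) (s : Fin 2) (x : Fin n) : S.f s x ≤ S.mf x :=
  (le_sup (f := fun s => S.f s x) (mem_univ s)).trans (le_max_right _ _)

theorem le_mW (S : TwoSpin n) (s t : Fin 2) (x y : Fin n) : S.W s t x y ≤ S.mW x y :=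
  (le_sup (f := fun p : Fin 2 × Fin 2 => S.W p.1 p.2 x y) (mem_univ (s, t))).trans
    (le_max_right _ _)

theorem mf_le {S : TwoSpin n} {x : Fin n} {c : ℕ} (h1 : 1 ≤ c) (h : ∀ s, S.f s x ≤ c) :
    S.mf x ≤ c := max_le h1 (Finset.sup_le fun s _ => h s)

theorem mW_le {S : TwoSpin n} {x y : Fin n} {c : ℕ} (h1 : 1 ≤ c) (h : ∀ s t, S.W s t x y ≤ c) :
    S.mW x y ≤ c := max_le h1 (Finset.sup_le fun p _ => h p.1 p.2)

theorem mW_symm {S : TwoSpin n} (h : S.Good) (x y : Fin n) : S.mW x y = S.mW y x :=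
  le_antisymm (mW_le (S.one_le_mW _ _) fun s t => h.symW s t x y ▸ S.le_mW t s y x)
    (mW_le (S.one_le_mW _ _) fun s t => h.symW s t y x ▸ S.le_mW t s x y)

theorem pot_pos (S : TwoSpin n) : 0 < S.pot := by
  unfold pot pairProd
  refine Nat.mul_pos (Nat.mul_pos (by omega) ?_) ?_
  · exact prod_pos fun x _ => S.one_le_mf x
  · refine prod_pos fun x _ => prod_pos fun y _ => ?_
    split_ifs
    · exact S.one_le_mW x y
    · exact one_pos

theorem one_le_pairProd (S : TwoSpin n) (A : Finset (Fin n)) : 1 ≤ pairProd A S.mW := by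
  refine one_le_prod' fun x _ => one_le_prod' fun y _ => ?_
  split_ifs
  · exact S.one_le_mW x y
  · rfl

theorem val_le_pot (S : TwoSpin n) : S.val ≤ S.pot := by
  have h1 : 1 ≤ ∏ x ∈ S.act, S.mf x := one_le_prod' fun x _ => S.one_le_mf x
  calc S.val ≤ max 1 S.val * 1 * 1 := by omega
    _ ≤ _ := by unfold pot; gcongr; exact S.one_le_pairProd _

theorem f_le_pot (S : TwoSpin n) {x : Fin n} (hx : x ∈ S.act) (s : Fin 2) :
    S.f s x ≤ S.pot := by
  have h1 : S.mf x ≤ ∏ x ∈ S.act, S.mf x :=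
    single_le_prod' (f := S.mf) (fun x _ => S.one_le_mf x) hx
  calc S.f s x ≤ 1 * S.mf x * 1 := by simpa using S.le_mf s x
    _ ≤ _ := by
      unfold pot
      gcongr
      · exact le_max_left _ _
      · exact S.one_le_pairProd _

theorem W_le_pot {S : TwoSpin n} (h : S.Good) {x y : Fin n} (hx : x ∈ S.act) (hy : y ∈ S.act)
    (hxy : x ≠ y) (s t : Fin 2) : S.W s t x y ≤ S.pot := by
  have h1 : 1 ≤ ∏ x ∈ S.act, S.mf x := one_le_prod' fun x _ => S.one_le_mf x
  have h2 : S.mW x y ≤ pairProd S.act S.mW := by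
    rw [← insert_erase hx, pairProd_insert (notMem_erase _ _) (mW_symm h)]
    have h3 : S.mW x y ≤ ∏ z ∈ S.act.erase x, S.mW x z :=
      single_le_prod' (f := S.mW x) (fun z _ => S.one_le_mW x z) (mem_erase.2 ⟨hxy.symm, hy⟩)
    calc S.mW x y = S.mW x y * 1 := by ring
      _ ≤ _ := by gcongr; exact S.one_le_pairProd _
  calc S.W s t x y ≤ 1 * 1 * S.mW x y := by simpa using S.le_mW s t x y
    _ ≤ _ := by
      unfold pot
      gcongr
      exact le_max_left _ _

/-- Isolates the factors that belong to v; treating v only redistributes them over the remaining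
variables. -/
theorem pot_split {S : TwoSpin n} (h : S.Good) {v : Fin n} (hv : v ∈ S.act) :
    S.pot = (max 1 S.val * S.mf v) * (∏ x ∈ S.act.erase v, S.mf x) *
      (∏ x ∈ S.act.erase v, S.mW v x) * pairProd (S.act.erase v) S.mW := by
  unfold pot
  have hp : pairProd S.act S.mW =
      (∏ x ∈ S.act.erase v, S.mW v x) * pairProd (S.act.erase v) S.mW := by
    conv_lhs => rw [← insert_erase hv]
    exact pairProd_insert (notMem_erase _ _) (mW_symm h)
  rw [hp, ← mul_prod_erase _ _ hv]
  ring

/-- The weight of v goes into `val`, and the pair factor of v and x goes into the weight of x. Both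
are already counted in the potential. -/
theorem pot_cond_le {S : TwoSpin n} (h : S.Good) {v : Fin n} (hv : v ∈ S.act) (s : Fin 2) :
    (S.cond v s).pot ≤ S.pot := by
  rw [pot_split h hv, pot, act_of_U (S' := S.cond v s) rfl]
  have h1 : max 1 (S.cond v s).val ≤ max 1 S.val * S.mf v := by
    refine max_le (Nat.mul_pos (by omega) (S.one_le_mf v)) ?_
    exact Nat.mul_le_mul (le_max_right _ _) (S.le_mf s v)
  have h2 : ∏ x ∈ S.act.erase v, (S.cond v s).mf x ≤
      (∏ x ∈ S.act.erase v, S.mf x) * ∏ x ∈ S.act.erase v, S.mW v x := by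
    rw [← prod_mul_distrib]
    refine prod_le_prod' fun x hx => mf_le (Nat.mul_pos (S.one_le_mf x) (S.one_le_mW v x)) ?_
    intro a
    simp only [cond]
    split_ifs
    · exact Nat.mul_le_mul (S.le_mf a x) (S.le_mW s a v x)
    · exact (S.le_mf a x).trans (Nat.le_mul_of_pos_right _ (S.one_le_mW v x))
  calc _ ≤ (max 1 S.val * S.mf v) * ((∏ x ∈ S.act.erase v, S.mf x) *
        ∏ x ∈ S.act.erase v, S.mW v x) * pairProd (S.act.erase v) S.mW := by
        gcongr
        exact le_of_eq rfl
    _ = _ := by ring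

theorem pot_elim₀_le {S : TwoSpin n} (h : S.Good) {v : Fin n} (hv : v ∈ S.act) :
    (S.elim₀ v).pot ≤ 2 * S.pot := by
  rw [pot_split h hv, pot, act_of_U (S' := S.elim₀ v) rfl]
  have h1 : max 1 (S.elim₀ v).val ≤ 2 * (max 1 S.val * S.mf v) := by
    have h3 : 1 ≤ max 1 S.val * S.mf v := Nat.mul_pos (by omega) (S.one_le_mf v)
    refine max_le (by omega) ?_
    have := Nat.mul_le_mul (le_max_right 1 S.val) (S.le_mf 0 v)
    have := Nat.mul_le_mul (le_max_right 1 S.val) (S.le_mf 1 v)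
    simp only [elim₀, mul_add]
    omega
  have h2 : 1 ≤ ∏ x ∈ S.act.erase v, S.mW v x := one_le_prod' fun x _ => S.one_le_mW v x
  calc _ ≤ (2 * (max 1 S.val * S.mf v)) * (∏ x ∈ S.act.erase v, S.mf x) * 1 *
        pairProd (S.act.erase v) S.mW := by rw [mul_one]; gcongr <;> exact le_of_eq rfl
    _ ≤ (2 * (max 1 S.val * S.mf v)) * (∏ x ∈ S.act.erase v, S.mf x) *
        (∏ x ∈ S.act.erase v, S.mW v x) * pairProd (S.act.erase v) S.mW := by gcongr
    _ = _ := by ring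

theorem nb_subset_erase {S : TwoSpin n} (h : S.Good) (v : Fin n) : S.nb v ⊆ S.act.erase v :=
  fun x hx => by
    rw [mem_erase, mem_act]
    exact ⟨fun hxv => h.notMem_nb v (hxv ▸ hx), (mem_nb.1 hx).1⟩

theorem pot_elim₁_le {S : TwoSpin n} (h : S.Good) {v a : Fin n} (hv : v ∈ S.act)
    (ha : S.nb v = {a}) : (S.elim₁ v).pot ≤ 2 * S.pot := by
  rw [pot_split h hv, pot, act_of_U (S' := S.elim₁ v) rfl]
  have ha' : a ∈ S.act.erase v := nb_subset_erase h v (by simp [ha])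
  have hone := Nat.mul_pos (S.one_le_mf v) (S.one_le_mW v a)
  have h2 : ∏ x ∈ S.act.erase v, (S.elim₁ v).mf x ≤
      (∏ x ∈ S.act.erase v, S.mf x) * (2 * (S.mf v * S.mW v a)) := by
    have : 2 * (S.mf v * S.mW v a) =
        ∏ x ∈ S.act.erase v, if x = a then 2 * (S.mf v * S.mW v a) else 1 := by
      rw [prod_ite_eq' (S.act.erase v) a, if_pos ha']
    rw [this, ← prod_mul_distrib]
    refine prod_le_prod' fun x hx => ?_
    by_cases hxa : x = a
    · subst hxa
      rw [if_pos rfl]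
      refine mf_le (Nat.mul_pos (S.one_le_mf x) (by omega)) fun s => ?_
      simp only [elim₁, ha, mem_singleton, if_true]
      refine Nat.mul_le_mul (S.le_mf s x) ?_
      have := Nat.mul_le_mul (S.le_mf 0 v) (S.le_mW 0 s v x)
      have := Nat.mul_le_mul (S.le_mf 1 v) (S.le_mW 1 s v x)
      omega
    · rw [if_neg hxa, mul_one]
      refine mf_le (S.one_le_mf x) fun s => ?_
      simp only [elim₁, ha, mem_singleton, hxa, if_false]
      exact S.le_mf s x
  have h3 : S.mW v a ≤ ∏ x ∈ S.act.erase v, S.mW v x :=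
    single_le_prod' (f := S.mW v) (fun x _ => S.one_le_mW v x) ha'
  calc _ ≤ max 1 S.val * ((∏ x ∈ S.act.erase v, S.mf x) * (2 * (S.mf v * S.mW v a))) *
        pairProd (S.act.erase v) S.mW := by gcongr <;> exact le_of_eq rfl
    _ ≤ max 1 S.val * ((∏ x ∈ S.act.erase v, S.mf x) *
        (2 * (S.mf v * ∏ x ∈ S.act.erase v, S.mW v x))) *
        pairProd (S.act.erase v) S.mW := by gcongr
    _ = _ := by ring

theorem pot_elim₂_le {S : TwoSpin n} (h : S.Good) {v a b : Fin n} (hv : v ∈ S.act) (hab : a ≠ b)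
    (hnb : S.nb v = {a, b}) : (S.elim₂ v).pot ≤ 2 * S.pot := by
  rw [pot_split h hv, pot, act_of_U (S' := S.elim₂ v) rfl]
  have ha' : a ∈ S.act.erase v := nb_subset_erase h v (by simp [hnb])
  have hb' : b ∈ S.act.erase v := nb_subset_erase h v (by simp [hnb])
  have h2 : pairProd (S.act.erase v) (S.elim₂ v).mW ≤
      pairProd (S.act.erase v) S.mW * (2 * (S.mf v * (S.mW v a * S.mW v b))) := by
    have hp := pairProd_single ha' hb' hab (g := fun x y =>
      if x ∈ S.nb v ∧ y ∈ S.nb v ∧ x ≠ y then 2 * (S.mf v * (S.mW v x * S.mW v y)) else 1) ?_ ?_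
    · rw [if_pos (by simp [hnb, hab])] at hp
      rw [← hp, ← pairProd_mul]
      refine pairProd_le fun x _ y _ _ => ?_
      have hone := Nat.mul_pos (S.one_le_mf v) (Nat.mul_pos (S.one_le_mW v x) (S.one_le_mW v y))
      split_ifs with hc
      · refine mW_le (Nat.mul_pos (S.one_le_mW x y) (by omega)) fun s t => ?_
        simp only [elim₂, if_pos hc]
        refine Nat.mul_le_mul (S.le_mW s t x y) ?_
        have h3 := Nat.mul_le_mul (S.le_mf 0 v)
          (Nat.mul_le_mul (S.le_mW 0 s v x) (S.le_mW 0 t v y))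
        have h4 := Nat.mul_le_mul (S.le_mf 1 v)
          (Nat.mul_le_mul (S.le_mW 1 s v x) (S.le_mW 1 t v y))
        simp only [mul_assoc] at h3 h4 ⊢
        omega
      · rw [mul_one]
        refine mW_le (S.one_le_mW x y) fun s t => ?_
        simp only [elim₂, if_neg hc]
        exact S.le_mW s t x y
    · intro x y
      by_cases hc : x ∈ S.nb v ∧ y ∈ S.nb v ∧ x ≠ y
      · rw [if_pos hc, if_pos ⟨hc.2.1, hc.1, hc.2.2.symm⟩]; ring
      · rw [if_neg hc, if_neg fun h' => hc ⟨h'.2.1, h'.1, h'.2.2.symm⟩]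
    · intro x _ y _ hxy h3 h4
      refine if_neg ?_
      rintro ⟨hx, hy, -⟩
      simp only [hnb, mem_insert, mem_singleton] at hx hy
      rcases hx with rfl | rfl <;> rcases hy with rfl | rfl <;> simp_all
  have h3 : S.mW v a * S.mW v b ≤ ∏ x ∈ S.act.erase v, S.mW v x := by
    rw [← prod_pair hab, ← hnb]
    exact prod_le_prod_of_subset_of_one_le' (nb_subset_erase h v) fun x _ _ => S.one_le_mW v x
  calc _ ≤ max 1 S.val * (∏ x ∈ S.act.erase v, S.mf x) *
        (pairProd (S.act.erase v) S.mW * (2 * (S.mf v * (S.mW v a * S.mW v b)))) := by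
        gcongr
        · exact le_of_eq rfl
        · exact le_of_eq rfl
    _ ≤ max 1 S.val * (∏ x ∈ S.act.erase v, S.mf x) *
        (pairProd (S.act.erase v) S.mW * (2 * (S.mf v * ∏ x ∈ S.act.erase v, S.mW v x))) := by
        gcongr
    _ = _ := by ring

/-- Fixing a value costs nothing, and an elimination replaces a product by a sum of two such
products. So n steps add at most n bits. -/
theorem pot_next_le {S : TwoSpin n} (h : S.Good) {v : Fin n} (hv : v ∈ S.act) (s : Fin 2) :
    (S.next v s).pot ≤ 2 * S.pot := by
  unfold next
  split_ifs with h0 h3 h2 h1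
  · have := pot_cond_le h hv 0; omega
  · have := pot_cond_le h hv s; omega
  · obtain ⟨a, b, hab, h2'⟩ := card_eq_two.1 h2
    exact pot_elim₂_le h hv hab h2'
  · obtain ⟨a, h1'⟩ := card_eq_one.1 h1
    exact pot_elim₁_le h hv h1'
  · exact pot_elim₀_le h hv

end TwoSpin

namespace TwoSpin

open Finset

variable {n : ℕ}

/-! ### The number of leaves -/

/-- The weight of a variable with `d` neighbours in the analysis of the branching tree. -/
noncomputable def degWt (d : ℕ) : ℝ :=
  if d ≤ 1 then 1 else if d = 2 then 1.125 else if d = 3 then 1.2 else if d = 4 then 1.259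
  else 1.269

/-- The weight of a variable with `d ≤ 3` neighbours when all degrees are at most 3. -/
noncomputable def cubicWt (d : ℕ) : ℝ := if d ≤ 2 then 1 else 1.2

theorem degWt_of_le_one {d : ℕ} (h : d ≤ 1) : degWt d = 1 := by simp [degWt, h]
theorem degWt_two : degWt 2 = 1.125 := by norm_num [degWt]
theorem degWt_three : degWt 3 = 1.2 := by norm_num [degWt]
theorem degWt_four : degWt 4 = 1.259 := by norm_num [degWt]
theorem degWt_of_five_le {d : ℕ} (h : 5 ≤ d) : degWt d = 1.269 := by
  unfold degWt
  rw [if_neg (by omega), if_neg (by omega), if_neg (by omega), if_neg (by omega)]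

theorem one_le_degWt (d : ℕ) : 1 ≤ degWt d := by
  unfold degWt; split_ifs <;> norm_num

theorem degWt_le (d : ℕ) : degWt d ≤ 1.269 := by
  unfold degWt; split_ifs <;> norm_num

theorem degWt_mono : Monotone degWt := by
  intro d e h
  unfold degWt
  split_ifs <;> first | omega | norm_num

theorem one_le_cubicWt (d : ℕ) : 1 ≤ cubicWt d := by
  unfold cubicWt; split_ifs <;> norm_num

theorem cubicWt_mono : Monotone cubicWt := by
  intro d e h
  unfold cubicWt
  split_ifs <;> first | omega | norm_num

theorem cubicWt_le_degWt {d : ℕ} (h : d ≤ 3) : cubicWt d ≤ degWt d := by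
  unfold cubicWt degWt
  split_ifs <;> first | omega | norm_num

theorem prod_wt_mono {w : ℕ → ℝ} (hw : Monotone w) (h1 : ∀ d, 1 ≤ w d) {A B : Finset (Fin n)}
    (hAB : A ⊆ B) {d e : Fin n → ℕ} (hde : ∀ x ∈ A, d x ≤ e x) :
    ∏ x ∈ A, w (d x) ≤ ∏ x ∈ B, w (e x) :=
  calc ∏ x ∈ A, w (d x) ≤ ∏ x ∈ A, w (e x) :=
        prod_le_prod (fun x _ => by linarith [h1 (d x)]) fun x hx => hw (hde x hx)
    _ ≤ _ := by
      rw [← prod_sdiff hAB]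
      refine le_mul_of_one_le_left (prod_nonneg fun x _ => by linarith [h1 (e x)]) ?_
      exact one_le_prod fun x _ => h1 _

/-- This is the branching inequality when all d neighbours have the same degree e. For d ≥ 6 the
right side is constant and both bases are at most 1, so d = 6 is the worst case. What remains is a
finite numerical check, which the constants in `degWt` are chosen to pass. -/
theorem degWt_branch {d e : ℕ} (hd : 4 ≤ d) (he : 2 ≤ e) (hed : e ≤ d) :
    (degWt (e - 1) / degWt e) ^ d + (1 / degWt e) ^ d ≤ degWt d := by
  have hpos : ∀ i, 0 < degWt i := fun i => by linarith [one_le_degWt i]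
  rcases Nat.lt_or_ge d 6 with h6 | h6
  · interval_cases d
    · interval_cases e <;>
        norm_num [degWt_two, degWt_three, degWt_four, degWt_of_le_one]
    · interval_cases e <;>
        norm_num [degWt_two, degWt_three, degWt_four, degWt_of_le_one, degWt_of_five_le]
  · have hp : degWt (e - 1) / degWt e ≤ 1 := div_le_one_of_le₀ (degWt_mono (by omega)) (hpos e).le
    have hq : 1 / degWt e ≤ 1 := div_le_one_of_le₀ (one_le_degWt e) (hpos e).le
    have h1 := pow_le_pow_of_le_one (div_pos (hpos (e - 1)) (hpos e)).le hp h6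
    have h2 := pow_le_pow_of_le_one (div_pos one_pos (hpos e)).le hq h6
    rw [degWt_of_five_le (by omega : 5 ≤ d)]
    refine (add_le_add h1 h2).trans ?_
    rcases Nat.lt_or_ge e 6 with he6 | he6
    · interval_cases e <;>
        norm_num [degWt_two, degWt_three, degWt_four, degWt_of_le_one, degWt_of_five_le]
    · rw [degWt_of_five_le (by omega : 5 ≤ e), degWt_of_five_le (by omega : 5 ≤ e - 1)]
      norm_num

/-- The inequality between geometric and arithmetic mean, applied to the powers with exponent |N|.
-/
theorem prod_le_avg_pow {N : Finset (Fin n)} (hN : N.Nonempty) {p : Fin n → ℝ}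
    (hp : ∀ x ∈ N, 0 ≤ p x) :
    ∏ x ∈ N, p x ≤ ∑ x ∈ N, (N.card : ℝ)⁻¹ * p x ^ N.card := by
  have hc : (N.card : ℝ) ≠ 0 := by exact_mod_cast hN.card_pos.ne'
  have := Real.geom_mean_le_arith_mean_weighted N (fun _ => (N.card : ℝ)⁻¹)
    (fun x => p x ^ N.card) (fun _ _ => by positivity) (by simp [hc])
    fun x hx => pow_nonneg (hp x hx) _
  refine le_trans (le_of_eq ?_) this
  refine prod_congr rfl fun x hx => ?_
  rw [Real.pow_rpow_inv_natCast (hp x hx) hN.card_pos.ne']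

/-- After division by the product on the right, both summands are products over N. Bounding each by
an average of |N|-th powers reduces mixed degrees to equal ones, which is `degWt_branch`. -/
theorem prod_degWt_branch {N : Finset (Fin n)} {e : Fin n → ℕ} (h4 : 4 ≤ N.card)
    (h2 : ∀ x ∈ N, 2 ≤ e x) (hle : ∀ x ∈ N, e x ≤ N.card) :
    ∏ x ∈ N, degWt (e x - 1) + 1 ≤ degWt N.card * ∏ x ∈ N, degWt (e x) := by
  have hpos : ∀ i, 0 < degWt i := fun i => by linarith [one_le_degWt i]
  have hne : N.Nonempty := card_pos.1 (by omega)
  have hP : 0 < ∏ x ∈ N, degWt (e x) := prod_pos fun x _ => hpos _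
  have h1 := prod_le_avg_pow hne (p := fun x => degWt (e x - 1) / degWt (e x))
    fun x _ => (div_pos (hpos _) (hpos _)).le
  have h3 := prod_le_avg_pow hne (p := fun x => 1 / degWt (e x))
    fun x _ => (div_pos one_pos (hpos _)).le
  have hc : (N.card : ℝ) ≠ 0 := by exact_mod_cast hne.card_pos.ne'
  have h5 : ∏ x ∈ N, (degWt (e x - 1) / degWt (e x)) + ∏ x ∈ N, (1 / degWt (e x)) ≤
      degWt N.card := by
    refine (add_le_add h1 h3).trans ?_
    rw [← sum_add_distrib]
    calc _ ≤ ∑ x ∈ N, (N.card : ℝ)⁻¹ * degWt N.card := by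
          refine sum_le_sum fun x hx => ?_
          rw [← mul_add]
          exact mul_le_mul_of_nonneg_left (degWt_branch h4 (h2 x hx) (hle x hx)) (by positivity)
      _ = _ := by rw [sum_const, nsmul_eq_mul]; field_simp
  rw [prod_div_distrib, prod_div_distrib, prod_const_one, ← add_div, div_le_iff₀ hP] at h5
  exact h5

/-! ### The measure on the branching tree. -/

/-- The active variables that are not forced to be 0. -/
def free (S : TwoSpin n) : Finset (Fin n) := S.act.filter fun x => S.f 1 x ≠ 0

/-- The degree of a variable among the free variables. -/
def freeDeg (S : TwoSpin n) (x : Fin n) : ℕ := (S.free.filter fun y => S.adj x y ≠ 0).card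

/-- Adjacent variables exclude each other. -/
def Plain (S : TwoSpin n) : Prop := ∀ x y, S.adj x y ≠ 0 → S.W 1 1 x y = 0

theorem nb_next_of_adj {S S' : TwoSpin n} {v : Fin n} (hU : S'.U = S.rm v)
    (hadj : S'.adj = S.adj) (x : Fin n) : S'.nb x = (S.nb x).erase v := by
  ext y
  rw [mem_nb, mem_erase, mem_nb, hU, hadj]
  by_cases hy : y = v <;> simp [rm, hy]

theorem card_nb_erase_le (S : TwoSpin n) {v : Fin n} (h : S.Good) (hv : v ∈ S.act) (x : Fin n) :
    ((S.nb x).erase v).card ≤ if x ∈ S.nb v then (S.nb x).card - 1 else (S.nb x).card := by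
  split_ifs with hx
  · rw [card_erase_of_mem]
    rw [mem_nb, h.symAdj]
    exact ⟨mem_act.1 hv, (mem_nb.1 hx).2⟩
  · exact card_erase_le

theorem adj_next (S : TwoSpin n) (v : Fin n) (s : Fin 2)
    (h : S.f 1 v = 0 ∨ (S.nb v).card ≠ 2) : (S.next v s).adj = S.adj := by
  unfold next
  split_ifs with h1 h2 h3
  · rfl
  · rfl
  · rcases h with h | h
    · exact absurd h h1
    · exact absurd h3 h
  · rfl
  · rfl

/-- A neighbour of v loses v and gains at most the other neighbour of v. -/
theorem card_nb_elim₂_le {S : TwoSpin n} (h : S.Good) {v a b : Fin n} (hv : v ∈ S.act)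
    (hab : a ≠ b) (hnb : S.nb v = {a, b}) (x : Fin n) :
    ((S.elim₂ v).nb x).card ≤ (S.nb x).card := by
  by_cases hx : x ∈ S.nb v
  · have hvx : v ∈ S.nb x := by
      rw [mem_nb, h.symAdj]
      exact ⟨mem_act.1 hv, (mem_nb.1 hx).2⟩
    have hsub : (S.elim₂ v).nb x ⊆ ((S.nb v).erase x) ∪ (S.nb x).erase v := by
      intro y hy
      rw [mem_nb] at hy
      have hyv : y ≠ v := fun hyv => by simp [elim₂, rm, hyv] at hy
      have hyU : S.U y ≠ 0 := by simpa [elim₂, rm, hyv] using hy.1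
      rw [mem_union, mem_erase, mem_erase]
      by_cases hc : x ∈ S.nb v ∧ y ∈ S.nb v ∧ x ≠ y
      · exact Or.inl ⟨hc.2.2.symm, hc.2.1⟩
      · refine Or.inr ⟨hyv, mem_nb.2 ⟨hyU, ?_⟩⟩
        have := hy.2
        simpa only [elim₂, if_neg hc] using this
    have h1 : ((S.nb v).erase x).card = 1 := by
      rw [card_erase_of_mem hx, hnb, card_pair hab]
    have h2 := card_erase_of_mem hvx
    have h3 := card_pos.2 ⟨v, hvx⟩
    have := (card_le_card hsub).trans (card_union_le _ _)
    omega
  · refine card_le_card fun y hy => ?_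
    rw [mem_nb] at hy ⊢
    have hyv : y ≠ v := fun hyv => by simp [elim₂, rm, hyv] at hy
    simpa [elim₂, rm, hyv, hx] using hy

theorem card_nb_next_le {S : TwoSpin n} (h : S.Good) {v : Fin n} (hv : v ∈ S.act) (s : Fin 2)
    (x : Fin n) : ((S.next v s).nb x).card ≤ (S.nb x).card := by
  by_cases hc : S.f 1 v = 0 ∨ (S.nb v).card ≠ 2
  · rw [nb_next_of_adj (S.next_U v s) (S.adj_next v s hc)]
    exact card_erase_le
  · push Not at hc
    obtain ⟨a, b, hab, h2⟩ := card_eq_two.1 hc.2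
    have : S.next v s = S.elim₂ v := by simp [next, hc.1, hc.2]
    rw [this]
    exact card_nb_elim₂_le h hv hab h2 x

/-- What the selection rule says about a variable that is neither forced nor of degree 0 or 1. -/
theorem IsSel.key_cases {S : TwoSpin n} {v : Fin n} (hv : S.IsSel v) (hf : S.f 1 v ≠ 0)
    (h2 : 2 ≤ (S.nb v).card) : ∀ x ∈ S.act, S.f 1 x ≠ 0 ∧ 2 ≤ (S.nb x).card ∧
      (4 ≤ (S.nb v).card → (S.nb x).card ≤ (S.nb v).card) ∧
      ((S.nb v).card ≤ 3 → (S.nb x).card ≤ 3) ∧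
      ((S.nb v).card = 3 → (S.nb x).card = 3) := by
  intro x hx
  have h := (hv.2 x hx).1
  have hn := S.card_nb_le v
  unfold key at h
  rw [if_neg hf, if_neg (show ¬ (S.nb v).card ≤ 1 by omega)] at h
  by_cases hfx : S.f 1 x = 0
  · rw [if_pos hfx] at h
    split_ifs at h <;> omega
  rw [if_neg hfx] at h
  refine ⟨hfx, ?_⟩
  split_ifs at h <;> omega

/-- Only degrees matter here, not the pair weights, so the bound survives elimination of degree 2.
The priorities allow branching only if all degrees are 3. Both branches then remove v and reduce its
three neighbours to degree 2, of weight 1, so four factors 1.2 disappear. -/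
theorem leaves_cubic {k : ℕ} {S : TwoSpin n} (h : S.Good) (h3 : ∀ x ∈ S.act, (S.nb x).card ≤ 3) :
    (S.leaves k : ℝ) ≤ ∏ x ∈ S.act, cubicWt (S.nb x).card := by
  induction k generalizing S with
  | zero =>
    simpa [leaves] using one_le_prod (s := S.act) (f := fun x => cubicWt (S.nb x).card)
      fun x _ => one_le_cubicWt (S.nb x).card
  | succ k ih =>
    rw [leaves]
    cases hs : S.sel with
    | none => exact ih h h3
    | some v =>
      have hsel := sel_eq_some.1 hs
      have hv := hsel.1
      have hchild : ∀ s, ((S.next v s).leaves k : ℝ) ≤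
          ∏ x ∈ S.act.erase v, cubicWt ((S.next v s).nb x).card := fun s => by
        have := ih (h.next v s) fun x hx => ?_
        · rwa [act_next] at this
        · rw [act_next] at hx
          exact (card_nb_next_le h hv s x).trans (h3 x (mem_of_mem_erase hx))
      by_cases hb : S.Branching v
      · simp only [if_pos hb]
        push_cast
        have hcard : (S.nb v).card = 3 := le_antisymm (h3 v hv) hb.2
        have hall : ∀ x ∈ S.act, (S.nb x).card = 3 := fun x hx =>
          (hsel.key_cases hb.1 (by omega) x hx).2.2.2.2 hcard
        have hsub := nb_subset_erase h v
        set R := (S.act.erase v) \ S.nb v with hR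
        have hRcard : R.card + 4 = S.act.card := by
          have h5 := card_sdiff_add_card_eq_card hsub
          rw [card_erase_of_mem hv] at h5
          have := card_pos.2 ⟨v, hv⟩
          rw [← hR] at h5
          omega
        have hle : ∀ s, ((S.next v s).leaves k : ℝ) ≤ 1.2 ^ R.card := fun s => by
          refine (hchild s).trans ?_
          rw [← prod_sdiff hsub]
          have hN : ∏ x ∈ S.nb v, cubicWt ((S.next v s).nb x).card = 1 := by
            refine prod_eq_one fun x hx => ?_
            rw [nb_next_of_adj (S.next_U v s) (S.adj_next v s (Or.inr (by omega)))]
            have h6 := S.card_nb_erase_le h hv x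
            have h7 := hall x (mem_of_mem_erase (hsub hx))
            rw [if_pos hx, h7] at h6
            simp [cubicWt, h6]
          rw [hN, mul_one, ← prod_const]
          refine prod_le_prod (fun x _ => by linarith [one_le_cubicWt ((S.next v s).nb x).card])
            fun x _ => ?_
          unfold cubicWt
          split_ifs <;> norm_num
        have hRHS : ∏ x ∈ S.act, cubicWt (S.nb x).card = 1.2 ^ (R.card + 4) := by
          rw [hRcard, ← prod_const]
          exact prod_congr rfl fun x hx => by rw [hall x hx]; norm_num [cubicWt]
        rw [hRHS]
        calc _ ≤ (1.2 : ℝ) ^ R.card + 1.2 ^ R.card := add_le_add (hle 0) (hle 1)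
          _ ≤ _ := by
            -- Two equal branches are paid for by 2 ≤ 1.2⁴ = 2.0736.
            rw [pow_add]
            have : (0 : ℝ) < 1.2 ^ R.card := by positivity
            nlinarith
      · simp only [if_neg hb]
        exact (hchild 0).trans (prod_wt_mono cubicWt_mono one_le_cubicWt (erase_subset _ _)
          fun x _ => card_nb_next_le h hv 0 x)

/-- Weights are only ever multiplied, so a variable once forced to 0 stays forced. -/
theorem free_next_subset {S : TwoSpin n} (v : Fin n) (s : Fin 2) :
    (S.next v s).free ⊆ S.free.erase v := by
  intro x hx
  rw [free, mem_filter, act_next, mem_erase] at hx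
  obtain ⟨⟨hxv, hx⟩, hf⟩ := hx
  rw [mem_erase, free, mem_filter]
  refine ⟨hxv, hx, fun h0 => hf ?_⟩
  unfold next
  split_ifs <;> simp [cond, elim₀, elim₁, elim₂, h0]

theorem freeDeg_next_le {S : TwoSpin n} {v : Fin n} {s : Fin 2}
    (hadj : (S.next v s).adj = S.adj) (x : Fin n) : (S.next v s).freeDeg x ≤ S.freeDeg x := by
  refine card_le_card fun y hy => ?_
  rw [mem_filter, hadj] at hy
  rw [mem_filter]
  exact ⟨mem_of_mem_erase (free_next_subset v s hy.1), hy.2⟩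

/-- Only the elimination of a variable with two neighbours changes adjacencies or pair weights. -/
theorem plain_next {S : TwoSpin n} (h : S.Plain) {v : Fin n} {s : Fin 2}
    (hc : S.f 1 v = 0 ∨ (S.nb v).card ≠ 2) : (S.next v s).Plain := by
  unfold next
  split_ifs with h1 h2 h3
  · exact h
  · exact h
  · rcases hc with hc | hc
    · exact absurd hc h1
    · exact absurd h3 hc
  · exact h
  · exact h

/-- The value 0 lowers the degree of every neighbour by one; the value 1 removes all neighbours from
the free variables. Variables outside the closed neighbourhood of v contribute a common factor, and
the rest is `prod_degWt_branch`. -/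
theorem leaves_branch {k : ℕ} {S : TwoSpin n} (h : S.Good) (hp : S.Plain) {v : Fin n}
    (hsel : S.IsSel v) (hf : S.f 1 v ≠ 0) (h4 : 4 ≤ (S.nb v).card)
    (ih : ∀ s, ((S.next v s).leaves k : ℝ) ≤
      ∏ x ∈ (S.next v s).free, degWt ((S.next v s).freeDeg x)) :
    ((S.next v 0).leaves k : ℝ) + (S.next v 1).leaves k ≤ ∏ x ∈ S.free, degWt (S.freeDeg x) := by
  have hv := hsel.1
  have hall := hsel.key_cases hf (by omega)
  have hfree : S.free = S.act := filter_true_of_mem fun x hx => (hall x hx).1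
  have hdeg : ∀ x, S.freeDeg x = (S.nb x).card := fun x => by rw [freeDeg, hfree, nb]
  have hsub := nb_subset_erase h v
  have hadj : ∀ s, (S.next v s).adj = S.adj := fun s => S.adj_next v s (Or.inr (by omega))
  have hd' : ∀ s x, (S.next v s).freeDeg x ≤
      if x ∈ S.nb v then (S.nb x).card - 1 else (S.nb x).card := fun s x => by
    refine (card_le_card fun y hy => ?_).trans (S.card_nb_erase_le h hv x)
    rw [mem_filter, hadj] at hy
    have h5 := mem_erase.1 (free_next_subset v s hy.1)
    rw [mem_erase, mem_nb]
    exact ⟨h5.1, mem_act.1 (hfree ▸ h5.2), hy.2⟩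
  set R := (S.act.erase v) \ S.nb v with hR
  have h0 : ((S.next v 0).leaves k : ℝ) ≤
      (∏ x ∈ R, degWt (S.nb x).card) * ∏ x ∈ S.nb v, degWt ((S.nb x).card - 1) := by
    refine (ih 0).trans ?_
    refine (prod_wt_mono degWt_mono one_le_degWt (free_next_subset v 0)
      fun x _ => hd' 0 x).trans ?_
    rw [hfree, ← prod_sdiff hsub]
    refine le_of_eq ?_
    congr 1
    · exact prod_congr rfl fun x hx => by rw [if_neg (mem_sdiff.1 hx).2]
    · exact prod_congr rfl fun x hx => by rw [if_pos hx]
  have h1 : ((S.next v 1).leaves k : ℝ) ≤ ∏ x ∈ R, degWt (S.nb x).card := by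
    refine (ih 1).trans ?_
    refine prod_wt_mono degWt_mono one_le_degWt (fun x hx => ?_) fun x _ => ?_
    · have h5 := mem_erase.1 (free_next_subset v 1 hx)
      rw [hfree] at h5
      rw [hR, mem_sdiff, mem_erase]
      refine ⟨h5, fun hxn => ?_⟩
      have hx1 := (mem_filter.1 hx).2
      have hU := mem_act.1 h5.2
      -- Conditioning on v = 1 multiplies the weight of x = 1 by an exclusion factor 0, so x is
      -- forced.
      simp [next, hf, show 3 ≤ (S.nb v).card by omega, cond, rm, h5.1, hU,
        hp v x (mem_nb.1 hxn).2] at hx1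
    · refine (hd' 1 x).trans ?_
      split_ifs <;> omega
  have hmain := prod_degWt_branch (e := fun x => (S.nb x).card) h4
    (fun x hx => (hall x (mem_of_mem_erase (hsub hx))).2.1)
    fun x hx => (hall x (mem_of_mem_erase (hsub hx))).2.2.1 h4
  have hRHS : ∏ x ∈ S.free, degWt (S.freeDeg x) = (∏ x ∈ R, degWt (S.nb x).card) *
      (degWt (S.nb v).card * ∏ x ∈ S.nb v, degWt (S.nb x).card) := by
    simp only [hdeg]
    rw [hfree, ← mul_prod_erase _ _ hv, ← prod_sdiff hsub]
    ring
  rw [hRHS]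
  have hRpos : 0 ≤ ∏ x ∈ R, degWt (S.nb x).card :=
    prod_nonneg fun x _ => by linarith [one_le_degWt (S.nb x).card]
  calc _ ≤ (∏ x ∈ R, degWt (S.nb x).card) *
        (∏ x ∈ S.nb v, degWt ((S.nb x).card - 1) + 1) := by linarith
    _ ≤ _ := mul_le_mul_of_nonneg_left hmain hRpos

/-- Adjacency remains exclusion until an unforced variable of degree 2 or 3 is selected for the
first time. By the priorities nothing is forced then and all degrees are at most 3, so
`leaves_cubic` takes over. Forced variables do not count in the measure. -/
theorem leaves_plain {k : ℕ} {S : TwoSpin n} (h : S.Good) (hp : S.Plain) :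
    (S.leaves k : ℝ) ≤ ∏ x ∈ S.free, degWt (S.freeDeg x) := by
  induction k generalizing S with
  | zero =>
    simpa [leaves] using one_le_prod (s := S.free) (f := fun x => degWt (S.freeDeg x))
      fun x _ => one_le_degWt (S.freeDeg x)
  | succ k ih =>
    by_cases hcub : ∃ v, S.sel = some v ∧ S.f 1 v ≠ 0 ∧
        ((S.nb v).card = 2 ∨ (S.nb v).card = 3)
    · obtain ⟨v, hs, hf, hd⟩ := hcub
      have hall := (sel_eq_some.1 hs).key_cases hf (by omega)
      have hfree : S.free = S.act := filter_true_of_mem fun x hx => (hall x hx).1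
      have hdeg : ∀ x, S.freeDeg x = (S.nb x).card := fun x => by rw [freeDeg, hfree, nb]
      have h3 : ∀ x ∈ S.act, (S.nb x).card ≤ 3 := fun x hx => (hall x hx).2.2.2.1 (by omega)
      refine (leaves_cubic h h3).trans ?_
      rw [hfree]
      refine prod_le_prod (fun x _ => by linarith [one_le_cubicWt (S.nb x).card]) fun x hx => ?_
      rw [hdeg]
      exact cubicWt_le_degWt (h3 x hx)
    rw [leaves]
    cases hs : S.sel with
    | none => exact ih h hp
    | some v =>
      have hc : S.f 1 v = 0 ∨ (S.nb v).card ≠ 2 := by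
        by_contra hc
        push Not at hc
        exact hcub ⟨v, hs, hc.1, Or.inl hc.2⟩
      have ih' : ∀ s, ((S.next v s).leaves k : ℝ) ≤
          ∏ x ∈ (S.next v s).free, degWt ((S.next v s).freeDeg x) :=
        fun s => ih (h.next v s) (plain_next hp hc)
      by_cases hb : S.Branching v
      · simp only [if_pos hb]
        push_cast
        refine leaves_branch h hp (sel_eq_some.1 hs) hb.1 ?_ ih'
        by_contra hlt
        exact hcub ⟨v, hs, hb.1, Or.inr (by have := hb.2; omega)⟩
      · simp only [if_neg hb]
        refine (ih' 0).trans (prod_wt_mono degWt_mono one_le_degWt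
          ((free_next_subset v 0).trans (erase_subset _ _)) fun x _ => ?_)
        exact freeDeg_next_le (S.adj_next v 0 hc) x

theorem leaves_le {k : ℕ} {S : TwoSpin n} (h : S.Good) (hp : S.Plain) :
    (S.leaves k : ℝ) ≤ 1.269 ^ S.act.card := by
  refine (leaves_plain h hp).trans ?_
  calc ∏ x ∈ S.free, degWt (S.freeDeg x) ≤ ∏ x ∈ S.free, (1.269 : ℝ) :=
        prod_le_prod (fun x _ => by linarith [one_le_degWt (S.freeDeg x)]) fun x _ => degWt_le _
    _ = 1.269 ^ S.free.card := by rw [prod_const]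
    _ ≤ _ := pow_le_pow_right₀ (by norm_num) (card_le_card (filter_subset _ _))

end TwoSpin

/-! ### Bicliques as independent sets of a two-spin system -/

namespace InducedBiclique

open Finset

variable {n : ℕ}

/-- One if `i = j`, and zero otherwise, for `i, j ≤ 1`. -/
def eqN (i j : ℕ) : ℕ := 1 - ((i - j) + (j - i))

/-- Four vertices: two on each side. -/
abbrev Quad (n : ℕ) := Fin n × Fin n × Fin n × Fin n

/-- The system for the sides `N(c) ∩ N(d) \ (N(a) ∪ N(b))` and `N(a) ∩ N(b) \ (N(c) ∪ N(d))`,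
whose vertices have the weights `X` and `Y`, for the graph with adjacency matrix `A`. -/
def root (A : Fin n → Fin n → ℕ) (X Y : ℕ) (q : Quad n) : TwoSpin n where
  U x := A q.1 x * A q.2.1 x * (1 - (A q.2.2.1 x + A q.2.2.2 x)) +
    A q.2.2.1 x * A q.2.2.2 x * (1 - (A q.1 x + A q.2.1 x))
  adj x y := eqN (A x y) (eqN (A q.1 x) (A q.1 y))
  f s x := if s = 0 then 1 else A q.1 x * Y + (1 - A q.1 x) * X
  W s t x y := if s = 1 ∧ t = 1 then 1 - eqN (A x y) (eqN (A q.1 x) (A q.1 y)) else 1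
  val := 1

open Classical in
/-- The adjacency matrix. -/
noncomputable def ad (G : SimpleGraph (Fin n)) (x y : Fin n) : ℕ := if G.Adj x y then 1 else 0

variable {G : SimpleGraph (Fin n)}

theorem ad_ne_zero {x y : Fin n} : ad G x y ≠ 0 ↔ G.Adj x y := by
  unfold ad; split_ifs with h <;> simp [h]

theorem ad_symm (x y : Fin n) : ad G x y = ad G y x := by
  classical
  exact if_congr (G.adj_comm x y) rfl rfl

/-- The pairs in the quadruple are distinct nonadjacent vertices. -/
def Valid (G : SimpleGraph (Fin n)) (q : Quad n) : Prop :=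
  q.1 ≠ q.2.1 ∧ ¬ G.Adj q.1 q.2.1 ∧ q.2.2.1 ≠ q.2.2.2 ∧ ¬ G.Adj q.2.2.1 q.2.2.2

theorem root_act {X Y : ℕ} {q : Quad n} {x : Fin n} : x ∈ (root (ad G) X Y q).act ↔
    (G.Adj q.1 x ∧ G.Adj q.2.1 x ∧ ¬ G.Adj q.2.2.1 x ∧ ¬ G.Adj q.2.2.2 x) ∨
    (G.Adj q.2.2.1 x ∧ G.Adj q.2.2.2 x ∧ ¬ G.Adj q.1 x ∧ ¬ G.Adj q.2.1 x) := by
  rw [TwoSpin.mem_act]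
  simp only [root, ad]
  by_cases h1 : G.Adj q.1 x <;> by_cases h2 : G.Adj q.2.1 x <;> by_cases h3 : G.Adj q.2.2.1 x <;>
    by_cases h4 : G.Adj q.2.2.2 x <;> simp [h1, h2, h3, h4]

theorem root_adj {X Y : ℕ} {q : Quad n} {x y : Fin n} : (root (ad G) X Y q).adj x y =
    eqN (ad G x y) (eqN (ad G q.1 x) (ad G q.1 y)) := rfl

theorem eqN_symm (i j : ℕ) : eqN i j = eqN j i := by unfold eqN; omega

theorem root_adj_ne_zero {X Y : ℕ} {q : Quad n} {x y : Fin n} :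
    (root (ad G) X Y q).adj x y ≠ 0 ↔ (G.Adj x y ↔ (G.Adj q.1 x ↔ G.Adj q.1 y)) := by
  rw [root_adj]
  unfold ad eqN
  by_cases h1 : G.Adj q.1 x <;> by_cases h2 : G.Adj q.1 y <;> by_cases h3 : G.Adj x y <;>
    simp [h1, h2, h3]

theorem root_W_one {X Y : ℕ} {q : Quad n} {x y : Fin n} : (root (ad G) X Y q).W 1 1 x y =
    1 - (root (ad G) X Y q).adj x y := by simp [root]

theorem root_good (G : SimpleGraph (Fin n)) (X Y : ℕ) (q : Quad n) :
    (root (ad G) X Y q).Good where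
  symW s t x y := by
    simp only [root]
    rw [ad_symm x y, eqN_symm (ad G q.1 x)]
    simp only [and_comm]
  symAdj x y := by rw [root_adj, root_adj, ad_symm x y, eqN_symm (ad G q.1 x)]
  irrefl x := by
    by_contra h
    rw [← ne_eq, root_adj_ne_zero] at h
    simp at h
  triv x y _ h s t := by
    rw [root_adj] at h
    simp [root, h]

theorem root_plain (G : SimpleGraph (Fin n)) (X Y : ℕ) (q : Quad n) :
    (root (ad G) X Y q).Plain := by
  intro x y h
  rw [root_W_one]
  omega

theorem card_inter_lt {c : ℕ} (hc : G.IsCClosed c) {u v : Fin n} (huv : u ≠ v)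
    (hadj : ¬ G.Adj u v) : (G.neighborSet u ∩ G.neighborSet v).ncard + 1 ≤ c := by
  classical
  refine lt_of_le_of_lt ?_ (hc u)
  unfold SimpleGraph.closureNumber
  have h := Finset.le_sup (s := univ.filter fun w => w ≠ u ∧ ¬ G.Adj u w)
    (f := fun w => (G.neighborSet u ∩ G.neighborSet w).ncard) (b := v) (by simp [huv.symm, hadj])
  convert h

/-- Each side lies in the common neighbourhood of a distinct nonadjacent pair, hence has at most c -
1 elements. -/
theorem card_root_act {c : ℕ} (hc : G.IsCClosed c) {X Y : ℕ} {q : Quad n} (hq : Valid G q) :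
    (root (ad G) X Y q).act.card + 2 ≤ 2 * c := by
  have h1 := card_inter_lt hc hq.1 hq.2.1
  have h2 := card_inter_lt hc hq.2.2.1 hq.2.2.2
  have hsub : ((root (ad G) X Y q).act : Set (Fin n)) ⊆
      (G.neighborSet q.1 ∩ G.neighborSet q.2.1) ∪ (G.neighborSet q.2.2.1 ∩
        G.neighborSet q.2.2.2) := by
    intro x hx
    rw [mem_coe, root_act] at hx
    rcases hx with hx | hx
    · exact Or.inl ⟨hx.1, hx.2.1⟩
    · exact Or.inr ⟨hx.1, hx.2.1⟩
  have h3 := (Set.ncard_le_ncard hsub).trans (Set.ncard_union_le _ _)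
  rw [Set.ncard_coe_finset] at h3
  omega

/-- The number of leaves of the branching tree. -/
theorem root_leaves_le {c : ℕ} (hc : G.IsCClosed c) {X Y : ℕ} {q : Quad n} (hq : Valid G q) :
    ((root (ad G) X Y q).leaves n : ℝ) ≤ 1.6107 ^ c := by
  have h1 := card_root_act hc (X := X) (Y := Y) hq
  calc ((root (ad G) X Y q).leaves n : ℝ) ≤ 1.269 ^ (root (ad G) X Y q).act.card :=
        TwoSpin.leaves_le (root_good G X Y q) (root_plain G X Y q)
    _ ≤ 1.269 ^ (2 * c) := pow_le_pow_right₀ (by norm_num) (by omega)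
    _ = (1.269 ^ 2) ^ c := by rw [pow_mul]
    -- 1.269² = 1.610361.
    _ ≤ _ := pow_le_pow_left₀ (by norm_num) (by norm_num) c

/-! ### The generating function and its digits. -/

/-- Independence in the conflict graph. -/
def Indep (G : SimpleGraph (Fin n)) (q : Quad n) (I : Finset (Fin n)) : Prop :=
  ∀ x ∈ I, ∀ y ∈ I, x ≠ y → ¬ (G.Adj x y ↔ (G.Adj q.1 x ↔ G.Adj q.1 y))

open Classical in
/-- The exponent of the monomial of an independent set. -/
noncomputable def expo (G : SimpleGraph (Fin n)) (p : Quad n × Finset (Fin n)) : ℕ :=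
  (p.2.filter fun x => ¬ G.Adj p.1.1 x).card + (n + 1) * (p.2.filter fun x => G.Adj p.1.1 x).card

open Classical in
-- A conflict inside I contributes a factor 0. Otherwise only vertex weights remain, and adjacency
-- to the first vertex of the quadruple tells the sides apart.
theorem root_wt {w : ℕ} {q : Quad n} {I : Finset (Fin n)}
    (hI : I ⊆ (root (ad G) (2 ^ w) (2 ^ (w * (n + 1))) q).act) :
    (root (ad G) (2 ^ w) (2 ^ (w * (n + 1))) q).wt
      (root (ad G) (2 ^ w) (2 ^ (w * (n + 1))) q).act (TwoSpin.ind I) =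
      if Indep G q I then 2 ^ (w * expo G (q, I)) else 0 := by
  set S := root (ad G) (2 ^ w) (2 ^ (w * (n + 1))) q with hS
  have hf : ∏ x ∈ S.act, S.f (TwoSpin.ind I x) x = 2 ^ (w * expo G (q, I)) := by
    have h1 : ∏ x ∈ S.act, S.f (TwoSpin.ind I x) x = ∏ x ∈ I, S.f 1 x := by
      rw [← prod_sdiff hI]
      have h2 : ∏ x ∈ S.act \ I, S.f (TwoSpin.ind I x) x = 1 :=
        prod_eq_one fun x hx => by simp [TwoSpin.ind, (mem_sdiff.1 hx).2, hS, root]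
      rw [h2, one_mul]
      exact prod_congr rfl fun x hx => by simp [TwoSpin.ind, hx]
    have h3 : ∀ x, S.f 1 x = if G.Adj q.1 x then 2 ^ (w * (n + 1)) else 2 ^ w := fun x => by
      simp only [hS, root, ad]
      by_cases h : G.Adj q.1 x <;> simp [h]
    rw [h1]
    simp only [h3]
    rw [prod_ite, prod_const, prod_const, ← pow_mul, ← pow_mul, ← pow_add]
    congr 1
    simp only [expo]
    ring
  unfold TwoSpin.wt
  rw [hf]
  split_ifs with hind
  · rw [pairProd_eq_one, mul_one]
    intro x _ y _ hxy
    by_cases hx : x ∈ I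
    · by_cases hy : y ∈ I
      · have := hind x hx y hy hxy
        rw [← root_adj_ne_zero (X := 2 ^ w) (Y := 2 ^ (w * (n + 1))), not_not] at this
        simp only [TwoSpin.ind, hx, hy, if_true]
        rw [hS, root_W_one, this]
      · simp [TwoSpin.ind, hy, hS, root]
    · simp [TwoSpin.ind, hx, hS, root]
  · unfold Indep at hind
    push Not at hind
    obtain ⟨x, hx, y, hy, hxy, hc⟩ := hind
    have hWG : ∀ x y, x ∈ I → y ∈ I → (G.Adj x y ↔ (G.Adj q.1 x ↔ G.Adj q.1 y)) →
        S.W (TwoSpin.ind I x) (TwoSpin.ind I y) x y = 0 := by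
      intro x y hx hy hc
      rw [← root_adj_ne_zero (X := 2 ^ w) (Y := 2 ^ (w * (n + 1)))] at hc
      simp only [TwoSpin.ind, hx, hy, if_true]
      rw [hS, root_W_one]
      omega
    have hz : pairProd S.act (fun x y => S.W (TwoSpin.ind I x) (TwoSpin.ind I y) x y) = 0 := by
      rcases lt_or_gt_of_ne hxy with hlt | hlt
      · refine prod_eq_zero (hI hx) (prod_eq_zero (hI hy) ?_)
        rw [if_pos hlt]
        exact hWG x y hx hy hc
      · refine prod_eq_zero (hI hy) (prod_eq_zero (hI hx) ?_)
        rw [if_pos hlt]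
        refine hWG y x hy hx ?_
        rw [G.adj_comm, hc]
        exact Iff.comm
    rw [hz, mul_zero]

open Classical in
/-- The monomials of the sum of all partition functions. -/
noncomputable def monomials (G : SimpleGraph (Fin n)) (X Y : ℕ) :
    Finset (Quad n × Finset (Fin n)) :=
  univ.filter fun p => Valid G p.1 ∧ p.2 ⊆ (root (ad G) X Y p.1).act ∧ Indep G p.1 p.2

open Classical in
theorem sum_Z (w : ℕ) : ∑ q ∈ univ.filter (Valid G), (root (ad G) (2 ^ w) (2 ^ (w * (n + 1))) q).Z =
    ∑ p ∈ monomials G (2 ^ w) (2 ^ (w * (n + 1))), 2 ^ (w * expo G p) := by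
  have h1 : ∀ q : Quad n, (root (ad G) (2 ^ w) (2 ^ (w * (n + 1))) q).Z =
      ∑ I : Finset (Fin n), if I ⊆ (root (ad G) (2 ^ w) (2 ^ (w * (n + 1))) q).act ∧ Indep G q I
        then 2 ^ (w * expo G (q, I)) else 0 := by
    intro q
    rw [TwoSpin.Z, show (root (ad G) (2 ^ w) (2 ^ (w * (n + 1))) q).val = 1 from rfl, one_mul]
    simp only [ite_and]
    rw [← sum_filter]
    refine sum_congr ?_ fun I hI => root_wt (by simpa using hI)
    ext I
    simp
  simp only [h1]
  rw [monomials, sum_filter, sum_filter]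
  refine Eq.trans ?_ (Fintype.sum_prod_type _).symm
  refine sum_congr rfl fun q _ => ?_
  split_ifs with hq
  · exact sum_congr rfl fun I _ => by simp [hq]
  · simp [hq]

/-- There are n⁴ ≤ 2^(4n) quadruples and 2^n sets; this is the source of the block width 5n + 1. -/
theorem card_monomials_lt (G : SimpleGraph (Fin n)) (X Y : ℕ) :
    (monomials G X Y).card < 2 ^ (5 * n + 1) := by
  have h1 := card_le_univ (monomials G X Y)
  simp only [Fintype.card_prod, Fintype.card_fin, Fintype.card_finset] at h1
  have h2 : n < 2 ^ n := Nat.lt_two_pow_self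
  refine lt_of_le_of_lt h1 ?_
  calc n * (n * (n * n)) * 2 ^ n ≤ 2 ^ n * (2 ^ n * (2 ^ n * 2 ^ n)) * 2 ^ n := by gcongr
    _ = 2 ^ (5 * n) := by ring
    _ < _ := Nat.pow_lt_pow_right (by norm_num) (by omega)

theorem expo_lt (G : SimpleGraph (Fin n)) (p : Quad n × Finset (Fin n)) :
    expo G p < (n + 1) * (n + 1) := by
  classical
  have h1 := card_le_univ (p.2.filter fun x => ¬ G.Adj p.1.1 x)
  have h2 := card_le_univ (p.2.filter fun x => G.Adj p.1.1 x)
  rw [Fintype.card_fin] at h1 h2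
  unfold expo
  nlinarith

/-- Reading off a block of binary digits. -/
theorem le_mod_iff {ι : Type*} {P : Finset ι} {e : ι → ℕ} {w : ℕ} (hP : P.card < 2 ^ w) (k : ℕ) :
    2 ^ (w * k) ≤ (∑ p ∈ P, 2 ^ (w * e p)) % 2 ^ (w * (k + 1)) ↔ ∃ p ∈ P, e p = k := by
  classical
  have hhigh : 2 ^ (w * (k + 1)) ∣ ∑ p ∈ P.filter (fun p => ¬ e p ≤ k), 2 ^ (w * e p) := by
    refine dvd_sum fun p hp => pow_dvd_pow 2 (Nat.mul_le_mul_left w ?_)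
    have := (mem_filter.1 hp).2
    omega
  have hlow : ∑ p ∈ P.filter (fun p => e p ≤ k), 2 ^ (w * e p) < 2 ^ (w * (k + 1)) := by
    calc _ ≤ ∑ p ∈ P.filter (fun p => e p ≤ k), 2 ^ (w * k) :=
          sum_le_sum fun p hp => Nat.pow_le_pow_right (by norm_num)
            (Nat.mul_le_mul_left w (mem_filter.1 hp).2)
      _ = (P.filter (fun p => e p ≤ k)).card * 2 ^ (w * k) := by rw [sum_const, smul_eq_mul]
      _ < 2 ^ w * 2 ^ (w * k) := by
        refine Nat.mul_lt_mul_of_pos_right ?_ (by positivity)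
        exact lt_of_le_of_lt (card_le_card (filter_subset _ _)) hP
      _ = _ := by rw [← pow_add]; ring_nf
  have hmod : (∑ p ∈ P, 2 ^ (w * e p)) % 2 ^ (w * (k + 1)) =
      ∑ p ∈ P.filter (fun p => e p ≤ k), 2 ^ (w * e p) := by
    rw [← sum_filter_add_sum_filter_not P (fun p => e p ≤ k), Nat.add_mod,
      Nat.mod_eq_zero_of_dvd hhigh, Nat.add_zero, Nat.mod_mod, Nat.mod_eq_of_lt hlow]
  rw [hmod]
  constructor
  · intro h
    by_contra hne
    push Not at hne
    refine absurd h (not_le.2 ?_)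
    -- Without exponent k, the low part consists of fewer than 2^w terms of size at most 2^(w(k-1)),
    -- so it stays below 2^(wk). For k = 0 it is empty.
    rcases Nat.eq_zero_or_pos k with rfl | hk
    · have : P.filter (fun p => e p ≤ 0) = ∅ := filter_eq_empty_iff.2 fun p hp h0 =>
        hne p hp (by omega)
      rw [this]
      simp
    · calc _ ≤ ∑ p ∈ P.filter (fun p => e p ≤ k), 2 ^ (w * (k - 1)) := by
            refine sum_le_sum fun p hp => Nat.pow_le_pow_right (by norm_num)
              (Nat.mul_le_mul_left w ?_)
            rw [mem_filter] at hp
            have := hne p hp.1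
            omega
        _ = (P.filter (fun p => e p ≤ k)).card * 2 ^ (w * (k - 1)) := by
            rw [sum_const, smul_eq_mul]
        _ < 2 ^ w * 2 ^ (w * (k - 1)) := by
          refine Nat.mul_lt_mul_of_pos_right ?_ (by positivity)
          exact lt_of_le_of_lt (card_le_card (filter_subset _ _)) hP
        _ = _ := by
          rw [← pow_add]
          congr 1
          obtain ⟨j, rfl⟩ : ∃ j, k = j + 1 := ⟨k - 1, by omega⟩
          simp only [Nat.add_sub_cancel]; ring
  · rintro ⟨p, hp, rfl⟩
    exact single_le_sum (f := fun i => 2 ^ (w * e i)) (fun _ _ => Nat.zero_le _)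
      (mem_filter.2 ⟨hp, le_rfl⟩)

/-- An independent set is split into nonneighbours and neighbours of the first guessed vertex, which
become the two sides. Conversely, two vertices on each side of a biclique give the quadruple, and
these four vertices are themselves among the candidates. -/
theorem exists_monomial_iff {k₁ k₂ : ℕ} (X Y : ℕ) (h1 : 2 ≤ k₁) (h2 : 2 ≤ k₂) (hk₁ : k₁ ≤ n) :
    (∃ p ∈ monomials G X Y, expo G p = k₁ + (n + 1) * k₂) ↔ G.HasInducedBiclique k₁ k₂ := by
  classical
  constructor
  · rintro ⟨⟨q, I⟩, hp, he⟩
    rw [monomials, mem_filter] at hp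
    obtain ⟨-, -, -, hind⟩ := hp
    have hb1 := card_le_univ (I.filter fun x => ¬ G.Adj q.1 x)
    rw [Fintype.card_fin] at hb1
    simp only [expo] at he
    -- The count of nonneighbours and k₁ are both below n + 1, so the exponent determines both
    -- counts.
    have hT : (I.filter fun x => G.Adj q.1 x).card = k₂ := by
      rcases lt_trichotomy (I.filter fun x => G.Adj q.1 x).card k₂ with h | h | h
      · nlinarith
      · exact h
      · nlinarith
    have hS : (I.filter fun x => ¬ G.Adj q.1 x).card = k₁ := by rw [hT] at he; omega
    refine ⟨_, _, (disjoint_filter_filter_not I I (fun x => G.Adj q.1 x)).symm, hS, hT, ?_, ?_, ?_⟩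
    · intro s hs s' hs' hadj
      rw [mem_filter] at hs hs'
      exact hind s hs.1 s' hs'.1 hadj.ne (by simp [hadj, hs.2, hs'.2])
    · intro s hs s' hs' hadj
      rw [mem_filter] at hs hs'
      exact hind s hs.1 s' hs'.1 hadj.ne (by simp [hadj, hs.2, hs'.2])
    · intro s hs t ht
      rw [mem_filter] at hs ht
      by_contra hadj
      refine hind s hs.1 t ht.1 (fun h => hs.2 (h ▸ ht.2)) (by simp [hadj, hs.2, ht.2])
  · rintro ⟨S, T, hdis, hS, hT, hSS, hTT, hST⟩
    obtain ⟨a, ha, b, hb, hab⟩ := one_lt_card.1 (by omega : 1 < S.card)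
    obtain ⟨c, hc, d, hd, hcd⟩ := one_lt_card.1 (by omega : 1 < T.card)
    refine ⟨((a, b, c, d), S ∪ T), ?_, ?_⟩
    · rw [monomials, mem_filter]
      refine ⟨mem_univ _, ⟨hab, hSS a ha b hb, hcd, hTT c hc d hd⟩, fun x hx => ?_, ?_⟩
      · rw [root_act]
        rcases mem_union.1 hx with hx | hx
        · exact Or.inr ⟨(hST x hx c hc).symm, (hST x hx d hd).symm, hSS a ha x hx, hSS b hb x hx⟩
        · exact Or.inl ⟨hST a ha x hx, hST b hb x hx, hTT c hc x hx, hTT d hd x hx⟩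
      · intro x hx y hy _
        dsimp only at hx hy ⊢
        rcases mem_union.1 hx with hx | hx <;> rcases mem_union.1 hy with hy | hy
        · simp [hSS x hx y hy, hSS a ha x hx, hSS a ha y hy]
        · simp [hST x hx y hy, hSS a ha x hx, hST a ha y hy]
        · simp [(hST y hy x hx).symm, hST a ha x hx, hSS a ha y hy]
        · simp [hTT x hx y hy, hST a ha x hx, hST a ha y hy]
    · have e1 : (S ∪ T).filter (fun x => ¬ G.Adj a x) = S := by
        ext x
        rw [mem_filter, mem_union]
        constructor
        · rintro ⟨hx | hx, h⟩
          · exact hx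
          · exact absurd (hST a ha x hx) h
        · exact fun hx => ⟨Or.inl hx, hSS a ha x hx⟩
      have e2 : (S ∪ T).filter (fun x => G.Adj a x) = T := by
        ext x
        rw [mem_filter, mem_union]
        constructor
        · rintro ⟨hx | hx, h⟩
          · exact absurd h (hSS a ha x hx)
          · exact hx
        · exact fun hx => ⟨Or.inr hx, hST a ha x hx⟩
      simp only [expo, e1, e2, hS, hT]

open Classical in
/-- The total of all partition functions. -/
noncomputable def grand (G : SimpleGraph (Fin n)) : ℕ :=
  ∑ q ∈ univ.filter (Valid G),
    (root (ad G) (2 ^ (5 * n + 1)) (2 ^ ((5 * n + 1) * (n + 1))) q).Z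

theorem grand_lt (G : SimpleGraph (Fin n)) :
    grand G < 2 ^ ((5 * n + 1) * ((n + 1) * (n + 1))) := by
  unfold grand
  rw [sum_Z]
  calc _ ≤ ∑ p ∈ monomials G (2 ^ (5 * n + 1)) (2 ^ ((5 * n + 1) * (n + 1))),
        2 ^ ((5 * n + 1) * ((n + 1) * (n + 1) - 1)) := by
        refine sum_le_sum fun p _ => Nat.pow_le_pow_right (by norm_num) (Nat.mul_le_mul_left _ ?_)
        have := expo_lt G p
        omega
    _ < 2 ^ (5 * n + 1) * 2 ^ ((5 * n + 1) * ((n + 1) * (n + 1) - 1)) := by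
        rw [sum_const, smul_eq_mul]
        exact Nat.mul_lt_mul_of_pos_right (card_monomials_lt G _ _) (by positivity)
    _ = _ := by
      rw [← pow_add]
      congr 1
      obtain ⟨j, hj⟩ : ∃ j, (n + 1) * (n + 1) = j + 1 := ⟨(n + 1) * (n + 1) - 1, by
        have : 0 < (n + 1) * (n + 1) := by positivity
        omega⟩
      rw [hj, Nat.add_sub_cancel]; ring

theorem grand_iff {k₁ k₂ : ℕ} (h1 : 2 ≤ k₁) (h2 : 2 ≤ k₂) (hk₁ : k₁ ≤ n) :
    2 ^ ((5 * n + 1) * (k₁ + (n + 1) * k₂)) ≤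
      grand G % 2 ^ ((5 * n + 1) * (k₁ + (n + 1) * k₂ + 1)) ↔ G.HasInducedBiclique k₁ k₂ := by
  rw [← exists_monomial_iff _ _ h1 h2 hk₁, ← le_mod_iff (card_monomials_lt G _ _), grand, sum_Z]

theorem root_pot_le (G : SimpleGraph (Fin n)) {X Y : ℕ} (hX : 0 < X) (hXY : X ≤ Y) (q : Quad n) :
    (root (ad G) X Y q).pot ≤ Y ^ n := by
  have h1 : ∀ x, (root (ad G) X Y q).mf x ≤ Y := fun x => by
    refine TwoSpin.mf_le (by omega) fun s => ?_
    simp only [root]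
    split_ifs
    · omega
    · unfold ad; split_ifs
      · simp
      · simpa using hXY
  have h2 : ∀ x y, (root (ad G) X Y q).mW x y ≤ 1 := fun x y => by
    refine TwoSpin.mW_le le_rfl fun s t => ?_
    simp only [root]
    split_ifs <;> omega
  unfold TwoSpin.pot
  calc _ ≤ 1 * Y ^ (root (ad G) X Y q).act.card * 1 := by
        gcongr
        · simp [root]
        · exact prod_le_pow_card _ _ _ fun x _ => h1 x
        · exact (pairProd_le fun x _ y _ _ => h2 x y).trans (pairProd_eq_one fun _ _ _ _ _ => rfl).le
    _ ≤ Y ^ n := by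
      rw [one_mul, mul_one]
      refine Nat.pow_le_pow_right (by omega) ?_
      simpa using card_le_univ (root (ad G) X Y q).act

end InducedBiclique

namespace InducedBiclique

open Finset RAM

/-! ### Enumerating neighbours and selecting a variable -/

/-- An injective pairing function. -/
def pr (i j : ℕ) : ℕ := (i + j) * (i + j) + j

theorem pr_inj {i j i' j' : ℕ} : pr i j = pr i' j' ↔ i = i' ∧ j = j' := by
  constructor
  · intro h
    unfold pr at h
    have : i + j = i' + j' := by
      rcases lt_trichotomy (i + j) (i' + j') with hlt | heq | hlt
      · nlinarith
      · exact heq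
      · nlinarith
    rw [this] at h
    omega
  · rintro ⟨rfl, rfl⟩; rfl

/-- The expression for `pr`. -/
def prT (e f : Term) : Term := .add (.mul (.add e f) (.add e f)) f

@[simp] theorem prT_val (s : State) (e f : Term) : (prT e f).val s = pr (e.val s) (f.val s) := rfl

variable {n M b : ℕ}

/-- The two-spin system in memory. -/
def sysOf (n : ℕ) (s : State) : TwoSpin n where
  U x := s.arr 2 x
  adj x y := s.arr 3 (pr x y)
  f t x := s.arr (4 + t) x
  W t t' x y := s.arr (6 + 2 * t + t') (pr x y)
  val := s.reg 12

theorem ok_assign' {p : State → Prop} {s : State} {x v : ℕ} {e : Term} (he : e.val s = v)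
    (hv : v < 2 ^ b) (h : p (s.setReg x v)) : Ok M b (.assign x e) s p := by
  subst he; exact ok_assign hv h

theorem ok_write' {p : State → Prop} {s : State} {a j v : ℕ} {i e : Term} (hi : i.val s = j)
    (he : e.val s = v) (hv : v < 2 ^ b) (h : p (s.setArr a j v)) : Ok M b (.write a i e) s p := by
  subst he hi; exact ok_write hv h

/-- Put the number of neighbours of the variable in register 14 into register 16, and the last
two neighbours into registers 17 and 18. -/
def nbrP : Program :=
  .seq (.assign 16 (.const 0)) <| forP 15 (.reg 0) <|
    .ite (.mul (.read 2 (.reg 15)) (.read 3 (prT (.reg 14) (.reg 15))))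
      (.seq (.assign 18 (.reg 17)) <| .seq (.assign 17 (.reg 15)) <|
        .assign 16 (.add (.reg 16) (.const 1)))
      .skip

/-- `d` is the degree of `v`, and `x` and `y` are neighbours. -/
structure Nbs (S : TwoSpin n) (v : Fin n) (d x y : ℕ) : Prop where
  card : d = (S.nb v).card
  one : 1 ≤ d → ∃ a ∈ S.nb v, x = a
  two : 2 ≤ d → ∃ a ∈ S.nb v, ∃ c ∈ S.nb v, a ≠ c ∧ x = a ∧ y = c

theorem filter_lt_succ {A : Finset (Fin n)} {i : ℕ} (hi : i < n) :
    (A.filter fun x : Fin n => x.val < i + 1) =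
      if ⟨i, hi⟩ ∈ A then insert ⟨i, hi⟩ (A.filter fun x : Fin n => x.val < i)
      else A.filter fun x : Fin n => x.val < i := by
  ext x
  split_ifs with h
  · simp only [mem_filter, mem_insert, Fin.ext_iff]
    constructor
    · rintro ⟨h1, h2⟩
      by_cases hx : x.val = i
      · exact Or.inl hx
      · exact Or.inr ⟨h1, by omega⟩
    · rintro (h1 | ⟨h1, h2⟩)
      · exact ⟨by rwa [show x = ⟨i, hi⟩ from Fin.ext h1], by omega⟩
      · exact ⟨h1, by omega⟩
  · simp only [mem_filter]
    refine and_congr_right fun h1 => ⟨fun h2 => ?_, fun h2 => by omega⟩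
    rcases Nat.lt_or_ge x.val i with h3 | h3
    · exact h3
    · exact absurd (show x = ⟨i, hi⟩ from Fin.ext (by simp only; omega)) fun hx => h (hx ▸ h1)

theorem ok_nbr {s : State} {v : Fin n} (h0 : s.reg 0 = n) (hv : s.reg 14 = v) (hM : n ≤ M)
    (hb : n + 4 < 2 ^ b) {Q : State → Prop}
    (hQ : ∀ s', Frame nbrP s s' → Bdd b s' →
      Nbs (sysOf n s) v (s'.reg 16) (s'.reg 17) (s'.reg 18) → Q s') : Ok M b nbrP s Q := by
  refine Ok.mono (Q := fun s' => Nbs (sysOf n s) v (s'.reg 16) (s'.reg 17) (s'.reg 18)) ?_ hQ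
  set N := (sysOf n s).nb v with hN
  refine ok_seq (ok_assign' (v := 0) rfl (by positivity) ?_)
  -- Register 17 holds the latest neighbour found and 18 the one before. Keeping the stored one
  -- below i makes it differ from the next.
  refine ok_for n (fun i s' => s'.reg 16 = (N.filter fun x : Fin n => x.val < i).card ∧
      (1 ≤ s'.reg 16 → ∃ a ∈ N, a.val < i ∧ s'.reg 17 = a) ∧
      (2 ≤ s'.reg 16 → ∃ a ∈ N, ∃ c ∈ N, a.val < i ∧ a ≠ c ∧ s'.reg 17 = a ∧ s'.reg 18 = c))
    hM (by omega) rfl (fun s' hf => by simpa [Term.val, h0] using hf.reg 0 rfl) (by simp) ?_ ?_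
  · rintro i hi s' hf hb' hri ⟨h1, h2, h3⟩
    have hx : s'.arr 2 i * s'.arr 3 (pr v i) ≠ 0 ↔ (⟨i, hi⟩ : Fin n) ∈ N := by
      rw [hN, TwoSpin.mem_nb, hf.arr 2 rfl, hf.arr 3 rfl, mul_ne_zero_iff]
      rfl
    have h14 : s'.reg 14 = v := by simpa [hv] using hf.reg 14 rfl
    have hcard : (N.filter fun x : Fin n => x.val < i).card ≤ n := by
      simpa using card_le_univ (N.filter fun x : Fin n => x.val < i)
    refine ok_ite (fun hne => ?_) fun he => ?_
    · simp only [Term.val, prT_val, hri, h14] at hne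
      rw [hx] at hne
      refine ok_seq (ok_assign' (v := s'.reg 17) rfl (hb'.reg _) ?_)
      refine ok_seq (ok_assign' (v := i) (by simpa [Term.val] using hri) (by omega) ?_)
      refine ok_assign' (v := s'.reg 16 + 1) (by simp [Term.val]) (by omega) ?_
      simp only [State.setReg_reg, Nat.reduceEqDiff, reduceIte]
      rw [filter_lt_succ hi, if_pos hne, card_insert_of_notMem (by simp), h1]
      refine ⟨rfl, fun _ => ⟨⟨i, hi⟩, hne, by simp, rfl⟩, fun hc => ?_⟩
      obtain ⟨a, ha, hai, h17⟩ := h2 (by omega)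
      exact ⟨⟨i, hi⟩, hne, a, ha, by simp, fun h => by simp [← h] at hai, rfl, h17⟩
    · simp only [Term.val, prT_val, hri, h14] at he
      have hne : (⟨i, hi⟩ : Fin n) ∉ N := fun h => hx.2 h he
      refine ok_skip ?_
      simp only [State.setReg_reg, Nat.reduceEqDiff, reduceIte]
      rw [filter_lt_succ hi, if_neg hne]
      refine ⟨h1, fun hc => ?_, fun hc => ?_⟩
      · obtain ⟨a, ha, hai, h17⟩ := h2 hc
        exact ⟨a, ha, by omega, h17⟩
      · obtain ⟨a, ha, c, hc, hai, h4⟩ := h3 hc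
        exact ⟨a, ha, c, hc, by omega, h4⟩
  · rintro s' - - - ⟨h1, h2, h3⟩
    refine ⟨?_, fun hc => ?_, fun hc => ?_⟩
    · rw [h1, filter_true_of_mem fun x _ => x.isLt]
    · obtain ⟨a, ha, -, h17⟩ := h2 hc
      exact ⟨a, ha, h17⟩
    · obtain ⟨a, ha, c, hc, -, h4⟩ := h3 hc
      exact ⟨a, ha, c, hc, h4⟩

/-- Put the priority of the variable in register 14, of degree in register 16, into
register 19. -/
def keyP : Program :=
  .ite (.read 5 (.reg 14))
    (.ite (.sub (.reg 16) (.const 1))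
      (.ite (.sub (.reg 16) (.const 3)) (.assign 19 (.reg 16))
        (.ite (.sub (.reg 16) (.const 2)) (.assign 19 (.const 1)) (.assign 19 (.const 2))))
      (.assign 19 (.add (.reg 0) (.const 2))))
    (.assign 19 (.add (.reg 0) (.const 3)))

theorem ok_key {s : State} {v : Fin n} (h0 : s.reg 0 = n) (hv : s.reg 14 = v)
    (hd : s.reg 16 = ((sysOf n s).nb v).card) (hb : n + 4 < 2 ^ b) {Q : State → Prop}
    (hQ : Q (s.setReg 19 ((sysOf n s).key v))) : Ok M b keyP s Q := by
  have hle := (sysOf n s).key_le v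
  have hf : (sysOf n s).f 1 v = s.arr 5 v := rfl
  unfold TwoSpin.key at hQ hle
  rw [hf, ← hd] at hQ hle
  refine ok_ite (fun h => ?_) fun h => ?_
  · simp only [Term.val, hv] at h
    rw [if_neg h] at hQ hle
    refine ok_ite (fun h1 => ?_) fun h1 => ?_
    · simp only [Term.val] at h1
      rw [if_neg (by omega)] at hQ hle
      refine ok_ite (fun h2 => ?_) fun h2 => ?_
      · simp only [Term.val] at h2
        rw [if_pos (by omega)] at hQ hle
        exact ok_assign' (v := s.reg 16) rfl (by omega) hQ
      · simp only [Term.val] at h2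
        rw [if_neg (by omega)] at hQ hle
        refine ok_ite (fun h3 => ?_) fun h3 => ?_
        · simp only [Term.val] at h3
          rw [if_neg (by omega)] at hQ hle
          exact ok_assign' (v := 1) rfl (by omega) hQ
        · simp only [Term.val] at h3
          rw [if_pos (by omega)] at hQ hle
          exact ok_assign' (v := 2) rfl (by omega) hQ
    · simp only [Term.val] at h1
      rw [if_pos (by omega)] at hQ hle
      exact ok_assign' (by simp [Term.val, h0]) (by omega) hQ
  · simp only [Term.val, hv] at h
    rw [if_pos h] at hQ hle
    exact ok_assign' (by simp [Term.val, h0]) (by omega) hQ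

/-- Select a variable: register 20 is nonzero if there are active variables, register 21 is the
selected one, and registers 22, 23, 24 are its degree and neighbours. -/
def selP : Program :=
  .seq (.assign 20 (.const 0)) <| forP 14 (.reg 0) <|
    .ite (.read 2 (.reg 14))
      (.seq nbrP <| .seq keyP <| .ite (.sub (.reg 19) (.reg 20))
        (.seq (.assign 20 (.reg 19)) <| .seq (.assign 21 (.reg 14)) <|
          .seq (.assign 22 (.reg 16)) <| .seq (.assign 23 (.reg 17)) <| .assign 24 (.reg 18))
        .skip)
      .skip

/-- `v` is the first variable of highest priority among the active ones below `i`. -/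
structure SelBelow (S : TwoSpin n) (i : ℕ) (v : Fin n) (s : State) : Prop where
  act : v ∈ S.act
  lt : v.val < i
  key : s.reg 20 = S.key v
  var : s.reg 21 = v
  nbs : Nbs S v (s.reg 22) (s.reg 23) (s.reg 24)
  max : ∀ x ∈ S.act, x.val < i → S.key x ≤ S.key v ∧ (x < v → S.key x < S.key v)

/-- The system occupies arrays 2 to 9 and register 12. The side conditions on concrete programs are
decidable. -/
theorem sysOf_frame {p : Program} {s s' : State} (h : Frame p s s')
    (ha : ∀ a ∈ range 10, a = 0 ∨ a = 1 ∨ p.wa a = false) (hr : p.wr 12 = false) :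
    sysOf n s' = sysOf n s := by
  have h' : ∀ a, 2 ≤ a → a < 10 → s'.arr a = s.arr a := fun a h2 h10 => by
    rcases ha a (mem_range.2 h10) with h3 | h3 | h3
    · omega
    · omega
    · exact h.arr a h3
  unfold sysOf
  rw [h' 2 (by omega) (by omega), h' 3 (by omega) (by omega), h.reg 12 hr]
  congr 1
  · funext t x
    rw [h' (4 + t) (by omega) (by omega)]
  · funext t t' x y
    rw [h' (6 + 2 * t + t') (by omega) (by omega)]

/-- A candidate replaces the current one only if its priority is strictly larger, so the first
maximum wins. Priorities are positive, so register 20 can use 0 for the absence of a candidate. -/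
theorem ok_sel {s : State} (h0 : s.reg 0 = n) (hM : n ≤ M) (hb : n + 4 < 2 ^ b)
    {Q : State → Prop} (hQ : ∀ s', Frame selP s s' → Bdd b s' →
      ((sysOf n s).sel = none → s'.reg 20 = 0) →
      (∀ v, (sysOf n s).sel = some v → s'.reg 20 ≠ 0 ∧ s'.reg 21 = v ∧
        Nbs (sysOf n s) v (s'.reg 22) (s'.reg 23) (s'.reg 24)) → Q s') : Ok M b selP s Q := by
  set S := sysOf n s with hS
  refine Ok.mono (Q := fun s' => (S.sel = none → s'.reg 20 = 0) ∧
      (∀ v, S.sel = some v → s'.reg 20 ≠ 0 ∧ s'.reg 21 = v ∧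
        Nbs S v (s'.reg 22) (s'.reg 23) (s'.reg 24))) ?_
    fun s' hf hb' h => hQ s' hf hb' h.1 h.2
  refine ok_seq (ok_assign' (v := 0) rfl (by positivity) ?_)
  refine ok_for n (fun i s' => (s'.reg 20 = 0 ∧ ∀ x ∈ S.act, ¬ x.val < i) ∨
      ∃ v, SelBelow S i v s') hM (by omega) rfl
    (fun s' hf => by simpa [Term.val, h0] using hf.reg 0 rfl) (by simp) ?_ ?_
  · intro i hi s' hf hb' hri hI
    have hS' : sysOf n s' = S := by
      rw [sysOf_frame hf (by decide) rfl]; rfl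
    have h0' : s'.reg 0 = n := by simpa [h0] using hf.reg 0 rfl
    have hx : s'.arr 2 i ≠ 0 ↔ (⟨i, hi⟩ : Fin n) ∈ S.act := by
      rw [TwoSpin.mem_act, ← hS']; rfl
    have hlt : ∀ x : Fin n, x.val < i + 1 → x.val < i ∨ x = ⟨i, hi⟩ := fun x hx => by
      rcases Nat.lt_or_ge x.val i with h | h
      · exact Or.inl h
      · exact Or.inr (Fin.ext (by simp only; omega))
    refine ok_ite (fun hne => ?_) fun he => ?_
    · simp only [Term.val, hri] at hne
      have hact := hx.1 hne
      refine ok_seq (ok_nbr h0' (v := ⟨i, hi⟩) hri hM hb ?_)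
      intro s₁ hf₁ hb₁ hn₁
      rw [hS'] at hn₁
      have hS₁ : sysOf n s₁ = S := by rw [sysOf_frame hf₁ (by decide) rfl, hS']
      have h14 : s₁.reg 14 = i := by rw [hf₁.reg 14 rfl, hri]
      have h20 := hf₁.reg 20 rfl
      refine ok_seq (ok_key (v := ⟨i, hi⟩) (by rw [hf₁.reg 0 rfl, h0']) h14 ?_ hb ?_)
      · rw [hn₁.card, hS₁]
      rw [hS₁]
      have hpos := S.key_pos ⟨i, hi⟩
      have hkle := S.key_le ⟨i, hi⟩
      refine ok_ite (fun hgt => ?_) fun hle => ?_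
      · simp only [Term.val, State.setReg_reg] at hgt
        norm_num at hgt
        refine ok_seq (ok_assign' (v := S.key ⟨i, hi⟩) (by simp [Term.val]) (by omega) ?_)
        refine ok_seq (ok_assign' (v := i) (by simp [Term.val, h14]) (by omega) ?_)
        refine ok_seq (ok_assign' (v := s₁.reg 16) (by simp [Term.val]) (hb₁.reg _) ?_)
        refine ok_seq (ok_assign' (v := s₁.reg 17) (by simp [Term.val]) (hb₁.reg _) ?_)
        refine ok_assign' (v := s₁.reg 18) (by simp [Term.val]) (hb₁.reg _) ?_
        refine Or.inr ⟨⟨i, hi⟩, hact, by simp, by simp, by simp, by simpa using hn₁, ?_⟩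
        intro x hx' hxi
        rcases hlt x hxi with h | rfl
        · rcases hI with ⟨-, h2⟩ | ⟨v, hv⟩
          · exact absurd h (h2 x hx')
          · have h3 := (hv.max x hx' h).1
            have h4 := hv.key
            constructor
            · omega
            · intro; omega
        · exact ⟨le_rfl, fun h => absurd h (lt_irrefl _)⟩
      · simp only [Term.val, State.setReg_reg] at hle
        norm_num at hle
        refine ok_skip ?_
        rcases hI with ⟨h1, -⟩ | ⟨v, hv⟩
        · omega
        · refine Or.inr ⟨v, hv.act, by have := hv.lt; omega, ?_, ?_, ?_, ?_⟩
          · simpa [h20] using hv.key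
          · simpa [hf₁.reg 21 rfl] using hv.var
          · simpa [hf₁.reg 22 rfl, hf₁.reg 23 rfl, hf₁.reg 24 rfl] using hv.nbs
          · intro x hx' hxi
            rcases hlt x hxi with h | rfl
            · exact hv.max x hx' h
            · have h4 := hv.key
              refine ⟨by omega, fun h => absurd h ?_⟩
              have := hv.lt
              rw [Fin.lt_def]
              simp only
              omega
    · simp only [Term.val, hri] at he
      have hact : (⟨i, hi⟩ : Fin n) ∉ S.act := fun h => hx.2 h he
      refine ok_skip ?_
      have hlt' : ∀ x ∈ S.act, x.val < i + 1 → x.val < i := fun x hx' hxi => by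
        rcases hlt x hxi with h | rfl
        · exact h
        · exact absurd hx' hact
      rcases hI with ⟨h1, h2⟩ | ⟨v, hv⟩
      · exact Or.inl ⟨by simpa using h1, fun x hx' hxi => h2 x hx' (hlt' x hx' hxi)⟩
      · refine Or.inr ⟨v, hv.act, by have := hv.lt; omega, ?_, ?_, ?_, ?_⟩
        · simpa using hv.key
        · simpa using hv.var
        · simpa using hv.nbs
        · exact fun x hx' hxi => hv.max x hx' (hlt' x hx' hxi)
  · rintro s' - - - (⟨h1, h2⟩ | ⟨v, hv⟩)
    · refine ⟨fun _ => h1, fun v hv => ?_⟩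
      exact absurd v.isLt (h2 v (TwoSpin.sel_eq_some.1 hv).1)
    · have hsel : S.IsSel v := ⟨hv.act, fun x hx => hv.max x hx x.isLt⟩
      rw [← TwoSpin.sel_eq_some] at hsel
      refine ⟨fun h => by simp [hsel] at h, fun w hw => ?_⟩
      rw [hsel] at hw
      cases hw
      have := S.key_pos v
      have := hv.key
      exact ⟨by omega, hv.var, hv.nbs⟩

end InducedBiclique

namespace InducedBiclique

open Finset RAM

variable {n M b : ℕ}

/-! ### One step down the branching tree -/

theorem sysOf_ext {s : State} {S : TwoSpin n} (hU : ∀ x : Fin n, s.arr 2 x = S.U x)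
    (hadj : ∀ x y : Fin n, s.arr 3 (pr x y) = S.adj x y) (h4 : ∀ x : Fin n, s.arr 4 x = S.f 0 x)
    (h5 : ∀ x : Fin n, s.arr 5 x = S.f 1 x) (h6 : ∀ x y : Fin n, s.arr 6 (pr x y) = S.W 0 0 x y)
    (h7 : ∀ x y : Fin n, s.arr 7 (pr x y) = S.W 0 1 x y)
    (h8 : ∀ x y : Fin n, s.arr 8 (pr x y) = S.W 1 0 x y)
    (h9 : ∀ x y : Fin n, s.arr 9 (pr x y) = S.W 1 1 x y) (hv : s.reg 12 = S.val) :
    sysOf n s = S := by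
  obtain ⟨U, adj, f, W, val⟩ := S
  unfold sysOf
  congr 1
  · exact funext hU
  · exact funext fun x => funext (hadj x)
  · funext t x
    revert t
    rw [Fin.forall_fin_two]
    exact ⟨h4 x, h5 x⟩
  · funext t t' x y
    revert t t'
    rw [Fin.forall_fin_two, Fin.forall_fin_two, Fin.forall_fin_two]
    exact ⟨⟨h6 x y, h7 x y⟩, h8 x y, h9 x y⟩

/-- What the memory contains if it represents `S`. -/
structure Rep (S : TwoSpin n) (s : State) : Prop where
  U : ∀ x : Fin n, s.arr 2 x = S.U x
  adj : ∀ x y : Fin n, s.arr 3 (pr x y) = S.adj x y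
  f0 : ∀ x : Fin n, s.arr 4 x = S.f 0 x
  f1 : ∀ x : Fin n, s.arr 5 x = S.f 1 x
  W00 : ∀ x y : Fin n, s.arr 6 (pr x y) = S.W 0 0 x y
  W01 : ∀ x y : Fin n, s.arr 7 (pr x y) = S.W 0 1 x y
  W10 : ∀ x y : Fin n, s.arr 8 (pr x y) = S.W 1 0 x y
  W11 : ∀ x y : Fin n, s.arr 9 (pr x y) = S.W 1 1 x y
  val : s.reg 12 = S.val

theorem rep_iff {S : TwoSpin n} {s : State} : Rep S s ↔ sysOf n s = S := by
  constructor
  · intro h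
    exact sysOf_ext h.U h.adj h.f0 h.f1 h.W00 h.W01 h.W10 h.W11 h.val
  · rintro rfl
    constructor <;> intros <;> rfl

/-! ### Programs that treat one variable. -/

/-- Fix the variable in register 21 to `t`. -/
def condP (t : ℕ) : Program :=
  .seq (.assign 12 (.mul (.reg 12) (.read (4 + t) (.reg 21)))) <| forP 28 (.reg 0) <|
    .ite (.read 2 (.reg 28))
      (.seq (.write 4 (.reg 28) (.mul (.read 4 (.reg 28))
          (.read (6 + 2 * t) (prT (.reg 21) (.reg 28)))))
        (.write 5 (.reg 28) (.mul (.read 5 (.reg 28))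
          (.read (6 + 2 * t + 1) (prT (.reg 21) (.reg 28))))))
      .skip

/-- The variable is already deactivated in memory when this program starts, so the loop passes over
v itself. The potential of the new system bounds every number that is written. -/
theorem ok_cond {S : TwoSpin n} (hS : S.Good) {v : Fin n} (hv : v ∈ S.act) (t : Fin 2) {s : State}
    (hs : Rep { S with U := S.rm v } s) (h0 : s.reg 0 = n) (h21 : s.reg 21 = v) (hM : n ≤ M)
    (hb : n < 2 ^ b) (hpot : S.pot < 2 ^ b) {Q : State → Prop}
    (hQ : ∀ s', Frame (condP t) s s' → Bdd b s' → Rep (S.cond v t) s' → Q s') :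
    Ok M b (condP t) s Q := by
  refine Ok.mono (Q := fun s' => Rep (S.cond v t) s') ?_ hQ
  have hpot' := (TwoSpin.pot_cond_le hS hv t).trans_lt hpot
  have hft : s.arr (4 + t) v = S.f t v := congrFun (congrFun (congrArg TwoSpin.f
    (rep_iff.1 hs)) t) v
  refine ok_seq (ok_assign' (v := (S.cond v t).val) ?_
    ((S.cond v t).val_le_pot.trans_lt hpot') ?_)
  · simp only [Term.val, h21, hs.val, hft]
    rfl
  refine ok_for n (fun i s' =>
    (∀ x : Fin n, s'.arr 4 x = if x.val < i then (S.cond v t).f 0 x else S.f 0 x) ∧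
    (∀ x : Fin n, s'.arr 5 x = if x.val < i then (S.cond v t).f 1 x else S.f 1 x))
    hM hb rfl (fun s' hf => by simpa [Term.val, h0] using hf.reg 0 rfl)
    ⟨by simpa using hs.f0, by simpa using hs.f1⟩ ?_ ?_
  · rintro i hi s' hf hb' hri ⟨h4, h5⟩
    obtain ⟨x, rfl⟩ : ∃ x : Fin n, x.val = i := ⟨⟨i, hi⟩, rfl⟩
    have h21' : s'.reg 21 = v := by simpa [h21] using hf.reg 21 rfl
    have hW : ∀ a : Fin 2, s'.arr (6 + 2 * t + a) (pr v x) = S.W t a v x := fun a => by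
      rw [hf.arr (6 + 2 * t + a)]
      · exact congrFun (congrFun (congrFun (congrFun (congrArg TwoSpin.W
          (rep_iff.1 hs)) t) a) v) x
      · simp only [forP, Program.wa, Bool.or_eq_false_iff, beq_eq_false_iff_ne]
        simp only [true_and, and_true]
        constructor <;> omega
    have hU : s'.arr 2 x = S.rm v x := by rw [hf.arr 2 rfl]; exact hs.U x
    have hlt : ∀ y : Fin n, y ≠ x → (y.val < x.val + 1 ↔ y.val < x.val) := fun y hy => by
      have : y.val ≠ x.val := fun h => hy (Fin.ext h)
      omega
    refine ok_ite (fun hne => ?_) fun he => ?_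
    · simp only [Term.val, hri, hU] at hne
      have hmem : x ∈ (S.cond v t).act := by rw [TwoSpin.mem_act]; exact hne
      have hf' : ∀ a, (S.cond v t).f a x = S.f a x * S.W t a v x := fun a => by
        simp [TwoSpin.cond, hne]
      refine ok_seq (ok_write' (j := x) (v := (S.cond v t).f 0 x) hri ?_
        (((S.cond v t).f_le_pot hmem 0).trans_lt hpot') ?_)
      · simp only [Term.val, prT_val, hri, h21', h4, lt_irrefl, if_false, hf']
        rw [← hW 0]
        rfl
      refine ok_write' (j := x) (v := (S.cond v t).f 1 x) hri ?_
        (((S.cond v t).f_le_pot hmem 1).trans_lt hpot') ?_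
      · simp only [Term.val, prT_val, State.setArr_reg, State.setArr_arr, hri, h21', hf']
        rw [if_neg (by simp), if_neg (by omega), h5, if_neg (lt_irrefl _), ← hW 1]
        rfl
      constructor
      · intro y
        by_cases hy : y = x
        · subst hy; simp
        · simp [h4, hlt y hy, Fin.val_inj, hy]
      · intro y
        by_cases hy : y = x
        · subst hy; simp
        · simp [h5, hlt y hy, Fin.val_inj, hy]
    · simp only [Term.val, hri, hU] at he
      have hf' : ∀ a, (S.cond v t).f a x = S.f a x := fun a => by simp [TwoSpin.cond, he]
      refine ok_skip ⟨fun y => ?_, fun y => ?_⟩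
      · by_cases hy : y = x
        · subst hy; simp [h4, hf']
        · simp only [State.setReg_arr, h4, hlt y hy]
      · by_cases hy : y = x
        · subst hy; simp [h5, hf']
        · simp only [State.setReg_arr, h5, hlt y hy]
  · rintro s' hf - - ⟨h4, h5⟩
    simp only [Fin.is_lt, if_true] at h4 h5
    refine ⟨fun x => ?_, fun x y => ?_, h4, h5, fun x y => ?_, fun x y => ?_, fun x y => ?_,
      fun x y => ?_, ?_⟩
    · rw [hf.arr 2 rfl]; exact hs.U x
    · rw [hf.arr 3 rfl]; exact hs.adj x y
    · rw [hf.arr 6 rfl]; exact hs.W00 x y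
    · rw [hf.arr 7 rfl]; exact hs.W01 x y
    · rw [hf.arr 8 rfl]; exact hs.W10 x y
    · rw [hf.arr 9 rfl]; exact hs.W11 x y
    · rw [hf.reg 12 rfl]; simp

/-- Sum over the values of the variable in register 21, which has no neighbours. -/
def elim₀P : Program :=
  .assign 12 (.mul (.reg 12) (.add (.read 4 (.reg 21)) (.read 5 (.reg 21))))

theorem ok_elim₀ {S : TwoSpin n} {v : Fin n} {s : State}
    (hs : Rep { S with U := S.rm v } s) (h21 : s.reg 21 = v)
    (hpot : (S.elim₀ v).pot < 2 ^ b) {Q : State → Prop}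
    (hQ : ∀ s', Frame elim₀P s s' → Bdd b s' → Rep (S.elim₀ v) s' → Q s') :
    Ok M b elim₀P s Q := by
  refine Ok.mono (Q := fun s' => Rep (S.elim₀ v) s') ?_ hQ
  refine ok_assign' (v := (S.elim₀ v).val) ?_ ((S.elim₀ v).val_le_pot.trans_lt hpot) ?_
  · simp only [Term.val, h21, hs.val, hs.f0, hs.f1]
    rfl
  · exact ⟨hs.U, hs.adj, hs.f0, hs.f1, hs.W00, hs.W01, hs.W10, hs.W11, by simp⟩

/-- Sum over the values of the variable in register 21, whose neighbour is in register 23. -/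
def elim₁P : Program :=
  .seq (.write 4 (.reg 23) (.mul (.read 4 (.reg 23))
      (.add (.mul (.read 4 (.reg 21)) (.read 6 (prT (.reg 21) (.reg 23))))
        (.mul (.read 5 (.reg 21)) (.read 8 (prT (.reg 21) (.reg 23)))))))
    (.write 5 (.reg 23) (.mul (.read 5 (.reg 23))
      (.add (.mul (.read 4 (.reg 21)) (.read 7 (prT (.reg 21) (.reg 23))))
        (.mul (.read 5 (.reg 21)) (.read 9 (prT (.reg 21) (.reg 23)))))))

theorem ok_elim₁ {S : TwoSpin n} (hS : S.Good) {v a : Fin n} {s : State}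
    (hs : Rep { S with U := S.rm v } s) (h21 : s.reg 21 = v) (h23 : s.reg 23 = a)
    (hnb : S.nb v = {a}) (hpot : (S.elim₁ v).pot < 2 ^ b) {Q : State → Prop}
    (hQ : ∀ s', Frame elim₁P s s' → Bdd b s' → Rep (S.elim₁ v) s' → Q s') :
    Ok M b elim₁P s Q := by
  refine Ok.mono (Q := fun s' => Rep (S.elim₁ v) s') ?_ hQ
  have ha := TwoSpin.nb_subset_erase hS v (show a ∈ S.nb v by simp [hnb])
  have hmem : a ∈ (S.elim₁ v).act := by rwa [TwoSpin.act_of_U (S' := S.elim₁ v) rfl]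
  have hva : (v : ℕ) ≠ a := fun h => (mem_erase.1 ha).1 (Fin.ext h.symm)
  have hf : ∀ t, (S.elim₁ v).f t a =
      S.f t a * (S.f 0 v * S.W 0 t v a + S.f 1 v * S.W 1 t v a) := fun t => by
    simp [TwoSpin.elim₁, hnb]
  refine ok_seq (ok_write' (j := a) (v := (S.elim₁ v).f 0 a) h23 ?_
    (((S.elim₁ v).f_le_pot hmem 0).trans_lt hpot) ?_)
  · simp only [Term.val, prT_val, h21, h23, hs.f0, hs.f1, hs.W00, hs.W10, hf]
  refine ok_write' (j := a) (v := (S.elim₁ v).f 1 a) h23 ?_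
    (((S.elim₁ v).f_le_pot hmem 1).trans_lt hpot) ?_
  · simp only [Term.val, prT_val, State.setArr_reg, State.setArr_arr, h21, h23, hs.f0, hs.f1,
      hs.W01, hs.W11, hf, hva, and_false, false_and, if_false, Nat.reduceEqDiff]
  refine ⟨hs.U, hs.adj, fun x => ?_, fun x => ?_, hs.W00, hs.W01, hs.W10, hs.W11, hs.val⟩
  · by_cases hx : x = a
    · subst hx; simp
    · simp [hs.f0, Fin.val_inj, hx, TwoSpin.elim₁, hnb]
  · by_cases hx : x = a
    · subst hx; simp
    · simp [hs.f1, Fin.val_inj, hx, TwoSpin.elim₁, hnb]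

/-- Update the weight of the values `t` and `t'` of the variables in registers `x` and `y`. -/
def wrP (t t' x y : ℕ) : Program :=
  .write (6 + 2 * t + t') (prT (.reg x) (.reg y)) (.mul
    (.read (6 + 2 * t + t') (prT (.reg x) (.reg y)))
    (.add (.mul (.mul (.read 4 (.reg 21)) (.read (6 + t) (prT (.reg 21) (.reg x))))
        (.read (6 + t') (prT (.reg 21) (.reg y))))
      (.mul (.mul (.read 5 (.reg 21)) (.read (8 + t) (prT (.reg 21) (.reg x))))
        (.read (8 + t') (prT (.reg 21) (.reg y))))))

/-- Sum over the values of the variable in register 21, whose neighbours are in registers 23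
and 24. -/
def elim₂P : Program :=
  .seq (wrP 0 0 23 24) <| .seq (wrP 0 1 23 24) <| .seq (wrP 1 0 23 24) <| .seq (wrP 1 1 23 24) <|
  .seq (wrP 0 0 24 23) <| .seq (wrP 0 1 24 23) <| .seq (wrP 1 0 24 23) <| .seq (wrP 1 1 24 23) <|
  .seq (.write 3 (prT (.reg 23) (.reg 24)) (.const 1))
    (.write 3 (prT (.reg 24) (.reg 23)) (.const 1))

/-- Pair weights are stored in both orientations, so there are eight updates. The factors read
belong to pairs with first entry v, which differs from both neighbours, so earlier updates do not
disturb them. -/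
theorem ok_elim₂ {S : TwoSpin n} (hS : S.Good) {v a c : Fin n} {s : State}
    (hs : Rep { S with U := S.rm v } s) (h21 : s.reg 21 = v) (h23 : s.reg 23 = a)
    (h24 : s.reg 24 = c) (hac : a ≠ c) (hnb : S.nb v = {a, c})
    (hpot : (S.elim₂ v).pot < 2 ^ b) {Q : State → Prop}
    (hQ : ∀ s', Frame elim₂P s s' → Bdd b s' → Rep (S.elim₂ v) s' → Q s') :
    Ok M b elim₂P s Q := by
  refine Ok.mono (Q := fun s' => Rep (S.elim₂ v) s') ?_ hQ
  have ha' : a ∈ S.nb v := by simp [hnb]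
  have hc' : c ∈ S.nb v := by simp [hnb]
  have ha := TwoSpin.nb_subset_erase hS v ha'
  have hc := TwoSpin.nb_subset_erase hS v hc'
  have hact : (S.elim₂ v).act = S.act.erase v := TwoSpin.act_of_U rfl
  have hva : (v : ℕ) ≠ a := fun h => (mem_erase.1 ha).1 (Fin.ext h.symm)
  have hvc : (v : ℕ) ≠ c := fun h => (mem_erase.1 hc).1 (Fin.ext h.symm)
  have hac' : (a : ℕ) ≠ c := fun h => hac (Fin.ext h)
  have hW : ∀ t t' x y, x ∈ S.nb v ∧ y ∈ S.nb v ∧ x ≠ y → (S.elim₂ v).W t t' x y = S.W t t' x y *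
      (S.f 0 v * S.W 0 t v x * S.W 0 t' v y + S.f 1 v * S.W 1 t v x * S.W 1 t' v y) :=
    fun t t' x y h => by simp [TwoSpin.elim₂, h]
  have hWac := fun t t' => hW t t' a c ⟨ha', hc', hac⟩
  have hWca := fun t t' => hW t t' c a ⟨hc', ha', hac.symm⟩
  have hbd : ∀ t t', (S.elim₂ v).W t t' a c < 2 ^ b := fun t t' =>
    (TwoSpin.W_le_pot (hS.of_elim₂ v) (hact ▸ ha) (hact ▸ hc) hac t t').trans_lt hpot
  have hbd' : ∀ t t', (S.elim₂ v).W t t' c a < 2 ^ b := fun t t' =>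
    (TwoSpin.W_le_pot (hS.of_elim₂ v) (hact ▸ hc) (hact ▸ ha) hac.symm t t').trans_lt hpot
  have hone : 1 < 2 ^ b := lt_of_le_of_lt (TwoSpin.pot_pos _) hpot
  refine ok_seq (ok_write' (j := pr a c) (v := (S.elim₂ v).W 0 0 a c) ?_ ?_ (hbd 0 0) ?_)
  · simp [h23, h24, Term.val]
  · simp [Term.val, h21, h23, h24, hs.f0, hs.f1, hs.W00, hs.W10, hWac]
  refine ok_seq (ok_write' (j := pr a c) (v := (S.elim₂ v).W 0 1 a c) ?_ ?_ (hbd 0 1) ?_)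
  · simp [h23, h24, Term.val]
  · simp [Term.val, h21, h23, h24, hs.f0, hs.f1, hs.W00, hs.W01, hs.W10, hs.W11, hWac, pr_inj, hva]
  refine ok_seq (ok_write' (j := pr a c) (v := (S.elim₂ v).W 1 0 a c) ?_ ?_ (hbd 1 0) ?_)
  · simp [h23, h24, Term.val]
  · simp [Term.val, h21, h23, h24, hs.f0, hs.f1, hs.W00, hs.W01, hs.W10, hs.W11, hWac, pr_inj, hva]
  refine ok_seq (ok_write' (j := pr a c) (v := (S.elim₂ v).W 1 1 a c) ?_ ?_ (hbd 1 1) ?_)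
  · simp [h23, h24, Term.val]
  · simp [Term.val, h21, h23, h24, hs.f0, hs.f1, hs.W01, hs.W11, hWac, pr_inj, hva]
  refine ok_seq (ok_write' (j := pr c a) (v := (S.elim₂ v).W 0 0 c a) ?_ ?_ (hbd' 0 0) ?_)
  · simp [h23, h24, Term.val]
  · simp [Term.val, h21, h23, h24, hs.f0, hs.f1, hs.W00, hs.W10, hWca, pr_inj, hva,
      hac'.symm]
  refine ok_seq (ok_write' (j := pr c a) (v := (S.elim₂ v).W 0 1 c a) ?_ ?_ (hbd' 0 1) ?_)
  · simp [h23, h24, Term.val]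
  · simp [Term.val, h21, h23, h24, hs.f0, hs.f1, hs.W00, hs.W01, hs.W10, hs.W11, hWca, pr_inj, hva,
      hvc, hac'.symm]
  refine ok_seq (ok_write' (j := pr c a) (v := (S.elim₂ v).W 1 0 c a) ?_ ?_ (hbd' 1 0) ?_)
  · simp [h23, h24, Term.val]
  · simp [Term.val, h21, h23, h24, hs.f0, hs.f1, hs.W00, hs.W01, hs.W10, hs.W11, hWca, pr_inj, hva,
      hvc, hac'.symm]
  refine ok_seq (ok_write' (j := pr c a) (v := (S.elim₂ v).W 1 1 c a) ?_ ?_ (hbd' 1 1) ?_)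
  · simp [h23, h24, Term.val]
  · simp [Term.val, h21, h23, h24, hs.f0, hs.f1, hs.W01, hs.W11, hWca, pr_inj, hva,
      hvc, hac'.symm]
  refine ok_seq (ok_write' (j := pr a c) (v := 1) ?_ rfl hone ?_)
  · simp [h23, h24, Term.val]
  refine ok_write' (j := pr c a) (v := 1) ?_ rfl hone ?_
  · simp [h23, h24, Term.val]
  have hor : ∀ x y, x ∈ S.nb v ∧ y ∈ S.nb v ∧ x ≠ y ↔ (x = a ∧ y = c) ∨ (x = c ∧ y = a) := by
    intro x y
    simp only [hnb, mem_insert, mem_singleton]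
    constructor
    · rintro ⟨rfl | rfl, rfl | rfl, h⟩ <;> simp_all
    · rintro (⟨rfl, rfl⟩ | ⟨rfl, rfl⟩) <;> simp [hac, hac.symm]
  have hWn : ∀ t t' x y, ¬ (x = a ∧ y = c) → ¬ (x = c ∧ y = a) →
      (S.elim₂ v).W t t' x y = S.W t t' x y := fun t t' x y h1 h2 =>
    if_neg fun h => ((hor x y).1 h).elim h1 h2
  have hadj : ∀ x y, (S.elim₂ v).adj x y =
      if x = a ∧ y = c ∨ x = c ∧ y = a then 1 else S.adj x y := fun x y => by
    simp only [TwoSpin.elim₂, hor]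
  constructor
  · intro x; exact hs.U x
  · intro x y
    rw [hadj]
    simp only [State.setArr_arr, pr_inj, Fin.val_inj, hs.adj]
    by_cases h1 : x = a ∧ y = c
    · simp [h1]
    · by_cases h2 : x = c ∧ y = a
      · simp [h2]
      · simp [h1, h2]
  · intro x; exact hs.f0 x
  · intro x; exact hs.f1 x
  all_goals try intro x y
  all_goals try simp only [State.setArr_arr, pr_inj, Fin.val_inj]
  · by_cases h1 : x = a ∧ y = c
    · simp [h1, hac]
    · by_cases h2 : x = c ∧ y = a
      · simp [h2]
      · simp [h1, h2, hs.W00, hWn]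
  · by_cases h1 : x = a ∧ y = c
    · simp [h1, hac]
    · by_cases h2 : x = c ∧ y = a
      · simp [h2]
      · simp [h1, h2, hs.W01, hWn]
  · by_cases h1 : x = a ∧ y = c
    · simp [h1, hac]
    · by_cases h2 : x = c ∧ y = a
      · simp [h2]
      · simp [h1, h2, hs.W10, hWn]
  · by_cases h1 : x = a ∧ y = c
    · simp [h1, hac]
    · by_cases h2 : x = c ∧ y = a
      · simp [h2]
      · simp [h1, h2, hs.W11, hWn]
  · exact hs.val

/-- Treat the variable in register 21; the number of decisions taken is in register 11. -/
def stepP : Program :=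
  .seq (.write 2 (.reg 21) (.const 0)) <|
    .ite (.read 5 (.reg 21))
      (.ite (.sub (.reg 22) (.const 2))
        (.seq (.assign 29 (.read 1 (.reg 11))) <| .seq (.assign 11 (.add (.reg 11) (.const 1))) <|
          .ite (.reg 29) (condP 1) (condP 0))
        (.ite (.sub (.reg 22) (.const 1)) elim₂P (.ite (.reg 22) elim₁P elim₀P)))
      (condP 0)

theorem ok_step {S : TwoSpin n} (hS : S.Good) {v : Fin n} (hv : v ∈ S.act) {s : State}
    (hs : Rep S s) (h0 : s.reg 0 = n) (h21 : s.reg 21 = v)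
    (hn : Nbs S v (s.reg 22) (s.reg 23) (s.reg 24)) (hL : s.reg 11 ≤ n)
    (hM : n ≤ M) (hb : n + 4 < 2 ^ b) (hpot : 2 * S.pot < 2 ^ b) {Q : State → Prop}
    (hQ : ∀ s', Frame stepP s s' → Bdd b s' →
      Rep (S.next v (TwoSpin.bit (s.arr 1) (s.reg 11))) s' →
      s'.reg 11 = (if S.Branching v then s.reg 11 + 1 else s.reg 11) → Q s') :
    Ok M b stepP s Q := by
  refine Ok.mono (Q := fun s' => Rep (S.next v (TwoSpin.bit (s.arr 1) (s.reg 11))) s' ∧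
      s'.reg 11 = (if S.Branching v then s.reg 11 + 1 else s.reg 11)) ?_
    fun s' h1 h2 h3 => hQ s' h1 h2 h3.1 h3.2
  have hpot1 := (TwoSpin.pot_next_le hS hv (TwoSpin.bit (s.arr 1) (s.reg 11))).trans_lt hpot
  refine Ok.of_bdd fun hbdd => ?_
  refine ok_seq (ok_write' (j := v) (v := 0) h21 rfl (by positivity) ?_)
  have hs1 : Rep { S with U := S.rm v } (s.setArr 2 v 0) := by
    refine ⟨fun x => ?_, hs.adj, hs.f0, hs.f1, hs.W00, hs.W01, hs.W10, hs.W11, hs.val⟩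
    simp [TwoSpin.rm, Fin.val_inj, hs.U]
  unfold TwoSpin.next at hpot1 ⊢
  refine ok_ite (fun h5 => ?_) fun h5 => ?_
  · have h5' : S.f 1 v ≠ 0 := by simpa [Term.val, h21, hs.f1] using h5
    rw [if_neg h5'] at hpot1 ⊢
    refine ok_ite (fun h => ?_) fun h => ?_
    · have h3 : 3 ≤ (S.nb v).card := by
        simp only [Term.val, State.setArr_reg, hn.card] at h; omega
      rw [if_pos h3, if_pos (show S.Branching v from ⟨h5', h3⟩)]
      refine ok_seq (ok_assign' (v := s.arr 1 (s.reg 11)) (by simp [Term.val]) (hbdd.arr _ _) ?_)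
      refine ok_seq (ok_assign' (v := s.reg 11 + 1) (by simp [Term.val]) (by omega) ?_)
      have hs2 : Rep { S with U := S.rm v }
          (((s.setArr 2 v 0).setReg 29 (s.arr 1 (s.reg 11))).setReg 11 (s.reg 11 + 1)) :=
        ⟨hs1.U, hs1.adj, hs1.f0, hs1.f1, hs1.W00, hs1.W01, hs1.W10, hs1.W11, by
          simpa using hs1.val⟩
      refine ok_ite (fun hbit => ?_) fun hbit => ?_
      · have : s.arr 1 (s.reg 11) ≠ 0 := by simpa [Term.val] using hbit
        rw [TwoSpin.bit, if_neg this]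
        refine ok_cond hS hv 1 hs2 (by simp [h0]) (by simp [h21]) hM (by omega) (by omega)
          fun s' hf _ hr => ⟨hr, ?_⟩
        simpa using hf.reg 11 rfl
      · have : s.arr 1 (s.reg 11) = 0 := by simpa [Term.val] using hbit
        rw [TwoSpin.bit, if_pos this]
        refine ok_cond hS hv 0 hs2 (by simp [h0]) (by simp [h21]) hM (by omega) (by omega)
          fun s' hf _ hr => ⟨hr, ?_⟩
        simpa using hf.reg 11 rfl
    · have h3 : ¬ 3 ≤ (S.nb v).card := by
        simp only [Term.val, State.setArr_reg, hn.card] at h; omega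
      rw [if_neg h3] at hpot1 ⊢
      rw [if_neg (show ¬ S.Branching v from fun hh => h3 hh.2)]
      refine ok_ite (fun h => ?_) fun h => ?_
      · have h2 : (S.nb v).card = 2 := by
          simp only [Term.val, State.setArr_reg, hn.card] at h; omega
        rw [if_pos h2] at hpot1 ⊢
        obtain ⟨a, ha, c, hc, hac, h23, h24⟩ := hn.two (by rw [hn.card]; omega)
        have hnb : S.nb v = {a, c} := by
          refine (eq_of_subset_of_card_le (fun x hx => ?_) (by rw [h2, card_pair hac])).symm
          rcases mem_insert.1 hx with rfl | hx
          · exact ha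
          · rw [mem_singleton.1 hx]; exact hc
        exact ok_elim₂ hS hs1 h21 h23 h24 hac hnb hpot1 fun s' hf _ hr => ⟨hr, hf.reg 11 rfl⟩
      · have h2 : ¬ (S.nb v).card = 2 := by
          simp only [Term.val, State.setArr_reg, hn.card] at h; omega
        rw [if_neg h2] at hpot1 ⊢
        refine ok_ite (fun h => ?_) fun h => ?_
        · have h1 : (S.nb v).card = 1 := by
            simp only [Term.val, State.setArr_reg, hn.card] at h; omega
          rw [if_pos h1] at hpot1 ⊢
          obtain ⟨a, ha, h23⟩ := hn.one (by rw [hn.card]; omega)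
          obtain ⟨a', ha'⟩ := card_eq_one.1 h1
          have : a = a' := by simpa [ha'] using ha
          subst this
          exact ok_elim₁ hS hs1 h21 h23 ha' hpot1 fun s' hf _ hr => ⟨hr, hf.reg 11 rfl⟩
        · have h1 : ¬ (S.nb v).card = 1 := by
            simp only [Term.val, State.setArr_reg, hn.card] at h; omega
          rw [if_neg h1] at hpot1 ⊢
          exact ok_elim₀ hs1 h21 hpot1 fun s' hf _ hr => ⟨hr, hf.reg 11 rfl⟩
  · have h5' : S.f 1 v = 0 := by simpa [Term.val, h21, hs.f1] using h5
    rw [if_pos h5', if_neg (show ¬ S.Branching v from fun h => h.1 h5')]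
    exact ok_cond hS hv 0 hs1 h0 h21 hM (by omega) (by omega)
      fun s' hf _ hr => ⟨hr, hf.reg 11 rfl⟩

end InducedBiclique

namespace InducedBiclique

open Finset RAM

variable {n M b : ℕ}

/-! ### Running down the branching tree -/

/-- The entry of the adjacency matrix. -/
def gT (e f : Term) : Term := .read 0 (.add (.mul e (.reg 0)) f)

/-- One if the values are equal, and zero otherwise, for values at most 1. -/
def eqT (e f : Term) : Term := .sub (.const 1) (.add (.sub e f) (.sub f e))

@[simp] theorem gT_val (s : State) (e f : Term) :
    (gT e f).val s = s.arr 0 (e.val s * s.reg 0 + f.val s) := rfl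

@[simp] theorem eqT_val (s : State) (e f : Term) :
    (eqT e f).val s = eqN (e.val s) (f.val s) := rfl

/-- The memory holds the graph, the quadruple `q`, and the weights. -/
structure Ctx (G : SimpleGraph (Fin n)) (X Y : ℕ) (q : Quad n) (s : State) : Prop where
  hn : s.reg 0 = n
  ha : s.reg 3 = q.1
  hb : s.reg 4 = q.2.1
  hc : s.reg 5 = q.2.2.1
  hd : s.reg 6 = q.2.2.2
  hX : s.reg 8 = X
  hY : s.reg 9 = Y
  hA : ∀ x y : Fin n, s.arr 0 (x * n + y) = ad G x y

variable {G : SimpleGraph (Fin n)} {X Y : ℕ} {q : Quad n}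

theorem Ctx.frame {p : Program} {s s' : State} (h : Ctx G X Y q s) (hf : Frame p s s')
    (hp : (p.wr 0 || p.wr 3 || p.wr 4 || p.wr 5 || p.wr 6 || p.wr 8 || p.wr 9 || p.wa 0) = false) :
    Ctx G X Y q s' := by
  simp only [Bool.or_eq_false_iff] at hp
  obtain ⟨⟨⟨⟨⟨⟨⟨h0, h3⟩, h4⟩, h5⟩, h6⟩, h8⟩, h9⟩, ha⟩ := hp
  exact ⟨(hf.reg 0 h0).trans h.hn, (hf.reg 3 h3).trans h.ha, (hf.reg 4 h4).trans h.hb,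
    (hf.reg 5 h5).trans h.hc, (hf.reg 6 h6).trans h.hd, (hf.reg 8 h8).trans h.hX,
    (hf.reg 9 h9).trans h.hY, by rw [hf.arr 0 ha]; exact h.hA⟩

/-- The part of the system that concerns a single variable. -/
structure RowRep (S : TwoSpin n) (s : State) (x : Fin n) : Prop where
  U : s.arr 2 x = S.U x
  f0 : s.arr 4 x = S.f 0 x
  f1 : s.arr 5 x = S.f 1 x

/-- The part of the system that concerns a pair of variables. -/
structure CellRep (S : TwoSpin n) (s : State) (x y : Fin n) : Prop where
  adj : s.arr 3 (pr x y) = S.adj x y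
  W00 : s.arr 6 (pr x y) = S.W 0 0 x y
  W01 : s.arr 7 (pr x y) = S.W 0 1 x y
  W10 : s.arr 8 (pr x y) = S.W 1 0 x y
  W11 : s.arr 9 (pr x y) = S.W 1 1 x y

theorem rep_of_rows {S : TwoSpin n} {s : State} (hr : ∀ x, RowRep S s x)
    (hc : ∀ x y, CellRep S s x y) (hv : s.reg 12 = S.val) : Rep S s :=
  ⟨fun x => (hr x).U, fun x y => (hc x y).adj, fun x => (hr x).f0, fun x => (hr x).f1,
    fun x y => (hc x y).W00, fun x y => (hc x y).W01, fun x y => (hc x y).W10,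
    fun x y => (hc x y).W11, hv⟩

/-- Write the weights of the pair in registers 26 and 27. -/
def cellP : Program :=
  .seq (.write 3 (prT (.reg 26) (.reg 27)) (eqT (gT (.reg 26) (.reg 27))
    (eqT (gT (.reg 3) (.reg 26)) (gT (.reg 3) (.reg 27))))) <|
  .seq (.write 6 (prT (.reg 26) (.reg 27)) (.const 1)) <|
  .seq (.write 7 (prT (.reg 26) (.reg 27)) (.const 1)) <|
  .seq (.write 8 (prT (.reg 26) (.reg 27)) (.const 1)) <|
  .write 9 (prT (.reg 26) (.reg 27)) (.sub (.const 1) (.read 3 (prT (.reg 26) (.reg 27))))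

theorem ok_cell {s : State} (hs : Ctx G X Y q s) {x y : Fin n} (hx : s.reg 26 = x)
    (hy : s.reg 27 = y) (hb : 1 < 2 ^ b) {Q : State → Prop}
    (hQ : ∀ s', Frame cellP s s' → Bdd b s' → CellRep (root (ad G) X Y q) s' x y →
      (∀ x' y', ¬ (x' = x ∧ y' = y) → CellRep (root (ad G) X Y q) s x' y' →
        CellRep (root (ad G) X Y q) s' x' y') → Q s') : Ok M b cellP s Q := by
  refine Ok.mono (Q := fun s' => CellRep (root (ad G) X Y q) s' x y ∧
      (∀ x' y', ¬ (x' = x ∧ y' = y) → CellRep (root (ad G) X Y q) s x' y' →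
        CellRep (root (ad G) X Y q) s' x' y')) ?_ fun s' h1 h2 h3 => hQ s' h1 h2 h3.1 h3.2
  have hle : (root (ad G) X Y q).adj x y ≤ 1 := by rw [root_adj]; unfold eqN; omega
  refine ok_seq (ok_write' (j := pr x y) (v := (root (ad G) X Y q).adj x y) ?_ ?_ (by omega) ?_)
  · simp [Term.val, hx, hy]
  · simp only [Term.val, eqT_val, gT_val, hx, hy, hs.hn, hs.ha, hs.hA]
    rfl
  refine ok_seq (ok_write' (j := pr x y) (v := 1) ?_ rfl hb ?_)
  · simp [Term.val, hx, hy]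
  refine ok_seq (ok_write' (j := pr x y) (v := 1) ?_ rfl hb ?_)
  · simp [Term.val, hx, hy]
  refine ok_seq (ok_write' (j := pr x y) (v := 1) ?_ rfl hb ?_)
  · simp [Term.val, hx, hy]
  refine ok_write' (j := pr x y) (v := (root (ad G) X Y q).W 1 1 x y) ?_ ?_ ?_ ?_
  · simp [Term.val, hx, hy]
  · simp [Term.val, hx, hy, root_W_one]
  · rw [root_W_one]; omega
  · refine ⟨by constructor <;> simp <;> simp [root], fun x' y' hne h => ?_⟩
    constructor
    · simpa [pr_inj, Fin.val_inj, hne] using h.adj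
    · simpa [pr_inj, Fin.val_inj, hne] using h.W00
    · simpa [pr_inj, Fin.val_inj, hne] using h.W01
    · simpa [pr_inj, Fin.val_inj, hne] using h.W10
    · simpa [pr_inj, Fin.val_inj, hne] using h.W11

/-- Write the weights of the variable in register 26. -/
def rowP : Program :=
  .seq (.write 2 (.reg 26) (.add
    (.mul (.mul (gT (.reg 3) (.reg 26)) (gT (.reg 4) (.reg 26)))
      (.sub (.const 1) (.add (gT (.reg 5) (.reg 26)) (gT (.reg 6) (.reg 26)))))
    (.mul (.mul (gT (.reg 5) (.reg 26)) (gT (.reg 6) (.reg 26)))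
      (.sub (.const 1) (.add (gT (.reg 3) (.reg 26)) (gT (.reg 4) (.reg 26))))))) <|
  .seq (.write 4 (.reg 26) (.const 1)) <|
  .write 5 (.reg 26) (.add (.mul (gT (.reg 3) (.reg 26)) (.reg 9))
    (.mul (.sub (.const 1) (gT (.reg 3) (.reg 26))) (.reg 8)))

theorem root_U_le (x : Fin n) : (root (ad G) X Y q).U x ≤ 1 := by
  simp only [root, ad]
  by_cases h1 : G.Adj q.1 x <;> by_cases h2 : G.Adj q.2.1 x <;> by_cases h3 : G.Adj q.2.2.1 x <;>
    by_cases h4 : G.Adj q.2.2.2 x <;> simp [h1, h2, h3, h4]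

theorem root_f_le (hXY : X ≤ Y) (x : Fin n) :
    (root (ad G) X Y q).f 1 x ≤ Y := by
  simp only [root, ad]
  by_cases h1 : G.Adj q.1 x <;> simp [h1, hXY]

theorem ok_row {s : State} (hs : Ctx G X Y q s) {x : Fin n} (hx : s.reg 26 = x)
    (hb : 1 < 2 ^ b) (hXY : X ≤ Y) (hY : Y < 2 ^ b) {Q : State → Prop}
    (hQ : ∀ s', Frame rowP s s' → Bdd b s' → RowRep (root (ad G) X Y q) s' x →
      (∀ x', x' ≠ x → RowRep (root (ad G) X Y q) s x' →
        RowRep (root (ad G) X Y q) s' x') → Q s') : Ok M b rowP s Q := by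
  refine Ok.mono (Q := fun s' => RowRep (root (ad G) X Y q) s' x ∧
      (∀ x', x' ≠ x → RowRep (root (ad G) X Y q) s x' →
        RowRep (root (ad G) X Y q) s' x')) ?_ fun s' h1 h2 h3 => hQ s' h1 h2 h3.1 h3.2
  refine ok_seq (ok_write' (j := x) (v := (root (ad G) X Y q).U x) hx ?_
    ((root_U_le x).trans_lt hb) ?_)
  · simp only [Term.val, gT_val, hx, hs.hn, hs.ha, hs.hb, hs.hc, hs.hd, hs.hA]
    rfl
  refine ok_seq (ok_write' (j := x) (v := 1) hx rfl hb ?_)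
  refine ok_write' (j := x) (v := (root (ad G) X Y q).f 1 x) hx ?_
    ((root_f_le hXY x).trans_lt hY) ?_
  · simp [Term.val, hx, hs.hn, hs.ha, hs.hA, hs.hX, hs.hY, root]
  · refine ⟨by constructor <;> simp; simp [root], fun x' hne h => ?_⟩
    constructor
    · simpa [Fin.val_inj, hne] using h.U
    · simpa [Fin.val_inj, hne] using h.f0
    · simpa [Fin.val_inj, hne] using h.f1

/-- Write the initial system into memory. -/
def setupP : Program := forP 26 (.reg 0) (.seq rowP (forP 27 (.reg 0) cellP))

theorem ok_setup {s : State} (hs : Ctx G X Y q s) (hM : n ≤ M) (hb : n + 4 < 2 ^ b)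
    (hXY : X ≤ Y) (hY : Y < 2 ^ b) {Q : State → Prop}
    (hQ : ∀ s', Frame setupP s s' → Bdd b s' → (∀ x, RowRep (root (ad G) X Y q) s' x) →
      (∀ x y, CellRep (root (ad G) X Y q) s' x y) → Q s') : Ok M b setupP s Q := by
  set S := root (ad G) X Y q with hS
  refine Ok.mono (Q := fun s' => (∀ x, RowRep S s' x) ∧ ∀ x y, CellRep S s' x y) ?_
    fun s' h1 h2 h3 => hQ s' h1 h2 h3.1 h3.2
  have hlt : ∀ (x y : Fin n), y.val < x.val + 1 → y = x ∨ y.val < x.val := fun x y h => by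
    rcases Nat.lt_or_ge y.val x.val with h1 | h1
    · exact Or.inr h1
    · exact Or.inl (Fin.ext (by omega))
  refine ok_for n (fun i s' => (∀ x : Fin n, x.val < i → RowRep S s' x) ∧
    ∀ x : Fin n, x.val < i → ∀ y, CellRep S s' x y) hM (by omega) rfl
    (fun s' hf => by simpa [Term.val, hs.hn] using hf.reg 0 rfl) (by simp) ?_ ?_
  · rintro i hi s₁ hf₁ - hri ⟨hr, hc⟩
    obtain ⟨x, rfl⟩ : ∃ x : Fin n, x.val = i := ⟨⟨i, hi⟩, rfl⟩
    have hs₁ := hs.frame hf₁ rfl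
    refine ok_seq (ok_row hs₁ hri (by omega) hXY hY ?_)
    intro s₂ hf₂ _ hr₂ hr₂'
    have hs₂ := hs₁.frame hf₂ rfl
    have hc₂ : ∀ x' : Fin n, x'.val < x.val → ∀ y, CellRep S s₂ x' y := fun x' hx' y => by
      have h := hc x' hx' y
      exact ⟨by rw [hf₂.arr 3 rfl, h.adj], by rw [hf₂.arr 6 rfl, h.W00],
        by rw [hf₂.arr 7 rfl, h.W01], by rw [hf₂.arr 8 rfl, h.W10], by rw [hf₂.arr 9 rfl, h.W11]⟩
    refine ok_for n (fun j s' => (∀ x' : Fin n, x'.val < x.val → ∀ y, CellRep S s' x' y) ∧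
      ∀ y : Fin n, y.val < j → CellRep S s' x y) hM (by omega) rfl
      (fun s' hf => by simpa [Term.val, hs₂.hn] using hf.reg 0 rfl) ?_ ?_ ?_
    · refine ⟨fun x' hx' y => ?_, by simp⟩
      have h := hc₂ x' hx' y
      exact ⟨h.adj, h.W00, h.W01, h.W10, h.W11⟩
    · rintro j hj s₃ hf₃ - hrj ⟨hA, hB⟩
      obtain ⟨y, rfl⟩ : ∃ y : Fin n, y.val = j := ⟨⟨j, hj⟩, rfl⟩
      have h26 : s₃.reg 26 = x := by rw [hf₃.reg 26 rfl, hf₂.reg 26 rfl, hri]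
      refine ok_cell (hs₂.frame hf₃ rfl) h26 hrj (by omega) ?_
      intro s₄ hf₄ _ hcell hcell'
      refine ⟨fun x' hx' y' => ?_, fun y' hy' => ?_⟩
      · have h := hcell' x' y' (fun h => by rw [h.1] at hx'; exact lt_irrefl _ hx') (hA x' hx' y')
        exact ⟨h.adj, h.W00, h.W01, h.W10, h.W11⟩
      · rcases hlt y y' hy' with rfl | h1
        · exact ⟨hcell.adj, hcell.W00, hcell.W01, hcell.W10, hcell.W11⟩
        · have h := hcell' x y' (fun h => by rw [h.2] at h1; exact lt_irrefl _ h1) (hB y' h1)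
          exact ⟨h.adj, h.W00, h.W01, h.W10, h.W11⟩
    · rintro s₃ hf₃ - - ⟨hA, hB⟩
      refine ⟨fun x' hx' => ?_, fun x' hx' y => ?_⟩
      · have h : RowRep S s₂ x' := by
          rcases hlt x x' hx' with rfl | h1
          · exact hr₂
          · exact hr₂' x' (fun h => by rw [h] at h1; exact lt_irrefl _ h1) (hr x' h1)
        exact ⟨by rw [State.setReg_arr, hf₃.arr 2 rfl, h.U],
          by rw [State.setReg_arr, hf₃.arr 4 rfl, h.f0],
          by rw [State.setReg_arr, hf₃.arr 5 rfl, h.f1]⟩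
      · have h : CellRep S s₃ x' y := by
          rcases hlt x x' hx' with rfl | h1
          · exact hB y y.isLt
          · exact hA x' h1 y
        exact ⟨h.adj, h.W00, h.W01, h.W10, h.W11⟩
  · rintro s' - - - ⟨hr, hc⟩
    exact ⟨fun x => hr x x.isLt, fun x => hc x x.isLt⟩

/-- Run down the branching tree, taking decisions from array 1. -/
def runP : Program :=
  .seq setupP <| .seq (.assign 12 (.const 1)) <| .seq (.assign 11 (.const 0)) <|
    forP 13 (.reg 0) (.seq selP (.ite (.reg 20) stepP .skip))

theorem iterate_step (β : ℕ → ℕ) {R : TwoSpin n} (hR : R.Good) (i : ℕ) :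
    ((TwoSpin.step β)^[i] (R, 0)).1.Good ∧
    ((TwoSpin.step β)^[i] (R, 0)).1.pot ≤ 2 ^ i * R.pot ∧
    ((TwoSpin.step β)^[i] (R, 0)).2 ≤ i := by
  induction i with
  | zero => simpa using hR
  | succ i ih =>
    rw [Function.iterate_succ_apply']
    obtain ⟨h1, h2, h3⟩ := ih
    set x := (TwoSpin.step β)^[i] (R, 0)
    unfold TwoSpin.step
    cases hs : x.1.sel with
    | none =>
      refine ⟨h1, h2.trans ?_, by dsimp only; omega⟩
      exact Nat.mul_le_mul_right _ (Nat.pow_le_pow_right (by norm_num) (by omega))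
    | some v =>
      refine ⟨h1.next _ _, ?_, ?_⟩
      · have := TwoSpin.pot_next_le h1 (TwoSpin.sel_eq_some.1 hs).1 (TwoSpin.bit β x.2)
        dsimp only
        rw [pow_succ]
        nlinarith
      · dsimp only
        split_ifs <;> omega

theorem ok_run {s : State} (hs : Ctx G X Y q s) (hM : n ≤ M) (hb : n + 4 < 2 ^ b)
    (hXY : X ≤ Y) (hY : Y < 2 ^ b) (hpot : 2 ^ (n + 1) * (root (ad G) X Y q).pot < 2 ^ b)
    {Q : State → Prop} (hQ : ∀ s', Frame runP s s' → Bdd b s' →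
      s'.reg 12 = ((TwoSpin.step (s.arr 1))^[n] (root (ad G) X Y q, 0)).1.val →
      s'.reg 11 = ((TwoSpin.step (s.arr 1))^[n] (root (ad G) X Y q, 0)).2 → Q s') :
    Ok M b runP s Q := by
  set S := root (ad G) X Y q with hS
  set β := s.arr 1 with hβ
  refine Ok.mono (Q := fun s' => s'.reg 12 = ((TwoSpin.step β)^[n] (S, 0)).1.val ∧
      s'.reg 11 = ((TwoSpin.step β)^[n] (S, 0)).2) ?_ fun s' h1 h2 h3 => hQ s' h1 h2 h3.1 h3.2
  refine ok_seq (ok_setup hs hM hb hXY hY ?_)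
  intro s₁ hf₁ _ hr hc
  refine ok_seq (ok_assign' (v := 1) rfl (by omega) ?_)
  refine ok_seq (ok_assign' (v := 0) rfl (by omega) ?_)
  have hs₁ := hs.frame hf₁ rfl
  refine ok_for n (fun i s' => Rep ((TwoSpin.step β)^[i] (S, 0)).1 s' ∧
    s'.reg 11 = ((TwoSpin.step β)^[i] (S, 0)).2) hM (by omega) rfl
    (fun s' hf => by simpa [Term.val, hs₁.hn] using hf.reg 0 rfl) ?_ ?_ ?_
  · refine ⟨rep_of_rows (fun x => ?_) (fun x y => ?_) ?_, by simp⟩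
    · exact ⟨(hr x).U, (hr x).f0, (hr x).f1⟩
    · exact ⟨(hc x y).adj, (hc x y).W00, (hc x y).W01, (hc x y).W10, (hc x y).W11⟩
    · simp [hS, root]
  · rintro i hi s₂ hf₂ - - ⟨hrep, h11⟩
    obtain ⟨hg, hp, hL⟩ := iterate_step β (R := S) (root_good G X Y q) i
    rw [Function.iterate_succ_apply']
    set x := (TwoSpin.step β)^[i] (S, 0) with hx
    have hsys := rep_iff.1 hrep
    have h0 : s₂.reg 0 = n := by simpa [hs₁.hn] using hf₂.reg 0 rfl
    have hβ₂ : s₂.arr 1 = β := by rw [hf₂.arr 1 rfl]; exact hf₁.arr 1 rfl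
    refine ok_seq (ok_sel h0 hM hb ?_)
    intro s₃ hf₃ _ hnone hsome
    rw [hsys] at hnone hsome
    have hrep₃ : Rep x.1 s₃ := by
      rw [rep_iff, sysOf_frame hf₃ (by decide) rfl, hsys]
    have h11₃ : s₃.reg 11 = x.2 := by rw [hf₃.reg 11 rfl, h11]
    have hβ₃ : s₃.arr 1 = β := by rw [hf₃.arr 1 rfl, hβ₂]
    unfold TwoSpin.step
    cases hsel : x.1.sel with
    | none =>
      refine ok_ite (fun h => absurd (hnone hsel) h) fun _ => ok_skip ⟨?_, by simpa using h11₃⟩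
      exact ⟨hrep₃.U, hrep₃.adj, hrep₃.f0, hrep₃.f1, hrep₃.W00, hrep₃.W01, hrep₃.W10, hrep₃.W11,
        by simpa using hrep₃.val⟩
    | some v =>
      obtain ⟨h20, h21, hn⟩ := hsome v hsel
      refine ok_ite (fun _ => ?_) fun h => absurd h h20
      have hpot' : 2 * x.1.pot < 2 ^ b := by
        refine lt_of_le_of_lt ?_ hpot
        have : (2:ℕ) ^ i ≤ 2 ^ n := Nat.pow_le_pow_right (by norm_num) hi.le
        rw [pow_succ]
        nlinarith [S.pot_pos]
      refine ok_step hg (TwoSpin.sel_eq_some.1 hsel).1 hrep₃ (by rw [hf₃.reg 0 rfl, h0]) h21 hn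
        (by omega) hM hb hpot' ?_
      intro s₄ _ _ hrep₄ h11₄
      rw [hβ₃, h11₃] at hrep₄
      rw [h11₃] at h11₄
      refine ⟨?_, by simpa using h11₄⟩
      exact ⟨hrep₄.U, hrep₄.adj, hrep₄.f0, hrep₄.f1, hrep₄.W00, hrep₄.W01, hrep₄.W10, hrep₄.W11,
        by simpa using hrep₄.val⟩
  · rintro s' - - - ⟨hrep, h11⟩
    exact ⟨hrep.val, h11⟩

/-! ### The decision counter and the loop over the leaves. -/

/-- Go to the next sequence of decisions; register 10 tells whether there is one. -/
def advP : Program :=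
  .seq (.assign 25 (.reg 11)) <| .seq (.assign 10 (.const 0)) <|
    .loop (.mul (.reg 25) (.sub (.const 1) (.reg 10))) <|
      .seq (.assign 25 (.sub (.reg 25) (.const 1))) <|
        .ite (.read 1 (.reg 25)) (.write 1 (.reg 25) (.const 0))
          (.seq (.write 1 (.reg 25) (.const 1)) (.assign 10 (.const 1)))

theorem setArr_arr_eq (s : State) (a i v : ℕ) :
    (s.setArr a i v).arr a = Function.update (s.arr a) i v := by
  simp [State.setArr]

theorem ok_adv {s : State} (hL : s.reg 11 ≤ n) (hM : n ≤ M) (hb : n + 4 < 2 ^ b)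
    {Q : State → Prop} (hQ : ∀ s', Frame advP s s' → Bdd b s' →
      (s'.arr 1, s'.reg 10) = TwoSpin.adv (s.arr 1) (s.reg 11) → Q s') : Ok M b advP s Q := by
  refine Ok.mono ?_ hQ
  refine ok_seq (ok_assign' (v := s.reg 11) rfl (by omega) ?_)
  refine ok_seq (ok_assign' (v := 0) rfl (by omega) ?_)
  -- Either the last 0 is still being sought, and advancing the first k entries gives the required
  -- result, or it has been found and the array is final.
  refine ok_loop (fun k s' => s'.reg 25 = k ∧ k ≤ n ∧
      ((s'.reg 10 = 0 ∧ TwoSpin.adv (s'.arr 1) k = TwoSpin.adv (s.arr 1) (s.reg 11)) ∨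
      (s'.reg 10 = 1 ∧ (s'.arr 1, 1) = TwoSpin.adv (s.arr 1) (s.reg 11)))) (s.reg 11)
    (hL.trans hM) (by simp [hL]) ?_ ?_
  · rintro k s' - ⟨h25, hk, hI⟩ hne
    simp only [Term.val, h25] at hne
    rcases hI with ⟨h10, hI⟩ | ⟨h10, -⟩
    · obtain ⟨j, rfl⟩ : ∃ j, k = j + 1 := ⟨k - 1, by
        have : k ≠ 0 := fun h => hne (by simp [h])
        omega⟩
      refine ok_seq (ok_assign' (v := j) (by simp [Term.val, h25]) (by omega) ?_)
      rw [TwoSpin.adv] at hI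
      refine ok_ite (fun h => ?_) fun h => ?_
      · have h' : s'.arr 1 j ≠ 0 := by simpa [Term.val] using h
        rw [if_neg h'] at hI
        refine ok_write' (j := j) (v := 0) (by simp [Term.val]) rfl (by omega) ?_
        refine ⟨j, by omega, by simp, by omega, Or.inl ⟨by simpa using h10, ?_⟩⟩
        rw [setArr_arr_eq]
        exact hI
      · have h' : s'.arr 1 j = 0 := by simpa [Term.val] using h
        rw [if_pos h'] at hI
        refine ok_seq (ok_write' (j := j) (v := 1) (by simp [Term.val]) rfl (by omega) ?_)
        refine ok_assign' (v := 1) rfl (by omega) ?_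
        refine ⟨j, by omega, by simp, by omega, Or.inr ⟨by simp, ?_⟩⟩
        rw [State.setReg_arr, setArr_arr_eq]
        exact hI
    · rw [h10] at hne; simp at hne
  · rintro k s' - ⟨h25, -, hI⟩ h0
    simp only [Term.val, h25] at h0
    rcases hI with ⟨h10, hI⟩ | ⟨h10, hI⟩
    · rw [h10] at h0
      have : k = 0 := by simpa using h0
      rw [this, TwoSpin.adv] at hI
      rw [h10]; exact hI
    · rw [h10]; exact hI

/-- One round: run, add the value to register 7, and advance. -/
def roundP : Program := .seq runP <| .seq (.assign 7 (.add (.reg 7) (.reg 12))) advP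

theorem ok_round {s : State} (hs : Ctx G X Y q s) (hM : n ≤ M) (hb : n + 4 < 2 ^ b)
    (hXY : X ≤ Y) (hY : Y < 2 ^ b) (hpot : 2 ^ (n + 1) * (root (ad G) X Y q).pot < 2 ^ b)
    (hacc : ((root (ad G) X Y q).round (s.reg 7, s.arr 1)).1 < 2 ^ b)
    {Q : State → Prop} (hQ : ∀ s', Frame roundP s s' → Bdd b s' →
      (s'.reg 7, s'.arr 1, s'.reg 10) = (root (ad G) X Y q).round (s.reg 7, s.arr 1) → Q s') :
    Ok M b roundP s Q := by
  refine Ok.mono ?_ hQ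
  refine ok_seq (ok_run hs hM hb hXY hY hpot ?_)
  intro s₁ hf₁ _ h12 h11
  simp only [TwoSpin.round] at hacc ⊢
  have h7 := hf₁.reg 7 rfl
  rw [← h12] at hacc ⊢
  rw [← h11]
  have hL := (iterate_step (s.arr 1) (root_good G X Y q) n).2.2
  rw [← h11] at hL
  refine ok_seq (ok_assign' (v := s.reg 7 + s₁.reg 12) (by simp [Term.val, h7]) hacc ?_)
  refine ok_adv (by simpa using hL) hM hb ?_
  intro s₂ hf₂ _ hadv
  rw [hadv]
  have h7₂ : s₂.reg 7 = s.reg 7 + s₁.reg 12 := by simpa using hf₂.reg 7 rfl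
  rw [h7₂]
  simp [hf₁.arr 1 rfl]

/-- This is the only loop with possibly exponentially many rounds. It is therefore timed by the
length of the chain, while each round has the static polynomial bound. The word length has to
accommodate only the final sum. -/
theorem okT_chain (hM : n ≤ M) (hb : n + 4 < 2 ^ b)
    (hXY : X ≤ Y) (hY : Y < 2 ^ b) (hpot : 2 ^ (n + 1) * (root (ad G) X Y q).pot < 2 ^ b)
    {x : ℕ × (ℕ → ℕ)} {m : ℕ} {y : ℕ × (ℕ → ℕ) × ℕ}
    (h : TwoSpin.Chain (root (ad G) X Y q) x m y) (hy : y.2.2 = 0) (hlt : y.1 < 2 ^ b) {s : State}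
    (hs : Ctx G X Y q s) (h7 : s.reg 7 = x.1) (h1 : s.arr 1 = x.2) (h10 : s.reg 10 ≠ 0) :
    OkT b (.loop (.reg 10) roundP) s ((m + 1) * (1 + (Term.reg 10).bound b + roundP.time M b))
      fun s' => s'.reg 7 = y.1 ∧ s'.arr 1 = y.2.1 := by
  have hle := h.le
  induction h generalizing s with
  | one x =>
    intro hbd
    have hround := ok_round (M := M) hs hM hb hXY hY hpot (by rw [h7, h1]; exact hlt)
      (Q := fun s' => (s'.reg 7, s'.arr 1, s'.reg 10) = (root (ad G) X Y q).round x)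
      (fun s' _ _ h => by rw [h, h7, h1])
    obtain ⟨t, s', hr, ht, hbd', hq⟩ := hround hbd
    have hc := (Term.reg 10).cost_le hbd
    have hc' := (Term.reg 10).cost_le hbd'
    have h10' : (Term.reg 10).val s' = 0 := by
      rw [← hy, ← hq]; rfl
    refine ⟨_, _, .loop_step h10 hr (.loop_done h10'), ?_, hbd', ?_⟩
    · have : roundP.time M b ≥ t := ht
      nlinarith
    · rw [← hq]; exact ⟨rfl, rfl⟩
  | @more x m y h2 hch ih =>
    intro hbd
    have hround := ok_round (M := M) hs hM hb hXY hY hpot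
      (by rw [h7, h1]; exact lt_of_le_of_lt hch.le hlt)
      (Q := fun s' => Ctx G X Y q s' ∧
        (s'.reg 7, s'.arr 1, s'.reg 10) = (root (ad G) X Y q).round x)
      (fun s' hf _ h => ⟨hs.frame hf rfl, by rw [h, h7, h1]⟩)
    obtain ⟨t, s', hr, ht, hbd', hctx, hq⟩ := hround hbd
    have hc := (Term.reg 10).cost_le hbd
    have h10' : s'.reg 10 ≠ 0 := by rw [← hq] at h2; exact h2
    obtain ⟨t', s'', hr', ht', hbd'', hq'⟩ := ih hy hlt hctx (by rw [← hq]) (by rw [← hq]) h10'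
      hch.le hbd'
    refine ⟨_, _, .loop_step h10 hr hr', ?_, hbd'', hq'⟩
    have : roundP.time M b ≥ t := ht
    nlinarith

end InducedBiclique

namespace InducedBiclique

open Finset RAM

variable {n M b L : ℕ} {G : SimpleGraph (Fin n)} {X Y : ℕ} {q : Quad n}

/-! ### Summing over all quadruples -/

/-- Add the partition function of the current quadruple to register 7. -/
def quadP : Program := .seq (.assign 10 (.const 1)) (.loop (.reg 10) roundP)

theorem okT_quad (hM : n ≤ M) (hb : n + 4 < 2 ^ b) (hXY : X ≤ Y) (hY : Y < 2 ^ b)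
    (hpot : 2 ^ (n + 1) * (root (ad G) X Y q).pot < 2 ^ b)
    (hL : (root (ad G) X Y q).leaves n ≤ L) {s : State} (hs : Ctx G X Y q s)
    (h1 : s.arr 1 = fun _ => 0) (hacc : s.reg 7 + (root (ad G) X Y q).Z < 2 ^ b) :
    OkT b quadP s (1 + (Term.const 1).bound b +
        (L + 1) * (1 + (Term.reg 10).bound b + roundP.time M b))
      fun s' => s'.reg 7 = s.reg 7 + (root (ad G) X Y q).Z ∧ s'.arr 1 = fun _ => 0 := by
  have hch := TwoSpin.chain_root (root (ad G) X Y q) (s.reg 7)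
  rw [TwoSpin.total_eq_Z (root_good G X Y q) ((card_le_univ _).trans (by simp))] at hch
  refine okT_seq (OkT.mono (ok_assign' (b := b) (M := M) (v := 1) rfl (by omega) ?_) le_rfl
    fun _ _ _ h => h)
  refine (okT_chain (s := s.setReg 10 1) hM hb hXY hY hpot hch rfl hacc ?_ (by simp) h1
    (by simp)).mono ?_
    fun _ _ _ h => h
  · exact ⟨hs.hn, hs.ha, hs.hb, hs.hc, hs.hd, hs.hX, hs.hY, hs.hA⟩
  · gcongr

/-- Nonzero if the quadruple consists of two pairs of distinct nonadjacent vertices. -/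
def validT : Term :=
  .mul (.mul (.sub (.const 1) (eqT (.reg 3) (.reg 4))) (.sub (.const 1) (gT (.reg 3) (.reg 4))))
    (.mul (.sub (.const 1) (eqT (.reg 5) (.reg 6))) (.sub (.const 1) (gT (.reg 5) (.reg 6))))

theorem one_sub_eqN_ne_zero {i j : ℕ} : 1 - eqN i j ≠ 0 ↔ i ≠ j := by unfold eqN; omega

theorem one_sub_ad_ne_zero {x y : Fin n} : 1 - ad G x y ≠ 0 ↔ ¬ G.Adj x y := by
  rw [← ad_ne_zero]; omega

theorem validT_val_ne_zero {s : State} (hs : Ctx G X Y q s) : validT.val s ≠ 0 ↔ Valid G q := by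
  simp only [validT, Term.val, eqT_val, gT_val, hs.hn, hs.ha, hs.hb, hs.hc, hs.hd, hs.hA,
    mul_ne_zero_iff, one_sub_eqN_ne_zero, one_sub_ad_ne_zero, Valid, ne_eq, Fin.val_inj, and_assoc]

/-- The program adds `v` to register 7 in time `T`, provided that array 1 is zero. -/
def Adds (b T v : ℕ) (p : Program) (s : State) : Prop :=
  s.arr 1 = (fun _ => 0) → s.reg 7 + v < 2 ^ b →
    OkT b p s T fun s' => s'.reg 7 = s.reg 7 + v ∧ s'.arr 1 = fun _ => 0

/-- Treat one quadruple. -/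
def bodyP : Program := .ite validT quadP .skip

/-- A bound for the running time of `bodyP` per leaf of the branching tree. -/
def bodyTime (M b : ℕ) : ℕ :=
  1 + validT.bound b + (1 + (Term.const 1).bound b +
    2 * (1 + (Term.reg 10).bound b + roundP.time M b))

open Classical in
-- Since L ≥ 1, the fixed overhead can be charged to the leaves and L + 1 is at most 2L, so the time
-- has the form L times a polynomial.
theorem adds_body (hM : n ≤ M) (hb : n + 4 < 2 ^ b) (hXY : X ≤ Y) (hY : Y < 2 ^ b)
    (hpot : 2 ^ (n + 1) * (root (ad G) X Y q).pot < 2 ^ b) (h1 : 1 ≤ L)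
    (hL : Valid G q → (root (ad G) X Y q).leaves n ≤ L) {s : State} (hs : Ctx G X Y q s) :
    Adds b (L * bodyTime M b) (if Valid G q then (root (ad G) X Y q).Z else 0) bodyP s := by
  intro ha hacc
  set K := 1 + (Term.reg 10).bound b + roundP.time M b with hK
  refine OkT.mono (T := 1 + validT.bound b + (1 + (Term.const 1).bound b + (L + 1) * K))
    (okT_ite (fun h => ?_) fun h => ?_) ?_ fun _ _ _ h => h
  · have hv := (validT_val_ne_zero hs).1 h
    rw [if_pos hv] at hacc ⊢
    exact okT_quad hM hb hXY hY hpot (hL hv) hs ha hacc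
  · have hv : ¬ Valid G q := fun hv => (validT_val_ne_zero hs).2 hv h
    rw [if_neg hv]
    exact OkT.mono (ok_skip (M := M) (b := b) (s := s) (Q := fun s' => s' = s) rfl)
      (by simp only [Program.time]; omega) fun s' _ _ h => by subst h; exact ⟨rfl, ha⟩
  · unfold bodyTime
    rw [← hK]
    obtain ⟨l, rfl⟩ : ∃ l, L = l + 1 := ⟨L - 1, by omega⟩
    nlinarith [Nat.zero_le (l * K), Nat.zero_le (l * validT.bound b),
      Nat.zero_le (l * (Term.const 1).bound b)]

/-- A bound for the running time of a loop with `N` rounds, each of which takes time `T`. -/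
def forTime (N b T : ℕ) : ℕ :=
  1 + (Term.const 0).bound b + (N + 1) * (1 + (Term.sub (.reg 0) (.reg 0)).bound b
    + (T + (1 + (Term.add (.reg 0) (.const 1)).bound b)))

/-- As L ≥ 1 absorbs the loop overhead, the factor L passes unchanged through the four nested loops.
-/
theorem forTime_mul_le {T : ℕ} (hM : n ≤ M) (h1 : 1 ≤ L) :
    forTime n b (L * T) ≤ L * forTime M b T := by
  unfold forTime
  set u := (Term.const 0).bound b
  set v := (Term.sub (.reg 0) (.reg 0)).bound b
  set w := (Term.add (.reg 0) (.const 1)).bound b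
  calc 1 + u + (n + 1) * (1 + v + (L * T + (1 + w)))
      ≤ L * (1 + u) + (M + 1) * (L * (1 + v) + (L * T + L * (1 + w))) := by
        gcongr
        · exact Nat.le_mul_of_pos_left _ h1
        · exact Nat.le_mul_of_pos_left _ h1
        · exact Nat.le_mul_of_pos_left _ h1
    _ = _ := by ring

theorem adds_for {x T : ℕ} {p : Program} {s : State} (hx : p.wr x = false) (hx7 : 7 ≠ x)
    (hp0 : (forP x (.reg 0) p).wr 0 = false) (h0 : s.reg 0 = n) (hM : n ≤ M) (hb : n < 2 ^ b)
    (h1 : 1 ≤ L) (v : Fin n → ℕ)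
    (step : ∀ i : Fin n, ∀ s', Frame (forP x (.reg 0) p) s s' → s'.reg x = i →
      Adds b (L * T) (v i) p s') :
    Adds b (L * forTime M b T) (∑ i, v i) (forP x (.reg 0) p) s := by
  intro ha hacc
  set g : ℕ → ℕ := fun i => if h : i < n then v ⟨i, h⟩ else 0 with hg
  have hsum : ∑ i, v i = ∑ i ∈ range n, g i := sum_fin_eq_sum_range v
  rw [hsum] at hacc ⊢
  refine OkT.mono (T := forTime n b (L * T)) ?_ (forTime_mul_le hM h1) fun _ _ _ h => h
  refine okT_for n (fun i s' => s'.reg 7 = s.reg 7 + ∑ j ∈ range i, g j ∧ s'.arr 1 = fun _ => 0)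
    hb hx (fun s' hf => by simpa [Term.val, h0] using hf.reg 0 hp0) (by simp [hx7, ha]) ?_ ?_
  · rintro i hi s' hf - hri ⟨h7, ha'⟩
    have hgi : v ⟨i, hi⟩ = g i := by simp [hg, hi]
    have hle : ∑ j ∈ range i, g j + g i ≤ ∑ j ∈ range n, g j := by
      rw [← sum_range_succ]
      exact sum_le_sum_of_subset (range_subset_range.2 hi)
    refine (step ⟨i, hi⟩ s' hf hri ha' (by rw [h7, hgi]; omega)).mono le_rfl ?_
    rintro s'' - - ⟨h7', ha''⟩
    refine ⟨?_, ha''⟩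
    rw [State.setReg_reg, if_neg hx7, h7', h7, hgi, sum_range_succ, add_assoc]
  · rintro s' - - - h
    exact h

/-- Treat all quadruples. -/
def nestP : Program :=
  forP 3 (.reg 0) <| forP 4 (.reg 0) <| forP 5 (.reg 0) <| forP 6 (.reg 0) bodyP

/-- A bound for the running time of `nestP` per leaf of the branching trees. -/
def nestTime (M b : ℕ) : ℕ :=
  forTime M b <| forTime M b <| forTime M b <| forTime M b <| bodyTime M b

theorem adds_nest (hM : n ≤ M) (hb : n + 4 < 2 ^ b) (htop : (5 * n + 1) * ((n + 1) * (n + 1)) < b)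
    (h1 : 1 ≤ L)
    (hL : ∀ q, Valid G q →
      (root (ad G) (2 ^ (5 * n + 1)) (2 ^ ((5 * n + 1) * (n + 1))) q).leaves n ≤ L)
    {s : State} (h0 : s.reg 0 = n) (hX : s.reg 8 = 2 ^ (5 * n + 1))
    (hY : s.reg 9 = 2 ^ ((5 * n + 1) * (n + 1)))
    (hA : ∀ x y : Fin n, s.arr 0 (x * n + y) = ad G x y) :
    Adds b (L * nestTime M b) (grand G) nestP s := by
  classical
  have hXY : 2 ^ (5 * n + 1) ≤ 2 ^ ((5 * n + 1) * (n + 1)) :=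
    Nat.pow_le_pow_right (by norm_num) (Nat.le_mul_of_pos_right _ (by omega))
  have hYb : 2 ^ ((5 * n + 1) * (n + 1)) < 2 ^ b :=
    Nat.pow_lt_pow_right (by norm_num) (lt_of_le_of_lt
      (Nat.mul_le_mul_left _ (Nat.le_mul_of_pos_right _ (by omega))) htop)
  have hpot : ∀ q, 2 ^ (n + 1) *
      (root (ad G) (2 ^ (5 * n + 1)) (2 ^ ((5 * n + 1) * (n + 1))) q).pot < 2 ^ b := fun q => by
    calc _ ≤ 2 ^ (n + 1) * (2 ^ ((5 * n + 1) * (n + 1))) ^ n :=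
          Nat.mul_le_mul_left _ (root_pot_le G (by positivity) hXY q)
      _ = 2 ^ (n + 1 + (5 * n + 1) * (n + 1) * n) := by rw [← pow_mul, ← pow_add]
      -- The initial potential has (5n+1)(n+1)n bits, n steps add n, and one more doubling covers an
      -- intermediate step; together this is at most (5n+1)(n+1)².
      _ < 2 ^ b := Nat.pow_lt_pow_right (by norm_num) (lt_of_le_of_lt (by nlinarith) htop)
  have hgrand : grand G = ∑ a, ∑ a', ∑ c, ∑ c', if Valid G (a, a', c, c') then
      (root (ad G) (2 ^ (5 * n + 1)) (2 ^ ((5 * n + 1) * (n + 1))) (a, a', c, c')).Z else 0 := by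
    rw [grand, sum_filter]
    simp only [Fintype.sum_prod_type]
  rw [hgrand]
  refine adds_for rfl (by decide) rfl h0 hM (by omega) h1 _ fun a s₁ hf₁ ha => ?_
  have h0₁ := (hf₁.reg 0 rfl).trans h0
  refine adds_for rfl (by decide) rfl h0₁ hM (by omega) h1 _ fun a' s₂ hf₂ ha' => ?_
  have h0₂ := (hf₂.reg 0 rfl).trans h0₁
  refine adds_for rfl (by decide) rfl h0₂ hM (by omega) h1 _ fun c s₃ hf₃ hc => ?_
  have h0₃ := (hf₃.reg 0 rfl).trans h0₂
  refine adds_for rfl (by decide) rfl h0₃ hM (by omega) h1 _ fun c' s₄ hf₄ hc' => ?_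
  refine adds_body hM hb hXY hYb (hpot _) h1 (hL _) ⟨(hf₄.reg 0 rfl).trans h0₃, ?_, ?_, ?_, hc',
    ?_, ?_, ?_⟩
  · rw [hf₄.reg 3 rfl, hf₃.reg 3 rfl, hf₂.reg 3 rfl, ha]
  · rw [hf₄.reg 4 rfl, hf₃.reg 4 rfl, ha']
  · rw [hf₄.reg 5 rfl, hc]
  · rw [hf₄.reg 8 rfl, hf₃.reg 8 rfl, hf₂.reg 8 rfl, hf₁.reg 8 rfl, hX]
  · rw [hf₄.reg 9 rfl, hf₃.reg 9 rfl, hf₂.reg 9 rfl, hf₁.reg 9 rfl, hY]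
  · rw [hf₄.arr 0 rfl, hf₃.arr 0 rfl, hf₂.arr 0 rfl, hf₁.arr 0 rfl]
    exact hA

/-! ### Powers of two, and reading off the answer -/

/-- Compute the powers of two and the weights. -/
def preP : Program :=
  .seq (.assign 30 (.add (.mul (.const 5) (.reg 0)) (.const 1))) <|
  .seq (.assign 31 (.mul (.reg 30) (.mul (.add (.reg 0) (.const 1)) (.add (.reg 0) (.const 1))))) <|
  .seq (.write 10 (.const 0) (.const 1)) <|
  .seq (forP 32 (.reg 31) (.write 10 (.add (.reg 32) (.const 1))
    (.add (.read 10 (.reg 32)) (.read 10 (.reg 32))))) <|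
  .seq (.assign 8 (.read 10 (.reg 30))) <|
  .assign 9 (.read 10 (.mul (.reg 30) (.add (.reg 0) (.const 1))))

/-- The memory holds the powers of two. -/
structure Pows (n : ℕ) (s : State) : Prop where
  w : s.reg 30 = 5 * n + 1
  top : s.reg 31 = (5 * n + 1) * ((n + 1) * (n + 1))
  pow : ∀ j ≤ (5 * n + 1) * ((n + 1) * (n + 1)), s.arr 10 j = 2 ^ j

/-- Expressions have no exponentiation, so all powers of two that are needed later are tabulated by
repeated doubling. -/
theorem ok_pre (htop : (5 * n + 1) * ((n + 1) * (n + 1)) < b)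
    (hM : (5 * n + 1) * ((n + 1) * (n + 1)) ≤ M) {s : State} (h0 : s.reg 0 = n) {Q : State → Prop}
    (hQ : ∀ s', Frame preP s s' → Bdd b s' → Pows n s' → s'.reg 8 = 2 ^ (5 * n + 1) →
      s'.reg 9 = 2 ^ ((5 * n + 1) * (n + 1)) → Q s') : Ok M b preP s Q := by
  have hw : 5 * n + 1 ≤ (5 * n + 1) * (n + 1) := Nat.le_mul_of_pos_right _ (by omega)
  have hw' : (5 * n + 1) * (n + 1) ≤ (5 * n + 1) * ((n + 1) * (n + 1)) := by nlinarith
  refine Ok.mono (Q := fun s' => Pows n s' ∧ s'.reg 8 = 2 ^ (5 * n + 1) ∧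
      s'.reg 9 = 2 ^ ((5 * n + 1) * (n + 1))) ?_ fun s' h1 h2 h3 => hQ s' h1 h2 h3.1 h3.2.1 h3.2.2
  have hlt := htop.trans (Nat.lt_two_pow_self (n := b))
  refine ok_seq (ok_assign' (v := 5 * n + 1) (by simp [Term.val, h0]) (by omega) ?_)
  refine ok_seq (ok_assign' (v := (5 * n + 1) * ((n + 1) * (n + 1))) (by simp [Term.val, h0])
    hlt ?_)
  refine ok_seq (ok_write' (j := 0) (v := 1) rfl rfl (by omega) ?_)
  set t := (5 * n + 1) * ((n + 1) * (n + 1)) with ht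
  set u := (5 * n + 1) * (n + 1) with hu
  refine ok_seq (ok_for t (fun i s' => ∀ j ≤ i, s'.arr 10 j = 2 ^ j) hM hlt rfl
    (fun s' hf => by simpa [Term.val] using hf.reg 31 rfl) (by simp) ?_ ?_)
  · intro i hi s' _ _ hri hI
    refine ok_write' (j := i + 1) (v := 2 ^ (i + 1)) (by simp [Term.val, hri]) ?_
      (Nat.pow_lt_pow_right (by norm_num) (by omega)) ?_
    · simp only [Term.val, hri, hI i le_rfl]; ring
    · intro j hj
      rcases Nat.lt_or_ge i j with h | h
      · have : j = i + 1 := by omega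
        simp [this]
      · simp [hI j h, show j ≠ i + 1 by omega]
  · intro s' hf _ _ hI
    have h30 : s'.reg 30 = 5 * n + 1 := by simpa using hf.reg 30 rfl
    have h31 : s'.reg 31 = t := by simpa using hf.reg 31 rfl
    have h00 : s'.reg 0 = n := by simpa [h0] using hf.reg 0 rfl
    refine ok_seq (ok_assign' (v := 2 ^ (5 * n + 1)) ?_
      (Nat.pow_lt_pow_right (by norm_num) (by omega)) ?_)
    · simp only [Term.val, h30]; exact hI _ (by omega)
    refine ok_assign' (v := 2 ^ u) ?_ (Nat.pow_lt_pow_right (by norm_num) (by omega)) ?_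
    · simpa [Term.val, h30, h00] using hI u hw'
    · exact ⟨⟨by simpa using h30, by simpa using h31, hI⟩, by simp, by simp⟩

/-- Read off the answer from register 7. -/
def decP : Program :=
  .seq (.assign 33 (.mul (.reg 30) (.add (.reg 1) (.mul (.add (.reg 0) (.const 1)) (.reg 2))))) <|
  .seq (.assign 34 (.add (.reg 33) (.reg 30))) <|
  .seq (forP 32 (.sub (.reg 31) (.reg 34)) <|
    .seq (.assign 35 (.read 10 (.sub (.sub (.reg 31) (.const 1)) (.reg 32)))) <|
      .ite (.sub (.add (.reg 7) (.const 1)) (.reg 35)) (.assign 7 (.sub (.reg 7) (.reg 35)))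
        .skip) <|
  .seq (.assign 35 (.read 10 (.reg 33))) <|
  .ite (.sub (.add (.reg 7) (.const 1)) (.reg 35)) (.assign 0 (.const 1)) (.assign 0 (.const 0))

/-- Passing from modulus 2^(e+1) to 2^e takes at most one subtraction. This replaces division, which
the machine lacks. -/
theorem mod_two_pow (a e : ℕ) :
    a % 2 ^ e = if 2 ^ e ≤ a % 2 ^ (e + 1) then a % 2 ^ (e + 1) - 2 ^ e else a % 2 ^ (e + 1) := by
  have h1 : a % 2 ^ (e + 1) < 2 ^ (e + 1) := Nat.mod_lt _ (by positivity)
  rw [← Nat.mod_mod_of_dvd a (pow_dvd_pow 2 (Nat.le_succ e))]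
  have h2 := pow_succ 2 e
  split_ifs with h
  · rw [Nat.mod_eq_sub_mod h, Nat.mod_eq_of_lt (by omega)]
  · exact Nat.mod_eq_of_lt (not_le.1 h)

open Classical in
theorem ok_dec {k₁ k₂ : ℕ} (hk₁ : k₁ ≤ n) (hk₂ : k₂ ≤ n)
    (htop : (5 * n + 1) * ((n + 1) * (n + 1)) < b)
    (hM : (5 * n + 1) * ((n + 1) * (n + 1)) ≤ M) {s : State} (h0 : s.reg 0 = n)
    (h1 : s.reg 1 = k₁) (h2 : s.reg 2 = k₂) (hp : Pows n s)
    (h7 : s.reg 7 < 2 ^ ((5 * n + 1) * ((n + 1) * (n + 1)))) :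
    Ok M b decP s fun s' => s'.reg 0 = if 2 ^ ((5 * n + 1) * (k₁ + (n + 1) * k₂)) ≤
      s.reg 7 % 2 ^ ((5 * n + 1) * (k₁ + (n + 1) * k₂ + 1)) then 1 else 0 := by
  have hlt := htop.trans (Nat.lt_two_pow_self (n := b))
  have hhi : (5 * n + 1) * (k₁ + (n + 1) * k₂ + 1) ≤ (5 * n + 1) * ((n + 1) * (n + 1)) := by
    refine Nat.mul_le_mul_left _ ?_
    nlinarith
  have hlo : (5 * n + 1) * (k₁ + (n + 1) * k₂ + 1) = (5 * n + 1) * (k₁ + (n + 1) * k₂) +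
      (5 * n + 1) := by ring
  have h30 := hp.w
  have h31 := hp.top
  have hpow := hp.pow
  set t := (5 * n + 1) * ((n + 1) * (n + 1)) with ht
  set l := (5 * n + 1) * (k₁ + (n + 1) * k₂) with hl
  set h := (5 * n + 1) * (k₁ + (n + 1) * k₂ + 1) with hh
  refine ok_seq (ok_assign' (v := l) (by simp [Term.val, h0, h1, h2, h30, hl]) (by omega) ?_)
  refine ok_seq (ok_assign' (v := h) (by simp [Term.val, h30, hlo]) (by omega) ?_)
  -- The powers 2^(t-1), …, 2^h are subtracted from the top down whenever they fit, which leaves the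
  -- residue modulo 2^h.
  refine ok_seq (ok_for (t - h) (fun i s' => s'.reg 7 = s.reg 7 % 2 ^ (t - i)) (by omega)
    (by omega) rfl (fun s' hf => ?_) ?_ ?_ ?_)
  · have e1 : s'.reg 31 = t := by simpa [h31] using hf.reg 31 rfl
    have e2 : s'.reg 34 = h := by simpa using hf.reg 34 rfl
    simp [Term.val, e1, e2]
  · simpa using (Nat.mod_eq_of_lt h7).symm
  · intro i hi s' hf hbd hri hI
    have e1 : s'.reg 31 = t := by simpa [h31] using hf.reg 31 rfl
    have e2 : s'.arr 10 = s.arr 10 := by simpa using hf.arr 10 rfl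
    obtain ⟨e, he⟩ : ∃ e, t - i = e + 1 := ⟨t - i - 1, by omega⟩
    have he' : t - (i + 1) = e := by omega
    rw [he] at hI
    rw [he', mod_two_pow]
    have hlt7 := hbd.reg 7
    rw [hI] at hlt7
    refine ok_seq (ok_assign' (v := 2 ^ e) ?_ (Nat.pow_lt_pow_right (by norm_num) (by omega)) ?_)
    · simp only [Term.val, e1, hri, e2]
      rw [hpow _ (by omega)]
      congr 1; omega
    refine ok_ite (fun hc => ?_) fun hc => ?_
    -- Truncated subtraction gives strict comparison only; adding 1 first turns it into ≤.
    · have hc' : 2 ^ e ≤ s.reg 7 % 2 ^ (e + 1) := by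
        simp only [Term.val, State.setReg_reg] at hc
        norm_num [hI] at hc
        omega
      rw [if_pos hc']
      exact ok_assign' (v := s.reg 7 % 2 ^ (e + 1) - 2 ^ e) (by simp [Term.val, hI]) (by omega)
        (by simp)
    · have hc' : ¬ 2 ^ e ≤ s.reg 7 % 2 ^ (e + 1) := by
        simp only [Term.val, State.setReg_reg] at hc
        norm_num [hI] at hc
        omega
      rw [if_neg hc']
      exact ok_skip (by simp [hI])
  · intro s' hf _ _ hI
    have e2 : s'.arr 10 = s.arr 10 := by simpa using hf.arr 10 rfl
    have e3 : s'.reg 33 = l := by simpa using hf.reg 33 rfl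
    rw [show t - (t - h) = h by omega] at hI
    refine ok_seq (ok_assign' (v := 2 ^ l) ?_ (Nat.pow_lt_pow_right (by norm_num) (by omega)) ?_)
    · simp only [Term.val, e2, e3]; exact hpow _ (by omega)
    refine ok_ite (fun hc => ?_) fun hc => ?_
    · have hc' : 2 ^ l ≤ s.reg 7 % 2 ^ h := by
        simp only [Term.val, State.setReg_reg] at hc
        norm_num [hI] at hc
        omega
      rw [if_pos hc']
      exact ok_assign' (v := 1) rfl (by omega) (by simp)
    · have hc' : ¬ 2 ^ l ≤ s.reg 7 % 2 ^ h := by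
        simp only [Term.val, State.setReg_reg] at hc
        norm_num [hI] at hc
        omega
      rw [if_neg hc']
      exact ok_assign' (v := 0) rfl (by omega) (by simp)

/-! ### The whole program -/

/-- The program for Induced `(k₁, k₂)`-Biclique. -/
def mainP : Program :=
  .ite (.sub (.reg 2) (.reg 0)) (.assign 0 (.const 0)) (.seq preP (.seq nestP decP))

/-- A bound for the running time of `mainP` per leaf of the branching trees. -/
def mainTime (M b : ℕ) : ℕ :=
  1 + (Term.sub (.reg 2) (.reg 0)).bound b + ((Program.assign 0 (.const 0)).time M b +
    (preP.time M b + (nestTime M b + decP.time M b)))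

theorem bicliqueInput_arr (k₁ k₂ : ℕ) (x y : Fin n) :
    (bicliqueInput G k₁ k₂).arr 0 (x * n + y) = ad G x y := by
  simp only [bicliqueInput, ad]
  congr 1
  refine propext ⟨?_, fun h => ⟨rfl, x, y, rfl, h⟩⟩
  rintro ⟨-, u, v, huv, h⟩
  have hn : 0 < n := x.pos
  have h1 : x = u := by
    have := congrArg (· / n) huv
    simp only [mul_comm _ n, Nat.mul_add_div hn, Nat.div_eq_of_lt y.isLt,
      Nat.div_eq_of_lt v.isLt, add_zero] at this
    exact Fin.ext this
  have h2 : y = v := by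
    have := congrArg (· % n) huv
    simp only [Nat.mul_add_mod_self_right, Nat.mod_eq_of_lt y.isLt, Nat.mod_eq_of_lt v.isLt] at this
    exact Fin.ext this
  rwa [h1, h2]

open Classical in
theorem okT_main {k₁ k₂ : ℕ} (h1 : 2 ≤ k₁) (hk : k₁ ≤ k₂) (hb : n + 4 < 2 ^ b)
    (htop : (5 * n + 1) * ((n + 1) * (n + 1)) < b)
    (hM : (5 * n + 1) * ((n + 1) * (n + 1)) ≤ M) (hL1 : 1 ≤ L)
    (hL : ∀ q, Valid G q →
      (root (ad G) (2 ^ (5 * n + 1)) (2 ^ ((5 * n + 1) * (n + 1))) q).leaves n ≤ L) :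
    OkT b mainP (bicliqueInput G k₁ k₂) (L * mainTime M b)
      fun s' => s'.reg 0 = if G.HasInducedBiclique k₁ k₂ then 1 else 0 := by
  have hnM : n ≤ M := le_trans (by nlinarith) hM
  set s := bicliqueInput G k₁ k₂ with hs
  have r0 : s.reg 0 = n := rfl
  have r1 : s.reg 1 = k₁ := rfl
  have r2 : s.reg 2 = k₂ := rfl
  refine OkT.mono (T := 1 + (Term.sub (.reg 2) (.reg 0)).bound b +
    ((Program.assign 0 (.const 0)).time M b +
    (preP.time M b + (L * nestTime M b + decP.time M b)))) (okT_ite (fun h => ?_) fun h => ?_) ?_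
    fun _ _ _ h => h
  · have hlt : n < k₂ := by
      simp only [Term.val, r0, r2] at h; omega
    -- If k₂ exceeds n the answer is no at once. This keeps the digit index polynomial in n,
    -- although k₁ and k₂ are given in binary.
    have hno : ¬ G.HasInducedBiclique k₁ k₂ := by
      rintro ⟨S, T, -, -, hT, -⟩
      have := card_le_univ T
      rw [hT, Fintype.card_fin] at this
      omega
    rw [if_neg hno]
    exact OkT.mono (ok_assign' (M := M) (v := 0) rfl (by omega) (by simp)) (Nat.le_add_right _ _)
      fun _ _ _ h => h
  · have hle : k₂ ≤ n := by
      simp only [Term.val, r0, r2] at h; omega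
    refine OkT.mono (okT_seq (ok_pre htop hM r0 ?_)) (Nat.le_add_left _ _) fun _ _ _ h => h
    intro s₁ hf₁ _ hp hX hY
    have h0 := (hf₁.reg 0 rfl).trans r0
    refine okT_seq ((adds_nest hnM hb htop hL1 hL h0 hX hY (fun x y => ?_) ?_ ?_).mono le_rfl ?_)
    · rw [hf₁.arr 0 rfl]; exact bicliqueInput_arr k₁ k₂ x y
    · rw [hf₁.arr 1 rfl]; funext i; simp [hs, bicliqueInput]
    · rw [hf₁.reg 7 rfl, show s.reg 7 = 0 from rfl, zero_add]
      exact (grand_lt G).trans (Nat.pow_lt_pow_right (by norm_num) htop)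
    · rintro s₂ hf₂ - ⟨h7, -⟩
      rw [hf₁.reg 7 rfl, show s.reg 7 = 0 from rfl, zero_add] at h7
      have hdec := ok_dec (M := M) (hk.trans hle) hle htop hM ((hf₂.reg 0 rfl).trans h0)
        ((hf₂.reg 1 rfl).trans ((hf₁.reg 1 rfl).trans r1))
        ((hf₂.reg 2 rfl).trans ((hf₁.reg 2 rfl).trans r2))
        (s := s₂) ⟨(hf₂.reg 30 rfl).trans hp.w, (hf₂.reg 31 rfl).trans hp.top, by
          rw [hf₂.arr 10 rfl]; exact hp.pow⟩ (by rw [h7]; exact grand_lt G)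
      rw [h7] at hdec
      simp only [grand_iff h1 (h1.trans hk) (hk.trans hle)] at hdec
      exact hdec
  · unfold mainTime
    obtain ⟨l, rfl⟩ : ∃ l, L = l + 1 := ⟨L - 1, by omega⟩
    have := Nat.zero_le (l * (1 + (Term.sub (.reg 2) (.reg 0)).bound b +
      ((Program.assign 0 (.const 0)).time M b + (preP.time M b + decP.time M b))))
    linarith

theorem polyBdd_mainTime {M b : ℕ → ℕ} (hM : PolyBdd M) (hb : PolyBdd b) :
    PolyBdd fun m => mainTime (M m) (b m) := by
  have hfor : ∀ {T : ℕ → ℕ}, PolyBdd T → PolyBdd fun m => forTime (M m) (b m) (T m) := fun hT =>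
    ((PolyBdd.const 1).add (hb.bound _)).add ((hM.add (PolyBdd.const 1)).mul
      (((PolyBdd.const 1).add (hb.bound _)).add (hT.add ((PolyBdd.const 1).add (hb.bound _)))))
  have hbody : PolyBdd fun m => bodyTime (M m) (b m) :=
    ((PolyBdd.const 1).add (hb.bound _)).add (((PolyBdd.const 1).add (hb.bound _)).add
      ((PolyBdd.const 2).mul (((PolyBdd.const 1).add (hb.bound _)).add (hM.time hb _))))
  exact ((PolyBdd.const 1).add (hb.bound _)).add ((hM.time hb _).add ((hM.time hb _).add
    ((hfor (hfor (hfor (hfor hbody)))).add (hM.time hb _))))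

theorem bicliqueInput_bdd {k₁ k₂ : ℕ} (hn : n < 2 ^ b) (h1 : k₁ < 2 ^ b) (h2 : k₂ < 2 ^ b)
    (hb : 1 < 2 ^ b) : Bdd b (bicliqueInput G k₁ k₂) := by
  refine ⟨fun x => ?_, fun a i => ?_⟩
  · simp only [bicliqueInput]; split_ifs <;> omega
  · simp only [bicliqueInput]; split_ifs <;> omega

end InducedBiclique

/-! ### The main theorem. -/

theorem mainTheorem9 :
    ∃ (P : RAM.Program) (p : Polynomial ℕ),
      ∀ (n : ℕ) (G : SimpleGraph (Fin n)) (k₁ k₂ c : ℕ),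
        G.IsCClosed c → 2 ≤ k₁ → k₁ ≤ k₂ →
          ∃ (t : ℕ) (s : RAM.State),
            RAM.Runs P (bicliqueInput G k₁ k₂) t s ∧
            (s.reg 0 = 0 ∨ s.reg 0 = 1) ∧
            (s.reg 0 = 1 ↔ G.HasInducedBiclique k₁ k₂) ∧
            (t : ℝ) ≤ (1.6107 : ℝ) ^ c * ((p.eval (bicliqueInputSize n k₁ k₂) : ℕ) : ℝ) := by
  classical
  have hM : RAM.PolyBdd fun m => (5 * m + 1) * ((m + 1) * (m + 1)) :=
    (((RAM.PolyBdd.const 5).mul .id).add (.const 1)).mul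
      ((RAM.PolyBdd.id.add (.const 1)).mul (RAM.PolyBdd.id.add (.const 1)))
  -- This word length exceeds the bit length of the sum of all partition functions, and it also
  -- accommodates the input and the loop counters.
  have hb : RAM.PolyBdd fun m => (5 * m + 1) * ((m + 1) * (m + 1)) + m + 4 :=
    (hM.add .id).add (.const 4)
  obtain ⟨p, hp⟩ := InducedBiclique.polyBdd_mainTime hM hb
  refine ⟨InducedBiclique.mainP, p, fun n G k₁ k₂ c hc h1 hk => ?_⟩
  have hm := hp (bicliqueInputSize n k₁ k₂)
  have hsq : n ≤ n ^ 2 := Nat.le_self_pow (by norm_num) n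
  have hn : n ≤ bicliqueInputSize n k₁ k₂ := by unfold bicliqueInputSize; omega
  have hk₁ : k₁.size ≤ bicliqueInputSize n k₁ k₂ := by unfold bicliqueInputSize; omega
  have hk₂ : k₂.size ≤ bicliqueInputSize n k₁ k₂ := by unfold bicliqueInputSize; omega
  set m := bicliqueInputSize n k₁ k₂
  have htop : (5 * n + 1) * ((n + 1) * (n + 1)) ≤ (5 * m + 1) * ((m + 1) * (m + 1)) := by gcongr
  set M := (5 * m + 1) * ((m + 1) * (m + 1))
  have hlt := Nat.lt_two_pow_self (n := M + m + 4)
  -- The number of leaves is an integer, so its real bound may be rounded down; the result is still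
  -- at least 1.
  have hL1 : 1 ≤ ⌊(1.6107 : ℝ) ^ c⌋₊ :=
    Nat.le_floor (by simpa using one_le_pow₀ (by norm_num : (1 : ℝ) ≤ 1.6107))
  obtain ⟨t, s, hr, ht, -, hs⟩ := InducedBiclique.okT_main (G := G) (M := M) (b := M + m + 4)
    h1 hk (by omega) (by omega) htop hL1
    (fun q hq => Nat.le_floor (InducedBiclique.root_leaves_le hc hq))
    (InducedBiclique.bicliqueInput_bdd (by omega) (Nat.size_le.1 (by omega))
      (Nat.size_le.1 (by omega)) (by omega))
  refine ⟨t, s, hr, ?_, ?_, ?_⟩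
  · rw [hs]; split_ifs <;> simp
  · rw [hs]; split_ifs with h <;> simp [h]
  · calc (t : ℝ) ≤ ((⌊(1.6107 : ℝ) ^ c⌋₊ * p.eval m : ℕ) : ℝ) :=
          Nat.cast_le.2 (ht.trans (Nat.mul_le_mul_left _ hm))
      _ ≤ _ := by
          rw [Nat.cast_mul]
          exact mul_le_mul_of_nonneg_right (Nat.floor_le (by positivity)) (Nat.cast_nonneg _)
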